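/- **Model.** Let $\mathcal T$ be a finite set of types, $\lambda_i,\mu_i>0$ and $r_{ij}\in\mathbb R$ for $i,j\in\mathcal T$; write $\mathcal I=(\mathcal T,\lambda,\mu,r)$. From time $0$ on, agents of type $i$ arrive according to a Poisson process of rate $\lambda_i$, independently across types; an agent of type $i$ that is not matched departs after an independent exponential time of mean $1/\mu_i$. A match of an earlier-arriving agent of type $i$ with a later-arriving agent of type $j$ earns $r_{ij}$. A greedy policy $\pi$ is given by strict total orders $\succ_j$ on $\mathcal T\cup\{\emptyset\}$, $j\in\mathcal T$: an arriving agent of type $j$ is immediately matched with a present agent of the $\succ_j$-best type among the present types $i$ with $i\succ_j\emptyset$ (among agents of that type, the earliest-arriving one), and joins the pool if there is no such type. The system starts empty. Let $N_i^\pi(t)$ be the number of agents of type $i$ present at time $t$, let $n_i^\pi=\lim_{t\to\infty}\mathbb E[N_i^\pi(t)]$, let $N^\pi$ have the steady-state (limiting) distribution of $N^\pi(t)=(N^\pi_i(t))_{i\in\mathcal T}$, let $V(\pi,\mathcal I,t)$ be $\frac1t$ times the expected total reward of the matches made before time $t$, and let $V(\pi,\mathcal I)=\lim_{t\to\infty}V(\pi,\mathcal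 I,t)$. A prefix of $\succ_j$ is a set $\{i\}\cup\{k\in\mathcal T: k\succ_j i\}$ with $i\succ_j\emptyset$. **Linear program.** Let $\mathcal M\subseteq\mathcal T\times\mathcal T$, $T(\mathcal M,j)=\{i:(i,j)\in\mathcal M\}$, and for nonempty $S\subseteq\mathcal T$ let $$\gamma_S=\frac{1-e^{-\sum_{i\in S}\lambda_i/\mu_i}}{\sum_{i\in S}\lambda_i/\mu_i}.$$ Let $\mathrm{LP}^{\mathrm{ALG}}(\mathcal I,\mathcal M)$ be the maximum of $\sum_{(i,j)\in\mathcal M}r_{ij}x_{ij}$ over real $(n_i)_{i\in\mathcal T}$, $(x_{ij})_{(i,j)\in\mathcal M}$ and $(\psi_{Sj})_{j\in\mathcal T,\ \emptyset\ne S\subseteq T(\mathcal M,j)}$ subject to $$n_i\mu_i+\sum_{j:(i,j)\in\mathcal M}x_{ij}+\sum_{j:(j,i)\in\mathcal M}x_{ji}=\lambda_i\quad(i\in\mathcal T),$$ $$\sum_{i\in S}x_{ij}+\psi_{Sj}=\lambda_j\gamma_S\sum_{i\in S}n_i\quad(j\in\mathcal T,\ \emptyset\ne S\subseteq T(\mathcal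 M,j)),$$ $$x_{ij}\ge0,\qquad \psi_{Sj}\ge 0.$$ A basic feasible solution $(n,x,\psi)$ is suitable if $\psi_{Sj}=0$ implies $x_{ij}>0$ for all $i\in S$. A greedy policy $\pi$ corresponds to a suitable solution if, for every $j$, the prefixes of $\succ_j$ are exactly the sets $S$ with $\psi_{Sj}=0$. **Proposition.** Let $(n^*,x^*,\psi^*)$ be an optimal and suitable solution of $\mathrm{LP}^{\mathrm{ALG}}(\mathcal I,\mathcal M)$ and let $\pi$ be a corresponding greedy policy. Suppose that for all $j\in\mathcal T$ and all nonempty $S\subseteq T(\mathcal M,j)$ with $\psi^*_{Sj}=0$, $$\mathbb P\Big(\sum_{i\in S}N_i^\pi>0\Big)\ \ge\ \gamma_S\sum_{i\in S}n_i^\pi .$$ Then the limit $V(\pi,\mathcal I)$ exists and $V(\pi,\mathcal I)\ \ge\ \mathrm{LP}^{\mathrm{ALG}}(\mathcal I,\mathcal M)$. -/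

import Mathlib

open Filter Topology MeasureTheory ProbabilityTheory

/-! ### The model: instances, arrivals and abandonment -/

/-- An instance of the matching problem with abandonment, with finite set of types `T`:
arrival rates `lam i > 0`, abandonment rates `mu i > 0`, and the reward `r i j` of matching an
earlier-arriving agent of type `i` with a later-arriving agent of type `j`. -/
structure MatchingInstance (T : Type*) where
  lam : T → ℝ
  mu : T → ℝ
  r : T → T → ℝ
  lam_pos : ∀ i, 0 < lam i
  mu_pos : ∀ i, 0 < mu i

/-- An agent, recorded by its type `i_a`, its arrival time `t_a`, and the time `d_a` at which it
departs if it has not been matched. -/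
structure Agent (T : Type*) where
  type : T
  arrival : ℝ
  departure : ℝ

/-- Outcomes. The pair `ω (i, k)` consists of the time between the `(k-1)`-st and the `k`-th
arrival of type `i` (from time `0` if `k = 0`) and the maximum sojourn time of the `k`-th agent of
type `i`. -/
abbrev Outcome (T : Type*) : Type _ := T × ℕ → ℝ × ℝ

namespace MatchingInstance

variable {T : Type*} (I : MatchingInstance T)

instance isProbabilityMeasure_lam (i : T) : IsProbabilityMeasure (expMeasure (I.lam i)) :=
  isProbabilityMeasure_expMeasure (I.lam_pos i)

instance isProbabilityMeasure_mu (i : T) : IsProbabilityMeasure (expMeasure (I.mu i)) :=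
  isProbabilityMeasure_expMeasure (I.mu_pos i)

/-- The law of the primitives: all interarrival and sojourn times are independent, the
interarrival times of type `i` are exponential with rate `lam i` (so that type `i` arrives according
to a Poisson process with rate `lam i`), and its sojourn times are exponential with rate `mu i`. -/
noncomputable def law : Measure (Outcome T) :=
  Measure.infinitePi fun a : T × ℕ => (expMeasure (I.lam a.1)).prod (expMeasure (I.mu a.1))

/-- `γ_S = (1 - exp (-∑_{i ∈ S} λ_i / μ_i)) / ∑_{i ∈ S} λ_i / μ_i` (used for nonempty `S`). -/
noncomputable def gamma (S : Finset T) : ℝ :=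
  (1 - Real.exp (-∑ i ∈ S, I.lam i / I.mu i)) / ∑ i ∈ S, I.lam i / I.mu i

end MatchingInstance

section History

variable {T : Type*}

/-- The arrival time of the `k`-th agent of type `i`, where `a = (i, k)`. -/
noncomputable def arrivalTime (ω : Outcome T) (a : T × ℕ) : ℝ :=
  ∑ l ∈ Finset.range (a.2 + 1), (ω (a.1, l)).1

/-- The agent with index `a = (i, k)`: type `i`, arrival time `t_a`, departure time `t_a + s_a`. -/
noncomputable def agentOf (ω : Outcome T) (a : T × ℕ) : Agent T :=
  ⟨a.1, arrivalTime ω a, arrivalTime ω a + (ω a).2⟩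

/-- The indices of the agents who arrive before time `t`. -/
def arrivedBefore (ω : Outcome T) (t : ℝ) : Set (T × ℕ) := {a | arrivalTime ω a < t}

open scoped Classical in
/-- The history up to time `t`: the agents who arrive before time `t`, listed in order of arrival.
(Almost surely there are finitely many, and no two arrive at the same time; on the null event that
there are infinitely many, the history is the empty list by convention.) -/
noncomputable def history (ω : Outcome T) (t : ℝ) : List (Agent T) :=
  if h : (arrivedBefore ω t).Finite then
    (h.toFinset.toList.map (agentOf ω)).insertionSort (fun a b => a.arrival ≤ b.arrival)
  else []

end History

/-! ### Greedy policies -/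

/-- A greedy policy: for each type `j` a strict total order `≻_j` on `T ∪ {∅}`, where `none` stands
for `∅`, and `prefers j u v` means `u ≻_j v`. -/
structure GreedyPolicy (T : Type*) where
  prefers : T → Option T → Option T → Prop
  isStrictTotalOrder : ∀ j, IsStrictTotalOrder (Option T) (prefers j)

/-- The agents waiting in the pool (in order of arrival) and the matches made so far; a match is a
pair (earlier-arriving agent, later-arriving agent). -/
structure SystemState (T : Type*) where
  pool : List (Agent T)
  matched : List (Agent T × Agent T)

namespace GreedyPolicy

variable {T : Type*} (π : GreedyPolicy T)

open scoped Classical in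
/-- The agent in `pool` with whom an arriving agent of type `j` is matched, if there is one: an
agent of the most preferred type among the types in the pool that are acceptable to `j`. Among
several agents of that type, the first in the list is taken. -/
noncomputable def partner (j : T) (pool : List (Agent T)) : Option (Agent T) :=
  pool.find? fun a =>
    decide (π.prefers j (some a.type) none ∧ ∀ c ∈ pool, ¬ π.prefers j (some c.type) (some a.type))

open scoped Classical in
/-- The arrival of the agent `b`: the agents who have abandoned before that time are removed, and
then `b` is matched with an agent in the pool, or joins the pool if no acceptable type is there. -/
noncomputable def step (σ : SystemState T) (b : Agent T) : SystemState T :=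
  let pool := σ.pool.filter fun a => decide (b.arrival ≤ a.departure)
  match π.partner b.type pool with
  | none => ⟨pool ++ [b], σ.matched⟩
  | some a => ⟨pool.erase a, (a, b) :: σ.matched⟩

/-- The system after all arrivals in the history `h`, starting from the empty system. -/
noncomputable def run (h : List (Agent T)) : SystemState T := h.foldl π.step ⟨[], []⟩

open scoped Classical in
/-- `N_i^π(t)`: the number of agents of type `i` who arrived before time `t` and have neither been
matched nor abandoned before time `t`. -/
noncomputable def present (ω : Outcome T) (t : ℝ) (i : T) : ℕ :=
  ((π.run (history ω t)).pool.filter fun a => decide (a.type = i ∧ t ≤ a.departure)).length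

/-- The total reward of the matches made before time `t`. -/
noncomputable def totalReward (I : MatchingInstance T) (ω : Outcome T) (t : ℝ) : ℝ :=
  ((π.run (history ω t)).matched.map fun p => I.r p.1.type p.2.type).sum

/-- `V(π, I, t)`, the expected reward rate by time `t`. -/
noncomputable def valueAt (I : MatchingInstance T) (t : ℝ) : ℝ :=
  (1 / t) * ∫ ω, π.totalReward I ω t ∂I.law

/-- `V(π, I) = lim_{t → ∞} V(π, I, t)`. -/
noncomputable def value (I : MatchingInstance T) : ℝ := limUnder atTop (π.valueAt I)

/-- `n_i^π = lim_{t → ∞} E[N_i^π(t)]`. -/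
noncomputable def meanPresent (I : MatchingInstance T) (i : T) : ℝ :=
  limUnder atTop fun t : ℝ => ∫ ω, (π.present ω t i : ℝ) ∂I.law

/-- The steady-state distribution of the chain `N^π(t)`: it gives the state `m` the mass
`lim_{t → ∞} P(N^π(t) = m)`. -/
noncomputable def steadyState (I : MatchingInstance T) : Measure (T → ℕ) :=
  Measure.sum fun m : T → ℕ =>
    ENNReal.ofReal (limUnder atTop fun t : ℝ => I.law.real {ω | π.present ω t = m}) •
      Measure.dirac m

/-- The set of prefixes of `≻_j`: the sets `{i} ∪ {k | k ≻_j i}` with `i ≻_j ∅`. -/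
def prefixes (j : T) : Set (Finset T) :=
  {S | ∃ i, π.prefers j (some i) none ∧
    ∀ k, k ∈ S ↔ k = i ∨ π.prefers j (some k) (some i)}

end GreedyPolicy

/-! ### The linear program associated with a set of matches -/

/-- The pairs `(S, j)` that index slack variables and match-rate constraints: `S` is a nonempty
set of types `i` with `(i, j) ∈ M`, that is, a nonempty subset of `T(M, j)`. -/
def IsSlackIndex {T : Type*} (M : Finset (T × T)) (S : Finset T) (j : T) : Prop :=
  S.Nonempty ∧ ∀ i ∈ S, (i, j) ∈ M

/-- Values of the variables of the linear program. Only `x i j` with `(i, j) ∈ M`, and `psi S j` with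
`(S, j)` a slack index, are variables of the program for `M`; the other values are ignored. -/
structure LPPoint (T : Type*) where
  n : T → ℝ
  x : T → T → ℝ
  psi : Finset T → T → ℝ

namespace LPPoint

variable {T : Type*} [Fintype T] [DecidableEq T]

/-- The constraints of the linear program. -/
structure IsFeasible (I : MatchingInstance T) (M : Finset (T × T)) (p : LPPoint T) : Prop where
  balance : ∀ i, p.n i * I.mu i + ∑ j with (i, j) ∈ M, p.x i j + ∑ j with (j, i) ∈ M, p.x j i
    = I.lam i
  matchRate : ∀ j S, IsSlackIndex M S j →
    ∑ i ∈ S, p.x i j + p.psi S j = I.lam j * I.gamma S * ∑ i ∈ S, p.n i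
  x_nonneg : ∀ i j, (i, j) ∈ M → 0 ≤ p.x i j
  psi_nonneg : ∀ j S, IsSlackIndex M S j → 0 ≤ p.psi S j

/-- The objective function `∑_{(i,j) ∈ M} r_{ij} x_{ij}`. -/
def objective (I : MatchingInstance T) (M : Finset (T × T)) (p : LPPoint T) : ℝ :=
  ∑ m ∈ M, I.r m.1 m.2 * p.x m.1 m.2

/-- An optimal solution of the linear program. -/
def IsOptimal (I : MatchingInstance T) (M : Finset (T × T)) (p : LPPoint T) : Prop :=
  p.IsFeasible I M ∧ ∀ q : LPPoint T, q.IsFeasible I M → q.objective I M ≤ p.objective I M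

end LPPoint

/-- The optimal value of the linear program. -/
noncomputable def lpValue {T : Type*} [Fintype T] [DecidableEq T] (I : MatchingInstance T)
    (M : Finset (T × T)) : ℝ :=
  sSup {v | ∃ p : LPPoint T, p.IsFeasible I M ∧ p.objective I M = v}

/-- Slack indices as a type. -/
abbrev SlackIndex {T : Type*} (M : Finset (T × T)) : Type _ :=
  {s : Finset T × T // IsSlackIndex M s.1 s.2}

/-- The variables of the linear program: `n_i`, `x_{ij}` for `(i, j) ∈ M`, and `ψ_{Sj}`. -/
abbrev LPVar {T : Type*} (M : Finset (T × T)) : Type _ := T ⊕ {m : T × T // m ∈ M} ⊕ SlackIndex M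

/-- The equality constraints: balance for each type, and match rates for each slack index. -/
abbrev LPCon {T : Type*} (M : Finset (T × T)) : Type _ := T ⊕ SlackIndex M

/-- The coefficient matrix of the equality constraints, with all variables on the left. -/
noncomputable def lpMatrix {T : Type*} [DecidableEq T] (I : MatchingInstance T)
    (M : Finset (T × T)) : Matrix (LPCon M) (LPVar M) ℝ
  | .inl i, .inl k => if k = i then I.mu i else 0
  | .inl i, .inr (.inl m) => (if m.1.1 = i then 1 else 0) + (if m.1.2 = i then 1 else 0)
  | .inl _, .inr (.inr _) => 0
  | .inr s, .inl k => if k ∈ s.1.1 then -(I.lam s.1.2 * I.gamma s.1.1) else 0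
  | .inr s, .inr (.inl m) => if m.1.1 ∈ s.1.1 ∧ m.1.2 = s.1.2 then 1 else 0
  | .inr s, .inr (.inr s') => if s' = s then 1 else 0

/-- The right-hand side of the equality constraints. -/
def lpRhs {T : Type*} (I : MatchingInstance T) (M : Finset (T × T)) : LPCon M → ℝ
  | .inl i => I.lam i
  | .inr _ => 0

namespace LPPoint

variable {T : Type*} [Fintype T] [DecidableEq T]

/-- The vector of the variables of the linear program for `M`. -/
def toVec (M : Finset (T × T)) (p : LPPoint T) : LPVar M → ℝ
  | .inl i => p.n i
  | .inr (.inl m) => p.x m.1.1 m.1.2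
  | .inr (.inr s) => p.psi s.1.1 s.1.2

/-- A basic feasible solution: a feasible point such that there is a basis `B` (as many variables
as there are equality constraints, with linearly independent columns, so that the square submatrix of
these columns has full rank) outside of which all variables are zero. -/
def IsBasicFeasible (I : MatchingInstance T) (M : Finset (T × T)) (p : LPPoint T) : Prop :=
  p.IsFeasible I M ∧ ∃ B : Set (LPVar M), B.ncard = Nat.card (LPCon M) ∧
    LinearIndependent ℝ (fun v : B => (lpMatrix I M).col v.1) ∧ ∀ v ∉ B, p.toVec M v = 0

/-- A suitable solution: a basic feasible solution such that `ψ_{Sj} = 0` implies `x_{ij} > 0` for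
all `i ∈ S`. -/
def IsSuitable (I : MatchingInstance T) (M : Finset (T × T)) (p : LPPoint T) : Prop :=
  p.IsBasicFeasible I M ∧
    ∀ j S, IsSlackIndex M S j → p.psi S j = 0 → ∀ i ∈ S, 0 < p.x i j

/-- `π` is the greedy policy corresponding to the solution `p`: for all `j`, the prefixes of `≻_j`
are exactly the sets `S` with `ψ_{Sj} = 0`. -/
def Corresponds (M : Finset (T × T)) (p : LPPoint T) (π : GreedyPolicy T) : Prop :=
  ∀ j, π.prefixes j = {S | IsSlackIndex M S j ∧ p.psi S j = 0}

end LPPoint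

/-! Let `q` be the point read off from the steady state of `π`: `n_i` is the mean number present,
`x_ij` is `λ_j` times the limiting probability that an arriving `j` is matched with an `i`, and `ψ`
is whatever the match-rate equations force. Balance holds by conservation of agents, so `q`
satisfies every equality constraint, and its objective is `V(π)`. It need not be feasible, but it
errs on the right side. If `ψ*_{Sj} = 0`, then `S` is a prefix of `≻_j`, so an arriving `j` is
matched inside `S` exactly when `S` is not empty of agents, and the hypothesis on `γ_S` says `ψ_{Sj}
≤ 0` at `q`. If `x*_ij = 0`, suitability rules out that `i` is acceptable to `j`, so `x_ij = 0` at
`q`. Hence `p + ε (p - q)` is feasible for small `ε > 0`, and optimality of `p` gives `objective p ≤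
objective q` (`IsOptimal.objective_le`).

The rest establishes that the limits exist and satisfy the balance equations.

Rates. An exponential variable `X` of rate `r` satisfies `E h(X) = r E ∫_0^X h`. Applied to one
interarrival time, with the state just before the arrival insensitive to that time, and summed over
agents, this says that arrivals see time averages (`lintegral_tsum_arrivals`). Applied to one
sojourn time it says that type `i` abandons at rate `μ_i E N_i` (`lintegral_abandonCount`). Taking
expectations in the pathwise identity "arrived = present + abandoned + matched" gives
`lintegral_flow`.

Convergence in law. By lack of memory, restarting at time `h` with an independent outcome preserves
the law (`law_map_restart`). The restarted system and a fresh one agree after any moment at which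
all earlier agents would have abandoned even if unmatched. This condition does not involve the
policy, and such a moment comes early with high probability (`tendsto_busyProb`). So the laws of the
state are Cauchy, uniformly over events.

Convergence of means. Convergence in law does not give convergence of `E N_i`. Instead, the flow
identity says that `f = E N_i` solves `f' = g - μ_i f` with `g` built from match probabilities,
which converge; hence `f` converges (`tendsto_of_relaxation`). The reward rate is a time average of
convergent match rates. -/

namespace GreedyPolicy

/-! ### Pool dynamics on abstract lists of labelled agents -/

section Engine

open scoped Classical

variable {T α β : Type*} (π : GreedyPolicy T)

/-- Whether an arriving agent of type `j` is willing to be matched with the element `a` of the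
pool `p`: the type of `a` is acceptable and of the most preferred type present. -/
noncomputable def accepts (ty : α → T) (j : T) (p : List α) (a : α) : Bool :=
  decide (π.prefers j (some (ty a)) none ∧ ∀ c ∈ p, ¬ π.prefers j (some (ty c)) (some (ty a)))

/-- The pool after the arrival of `b`, if `p` is the pool just before. -/
noncomputable def enter (ty : α → T) (p : List α) (b : α) : List α :=
  if p.find? (π.accepts ty (ty b) p) = none then p ++ [b]
  else p.eraseP (π.accepts ty (ty b) p)

/-- The pool after the arrival of `b`, where `live b a` says whether `a` is still willing to wait
when `b` arrives. -/
noncomputable def poolStep (ty : α → T) (live : α → α → Bool) (p : List α) (b : α) : List α :=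
  π.enter ty (p.filter (live b)) b

/-- The pool after the arrivals listed in `l`. -/
noncomputable def poolRun (ty : α → T) (live : α → α → Bool) (l : List α) : List α :=
  l.foldl (π.poolStep ty live) []

/-- The number of elements of type `i` in a list. -/
noncomputable def typeCount (ty : α → T) (p : List α) (i : T) : ℕ :=
  (p.filter fun a => decide (ty a = i)).length

/-- In a pool with `m k` agents of each type `k`, an arriving agent of type `j` is matched with an
agent of type `i`. -/
def IsTop (j i : T) (m : T → ℕ) : Prop :=
  π.prefers j (some i) none ∧ 0 < m i ∧ ∀ k, π.prefers j (some k) (some i) → m k = 0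

variable {π} {ty : α → T} {live : α → α → Bool}

lemma poolRun_append (l l' : List α) :
    π.poolRun ty live (l ++ l') = l'.foldl (π.poolStep ty live) (π.poolRun ty live l) := by
  simp [poolRun]

lemma poolRun_concat (l : List α) (b : α) :
    π.poolRun ty live (l ++ [b]) = π.poolStep ty live (π.poolRun ty live l) b := by
  simp [poolRun]

lemma enter_subset {p : List α} {b a : α} (h : a ∈ π.enter ty p b) : a ∈ p ∨ a = b := by
  unfold enter at h
  split_ifs at h
  · simpa using h
  · exact .inl (List.mem_of_mem_eraseP h)

lemma enter_nodup {p : List α} {b : α} (hp : p.Nodup) (hb : b ∉ p) :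
    (π.enter ty p b).Nodup := by
  unfold enter
  split_ifs
  · exact List.nodup_append.2 ⟨hp, by simp, by rintro a ha c hc rfl; simp_all⟩
  · exact hp.sublist List.eraseP_sublist

lemma mem_of_mem_poolRun {l : List α} {a : α} (h : a ∈ π.poolRun ty live l) : a ∈ l := by
  induction l using List.reverseRecOn with
  | nil => simp [poolRun] at h
  | append_singleton l b ih =>
    rw [poolRun_concat] at h
    rcases enter_subset h with h | h
    · simp [ih (List.mem_of_mem_filter h)]
    · simp [h]

lemma poolRun_nodup {l : List α} (hl : l.Nodup) : (π.poolRun ty live l).Nodup := by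
  induction l using List.reverseRecOn with
  | nil => simp [poolRun]
  | append_singleton l b ih =>
    rw [poolRun_concat]
    rw [List.nodup_append] at hl
    refine enter_nodup ((ih hl.1).filter _) fun hb => ?_
    exact hl.2.2 b (mem_of_mem_poolRun (List.mem_of_mem_filter hb)) b (by simp) rfl

lemma accepts_map (f : α → β) (ty : β → T) (j : T) (p : List α) (a : α) :
    π.accepts ty j (p.map f) (f a) = π.accepts (ty ∘ f) j p a := by
  simp [accepts]

lemma enter_map (f : α → β) (ty : β → T) (p : List α) (b : α) :
    π.enter ty (p.map f) (f b) = (π.enter (ty ∘ f) p b).map f := by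
  have h : π.accepts ty (ty (f b)) (p.map f) ∘ f = π.accepts (ty ∘ f) (ty (f b)) p := by
    ext a; exact accepts_map f ty _ p a
  unfold enter
  rw [List.find?_map, h, List.eraseP_map, h]
  simp only [Option.map_eq_none_iff, Function.comp_apply]
  split_ifs <;> simp

/-- The evolution of the pool commutes with relabelling. -/
lemma poolRun_map (f : α → β) (ty : β → T) (live : β → β → Bool) (l : List α) :
    π.poolRun ty live (l.map f) =
      (π.poolRun (ty ∘ f) (fun b a => live (f b) (f a)) l).map f := by
  induction l using List.reverseRecOn with
  | nil => simp [poolRun]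
  | append_singleton l b ih =>
    rw [List.map_append, List.map_singleton, poolRun_concat, poolRun_concat, ih, poolStep,
      poolStep, ← enter_map, List.filter_map]
    rfl

/-- The evolution of the pool depends only on which of the agents listed are still willing to wait
at the arrivals listed. -/
lemma poolRun_congr {live' : α → α → Bool} {l : List α}
    (h : ∀ b ∈ l, ∀ a ∈ l, live b a = live' b a) :
    π.poolRun ty live l = π.poolRun ty live' l := by
  induction l using List.reverseRecOn with
  | nil => rfl
  | append_singleton l b ih =>
    rw [poolRun_concat, poolRun_concat, ih fun b hb a ha => h b (by simp [hb]) a (by simp [ha]),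
      poolStep, poolStep]
    congr 1
    refine List.filter_congr fun a ha => h b (by simp) a ?_
    simp [mem_of_mem_poolRun ha]

/-- Agents who have all left have no influence on the later evolution of the pool. -/
lemma filter_poolRun_append_of_gone (alive : α → Bool) {l l' : List α}
    (h : ∀ a ∈ l, ∀ b ∈ l', live b a = false) (h' : ∀ a ∈ l, alive a = false) :
    (π.poolRun ty live (l ++ l')).filter alive = (π.poolRun ty live l').filter alive := by
  cases l' with
  | nil =>
    simp only [List.append_nil, poolRun, List.foldl_nil, List.filter_nil]
    rw [List.filter_eq_nil_iff]
    intro a ha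
    simp [h' a (mem_of_mem_poolRun ha)]
  | cons b l' =>
    have : π.poolStep ty live (π.poolRun ty live l) b = π.poolStep ty live [] b := by
      unfold poolStep
      congr 1
      rw [List.filter_nil, List.filter_eq_nil_iff]
      intro a ha
      simp [h a (mem_of_mem_poolRun ha) b (by simp)]
    rw [poolRun_append, List.foldl_cons, this]
    rfl

/-- Links `step`, which erases the partner by equality, to `enter`, which erases by the predicate.
Every element before the one found fails `q` and so differs from it; both operations remove the same
occurrence. -/
lemma eraseP_eq_erase_of_find? [DecidableEq α] {p : List α} {q : α → Bool} {a : α}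
    (h : p.find? q = some a) : p.erase a = p.eraseP q := by
  induction p with
  | nil => simp at h
  | cons c p ih =>
    rw [List.find?_cons] at h
    by_cases hc : q c = true
    · simp only [hc] at h
      obtain rfl : c = a := by simpa using h
      simp [hc]
    · simp only [hc] at h
      have : c ≠ a := by
        rintro rfl
        exact hc (List.find?_some h)
      rw [List.erase_cons_tail (by simpa using this), List.eraseP_cons_of_neg hc, ih h]

lemma typeCount_pos {p : List α} {i : T} : 0 < typeCount ty p i ↔ ∃ a ∈ p, ty a = i := by
  simp [typeCount, List.length_pos_iff_exists_mem]

lemma typeCount_eq_zero {p : List α} {i : T} : typeCount ty p i = 0 ↔ ∀ a ∈ p, ty a ≠ i := by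
  simp [typeCount]

/-- The type of the partner is determined by the numbers of agents of each type. -/
lemma find?_accepts_eq_some_iff {p : List α} {j i : T} :
    ((p.find? (π.accepts ty j p)).map ty = some i) ↔ π.IsTop j i (typeCount ty p) := by
  have := π.isStrictTotalOrder j
  constructor
  · intro h
    rw [Option.map_eq_some_iff] at h
    obtain ⟨a, ha, rfl⟩ := h
    have h1 := List.find?_some ha
    have h2 := List.mem_of_find?_eq_some ha
    simp only [accepts, decide_eq_true_eq] at h1
    refine ⟨h1.1, typeCount_pos.2 ⟨a, h2, rfl⟩, fun k hk => typeCount_eq_zero.2 ?_⟩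
    rintro c hc rfl
    exact h1.2 c hc hk
  · rintro ⟨h1, h2, h3⟩
    obtain ⟨a, ha, rfl⟩ := typeCount_pos.1 h2
    have haa : π.accepts ty j p a = true := by
      simp only [accepts, decide_eq_true_eq]
      exact ⟨h1, fun c hc h => typeCount_eq_zero.1 (h3 _ h) c hc rfl⟩
    cases hf : p.find? (π.accepts ty j p) with
    | none => exact absurd haa (by simpa using List.find?_eq_none.1 hf a ha)
    | some c =>
      have h4 := List.find?_some hf
      have h5 := List.mem_of_find?_eq_some hf
      simp only [accepts, decide_eq_true_eq] at h4 haa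
      simp only [Option.map_some, Option.some.injEq]
      rcases trichotomous_of (π.prefers j) (some (ty c)) (some (ty a)) with h | h | h
      · exact absurd h (haa.2 c h5)
      · simpa using h
      · exact absurd h (h4.2 a ha)

lemma typeCount_append (p p' : List α) (i : T) :
    typeCount ty (p ++ p') i = typeCount ty p i + typeCount ty p' i := by
  simp [typeCount]

lemma typeCount_singleton (a : α) (i : T) :
    typeCount ty [a] i = if ty a = i then 1 else 0 := by
  by_cases h : ty a = i <;> simp [typeCount, h]

lemma typeCount_filter_add (q : α → Bool) (p : List α) (i : T) :
    typeCount ty (p.filter q) i + typeCount ty (p.filter fun a => !q a) i = typeCount ty p i := by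
  induction p with
  | nil => simp [typeCount]
  | cons a p ih =>
    have e : ∀ (a : α) (l : List α), a :: l = [a] ++ l := fun _ _ => rfl
    by_cases h : q a = true
    · rw [List.filter_cons_of_pos h, List.filter_cons_of_neg (by simp [h]), e, typeCount_append,
        e a p, typeCount_append]
      omega
    · rw [List.filter_cons_of_neg h, List.filter_cons_of_pos (by simp [h]), e a (p.filter _),
        typeCount_append, e a p, typeCount_append]
      omega

lemma typeCount_eraseP_of_find? {p : List α} {q : α → Bool} {a : α}
    (h : p.find? q = some a) (i : T) :
    typeCount ty (p.eraseP q) i + (if ty a = i then 1 else 0) = typeCount ty p i := by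
  obtain ⟨hq, as, bs, rfl, has⟩ := List.find?_eq_some_iff_append.1 h
  rw [List.eraseP_append_right _ (by simpa using has), List.eraseP_cons_of_pos hq,
    typeCount_append, typeCount_append, ← typeCount_singleton a i]
  change _ = _ + typeCount ty ([a] ++ bs) i
  rw [typeCount_append]
  omega

/-- The effect of an arrival on the number of agents of type `i`: the arriving agent is matched or
joins the pool. -/
lemma typeCount_enter [Fintype T] (p : List α) (b : α) (i : T) :
    typeCount ty (π.enter ty p b) i + (if π.IsTop (ty b) i (typeCount ty p) then 1 else 0)
        + (if ty b = i then ∑ k, (if π.IsTop (ty b) k (typeCount ty p) then 1 else 0) else 0)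
      = typeCount ty p i + (if ty b = i then 1 else 0) := by
  simp only [← find?_accepts_eq_some_iff]
  unfold enter
  cases hf : p.find? (π.accepts ty (ty b) p) with
  | none => simp [typeCount_append, typeCount_singleton]
  | some a =>
    have := typeCount_eraseP_of_find? (ty := ty) hf i
    simp only [reduceCtorEq, if_false, Option.map_some, Option.some.injEq, Finset.sum_ite_eq,
      Finset.mem_univ, if_true]
    omega

end Engine

end GreedyPolicy

/-! ### Pathwise bookkeeping: matches, abandonments, conservation of agents -/

section Paths

open scoped Classical

variable {T : Type*}

/-- The time at which the agent with index `a` departs if it has not been matched. -/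
noncomputable def departureTime (ω : Outcome T) (a : T × ℕ) : ℝ := arrivalTime ω a + (ω a).2

/-- The indices of the agents who arrive before time `t`, in order of arrival. -/
noncomputable def arrivalOrder (ω : Outcome T) (t : ℝ) : List (T × ℕ) :=
  if h : (arrivedBefore ω t).Finite then
    h.toFinset.toList.insertionSort (fun a b => arrivalTime ω a ≤ arrivalTime ω b)
  else []

/-- Whether the agent `a` has not abandoned when the agent `b` arrives. -/
noncomputable def liveAt (ω : Outcome T) (b a : T × ℕ) : Bool :=
  decide (arrivalTime ω b ≤ departureTime ω a)

/-- The outcomes without coincidences: all interarrival and sojourn times are positive, no two of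
the arrivals and departures take place at the same time, and finitely many agents arrive in finite
time. -/
structure NoCoincidence (ω : Outcome T) : Prop where
  interarrival_pos : ∀ a, 0 < (ω a).1
  sojourn_pos : ∀ a, 0 < (ω a).2
  arrival_injective : Function.Injective (arrivalTime ω)
  arrival_ne_departure : ∀ a b, arrivalTime ω b ≠ departureTime ω a
  finite_arrivedBefore : ∀ t, (arrivedBefore ω t).Finite

/-- Passing to indices makes the lists free of duplicates by construction and lets single agents be
followed when an outcome is changed. Sorting commutes with the relabelling because both orders
compare arrival times. -/
lemma history_eq_map (ω : Outcome T) (t : ℝ) :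
    history ω t = (arrivalOrder ω t).map (agentOf ω) := by
  unfold history arrivalOrder
  split_ifs with h
  · rw [List.map_insertionSort (s := fun a b : Agent T => a.arrival ≤ b.arrival)]
    intros; rfl
  · rfl

lemma mem_arrivalOrder {ω : Outcome T} {t : ℝ} {a : T × ℕ} (h : (arrivedBefore ω t).Finite) :
    a ∈ arrivalOrder ω t ↔ arrivalTime ω a < t := by
  rw [arrivalOrder, dif_pos h, List.mem_insertionSort, Finset.mem_toList, Set.Finite.mem_toFinset]
  rfl

lemma arrivalTime_lt_of_mem {ω : Outcome T} {t : ℝ} {a : T × ℕ} (h : a ∈ arrivalOrder ω t) :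
    arrivalTime ω a < t := by
  by_cases hf : (arrivedBefore ω t).Finite
  · exact (mem_arrivalOrder hf).1 h
  · simp [arrivalOrder, hf] at h

lemma arrivalOrder_nodup (ω : Outcome T) (t : ℝ) : (arrivalOrder ω t).Nodup := by
  unfold arrivalOrder
  split_ifs with h
  · exact (List.perm_insertionSort _ _).nodup_iff.2 (Finset.nodup_toList _)
  · exact List.nodup_nil

lemma pairwise_arrivalOrder {ω : Outcome T} (hω : Function.Injective (arrivalTime ω)) (t : ℝ) :
    (arrivalOrder ω t).Pairwise fun a b => arrivalTime ω a < arrivalTime ω b := by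
  have hs : (arrivalOrder ω t).Pairwise fun a b => arrivalTime ω a ≤ arrivalTime ω b := by
    have : Std.Total (fun a b : T × ℕ => arrivalTime ω a ≤ arrivalTime ω b) :=
      ⟨fun a b => le_total _ _⟩
    have : IsTrans (T × ℕ) (fun a b : T × ℕ => arrivalTime ω a ≤ arrivalTime ω b) :=
      ⟨fun a b c => le_trans⟩
    unfold arrivalOrder
    split_ifs
    · exact List.pairwise_insertionSort _ _
    · exact List.Pairwise.nil
  exact (hs.and (arrivalOrder_nodup ω t)).imp fun h => lt_of_le_of_ne h.1 fun e => h.2 (hω e)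

/-- The order of arrival is determined by being sorted and by its elements. -/
lemma eq_arrivalOrder {ω : Outcome T} (hω : NoCoincidence ω) {t : ℝ} {l : List (T × ℕ)}
    (hl : l.Pairwise fun a b => arrivalTime ω a < arrivalTime ω b)
    (hm : ∀ a, a ∈ l ↔ arrivalTime ω a < t) : l = arrivalOrder ω t := by
  have : Std.Antisymm (fun a b : T × ℕ => arrivalTime ω a < arrivalTime ω b) :=
    ⟨fun a b h h' => absurd h' h.asymm⟩
  refine List.Perm.eq_of_pairwise' hl (pairwise_arrivalOrder hω.arrival_injective t) ?_
  rw [List.perm_ext_iff_of_nodup (hl.imp fun h => by rintro rfl; exact lt_irrefl _ h)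
    (arrivalOrder_nodup ω t)]
  intro a
  rw [hm, mem_arrivalOrder (hω.finite_arrivedBefore t)]

lemma arrivalOrder_append {ω : Outcome T} (hω : NoCoincidence ω) {s t : ℝ} (hst : s ≤ t) :
    arrivalOrder ω t =
      arrivalOrder ω s ++ (arrivalOrder ω t).filter fun a => decide (s ≤ arrivalTime ω a) := by
  have h := pairwise_arrivalOrder hω.arrival_injective
  refine (eq_arrivalOrder hω (List.pairwise_append.2 ⟨h s, (h t).filter _, ?_⟩) ?_).symm
  · intro a ha b hb
    rw [List.mem_filter, decide_eq_true_eq] at hb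
    exact (arrivalTime_lt_of_mem ha).trans_le hb.2
  · intro a
    rw [List.mem_append, List.mem_filter, mem_arrivalOrder (hω.finite_arrivedBefore t),
      mem_arrivalOrder (hω.finite_arrivedBefore s), decide_eq_true_eq]
    constructor
    · rintro (h | h)
      · exact h.trans_le hst
      · exact h.1
    · intro h
      rcases lt_or_ge (arrivalTime ω a) s with h' | h'
      · exact .inl h'
      · exact .inr ⟨h, h'⟩

/-- The last agent who arrives before time `t`. -/
lemma exists_last_arrival {ω : Outcome T} (hω : NoCoincidence ω) {t : ℝ} (h : arrivalOrder ω t ≠ []) :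
    ∃ b, arrivalTime ω b < t ∧ ∀ s, arrivalTime ω b < s → s ≤ t →
      arrivalOrder ω s = arrivalOrder ω (arrivalTime ω b) ++ [b] := by
  have hp := pairwise_arrivalOrder hω.arrival_injective t
  obtain ⟨l, b, hl⟩ := List.eq_nil_or_concat' (arrivalOrder ω t) |>.resolve_left h
  have hm : ∀ a, a ∈ l ++ [b] ↔ arrivalTime ω a < t := fun a => by
    rw [← hl, mem_arrivalOrder (hω.finite_arrivedBefore t)]
  have hbt := (hm b).1 (by simp)
  rw [hl, List.pairwise_append] at hp
  have hl' : l = arrivalOrder ω (arrivalTime ω b) := by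
    refine eq_arrivalOrder hω hp.1 fun a => ⟨fun ha => hp.2.2 a ha b (by simp), fun ha => ?_⟩
    have := (hm a).2 (ha.trans hbt)
    simp only [List.mem_append, List.mem_singleton] at this
    rcases this with h | rfl
    · exact h
    · exact absurd ha (lt_irrefl _)
  refine ⟨b, hbt, fun s hs hst => ?_⟩
  rw [← hl']
  refine (eq_arrivalOrder hω (List.pairwise_append.2 hp) fun a => ?_).symm
  rw [hm]
  refine ⟨fun h => ?_, fun h => h.trans_le hst⟩
  have := (hm a).2 h
  simp only [List.mem_append, List.mem_singleton] at this
  rcases this with h | rfl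
  · exact (hp.2.2 a h b (by simp)).trans hs
  · exact hs

namespace GreedyPolicy

variable (π : GreedyPolicy T)

/-- The indices of the agents in the pool just after the last arrival before time `t`. -/
noncomputable def poolBefore (ω : Outcome T) (t : ℝ) : List (T × ℕ) :=
  π.poolRun Prod.fst (liveAt ω) (arrivalOrder ω t)

/-- The indices of the agents present at time `t`. -/
noncomputable def waiting (ω : Outcome T) (t : ℝ) : List (T × ℕ) :=
  (π.poolBefore ω t).filter fun a => decide (t ≤ departureTime ω a)

lemma run_pool (h : List (Agent T)) :
    (π.run h).pool =
      π.poolRun Agent.type (fun b a => decide (b.arrival ≤ a.departure)) h := by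
  induction h using List.reverseRecOn with
  | nil => rfl
  | append_singleton h b ih =>
    rw [poolRun_concat, run, List.foldl_append, List.foldl_cons, List.foldl_nil, poolStep, ← ih]
    change (π.step (π.run h) b).pool = _
    unfold step enter
    set p := List.filter (fun a => decide (b.arrival ≤ a.departure)) (π.run h).pool
    have hp : π.partner b.type p = p.find? (π.accepts Agent.type b.type p) := rfl
    simp only [hp]
    cases hf : p.find? (π.accepts Agent.type b.type p) with
    | none => simp
    | some a => simpa using eraseP_eq_erase_of_find? hf

lemma run_history_pool (ω : Outcome T) (t : ℝ) :
    (π.run (history ω t)).pool = (π.poolBefore ω t).map (agentOf ω) := by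
  rw [run_pool, history_eq_map, poolRun_map]
  rfl

lemma present_eq_typeCount (ω : Outcome T) (t : ℝ) :
    π.present ω t = typeCount Prod.fst (π.waiting ω t) := by
  ext i
  rw [present, run_history_pool, List.filter_map, List.length_map, typeCount, waiting,
    List.filter_filter]
  congr 2
  ext a
  simp only [Function.comp_apply, Bool.decide_and, agentOf]
  rfl

lemma reward_step [Fintype T] (R : T → T → ℝ) (σ : SystemState T) (b : Agent T) :
    (((π.step σ b).matched.map fun q => R q.1.type q.2.type).sum : ℝ) =
      (σ.matched.map fun q => R q.1.type q.2.type).sum +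
      ∑ i, if π.IsTop b.type i (typeCount Agent.type
        (σ.pool.filter fun a => decide (b.arrival ≤ a.departure))) then R i b.type else 0 := by
  simp only [← find?_accepts_eq_some_iff]
  unfold step
  set p := List.filter (fun a => decide (b.arrival ≤ a.departure)) σ.pool
  have hp : π.partner b.type p = p.find? (π.accepts Agent.type b.type p) := rfl
  simp only [hp]
  cases hf : p.find? (π.accepts Agent.type b.type p) with
  | none => simp
  | some a => simp [add_comm]

lemma reward_run_concat [Fintype T] (R : T → T → ℝ) (h : List (Agent T)) (b : Agent T) :
    (((π.run (h ++ [b])).matched.map fun q => R q.1.type q.2.type).sum : ℝ) =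
      ((π.run h).matched.map fun q => R q.1.type q.2.type).sum +
      ∑ i, if π.IsTop b.type i (typeCount Agent.type
        ((π.run h).pool.filter fun a => decide (b.arrival ≤ a.departure))) then R i b.type
        else 0 := by
  rw [← reward_step, run, List.foldl_append]
  rfl

/-- The number of matches of an earlier-arriving agent of type `i` with a later-arriving agent of
type `j` before time `t`. -/
noncomputable def matchCount (ω : Outcome T) (t : ℝ) (i j : T) : ℕ :=
  ((arrivalOrder ω t).filter fun b =>
    decide (b.1 = j ∧ π.IsTop j i (π.present ω (arrivalTime ω b)))).length

/-- The number of agents of type `i` who abandon before time `t`. -/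
noncomputable def abandonCount (ω : Outcome T) (t : ℝ) (i : T) : ℕ :=
  ((arrivalOrder ω t).filter fun a =>
    decide (a.1 = i ∧ departureTime ω a < t ∧ a ∈ π.waiting ω (departureTime ω a))).length

variable {π}

lemma matchCount_concat {ω : Outcome T} {s t : ℝ} {b : T × ℕ}
    (h : arrivalOrder ω t = arrivalOrder ω s ++ [b]) (i j : T) :
    π.matchCount ω t i j = π.matchCount ω s i j +
      if b.1 = j ∧ π.IsTop j i (π.present ω (arrivalTime ω b)) then 1 else 0 := by
  rw [matchCount, h, List.filter_append, List.length_append, matchCount]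
  congr 1
  rw [List.filter_singleton]
  by_cases h : b.1 = j ∧ π.IsTop j i (π.present ω (arrivalTime ω b)) <;> simp [h]

/-- Induction on the number of arrivals, removing the last one. Its reward depends on the pool after
abandonments have been removed, and the counts in that pool are `present` at its own arrival time,
because both keep the agents whose departure is not earlier. -/
lemma totalReward_eq [Fintype T] (I : MatchingInstance T) {ω : Outcome T} (hω : NoCoincidence ω)
    (t : ℝ) : π.totalReward I ω t = ∑ i, ∑ j, I.r i j * π.matchCount ω t i j := by
  induction hn : (arrivalOrder ω t).length generalizing t with
  | zero =>
    rw [List.length_eq_zero_iff] at hn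
    simp [totalReward, history_eq_map, hn, run, matchCount]
  | succ n ih =>
    obtain ⟨b, hb, hs⟩ := exists_last_arrival hω (t := t) (by rintro h; simp [h] at hn)
    have ht := hs t hb le_rfl
    have hlen : (arrivalOrder ω (arrivalTime ω b)).length = n := by
      rw [ht] at hn; simpa using hn
    simp only [matchCount_concat ht]
    rw [totalReward, history_eq_map, ht, List.map_append, List.map_singleton,
      reward_run_concat π I.r, ← history_eq_map, run_history_pool]
    change π.totalReward I ω (arrivalTime ω b) + _ = _
    rw [ih _ hlen]
    push_cast
    simp only [mul_add, Finset.sum_add_distrib]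
    congr 1
    refine Finset.sum_congr rfl fun i _ => ?_
    have : typeCount Agent.type (((π.poolBefore ω (arrivalTime ω b)).map (agentOf ω)).filter
        fun a => decide ((agentOf ω b).arrival ≤ a.departure)) =
        π.present ω (arrivalTime ω b) := by
      rw [present_eq_typeCount, List.filter_map]
      ext k
      rw [typeCount, List.filter_map, List.length_map]
      rfl
    rw [this]
    rw [Finset.sum_eq_single b.1 (by intro k _ hk; simp [hk.symm]) (by simp)]
    simp only [agentOf, true_and, mul_ite, mul_one, mul_zero]
    congr!

lemma mem_waiting {ω : Outcome T} {t : ℝ} {a : T × ℕ} :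
    a ∈ π.waiting ω t ↔ a ∈ π.poolBefore ω t ∧ t ≤ departureTime ω a := by
  simp [waiting]

lemma arrivalTime_lt_of_mem_waiting {ω : Outcome T} {t : ℝ} {a : T × ℕ}
    (h : a ∈ π.waiting ω t) : arrivalTime ω a < t :=
  arrivalTime_lt_of_mem (mem_of_mem_poolRun (mem_waiting.1 h).1)

lemma waiting_nodup (ω : Outcome T) (t : ℝ) : (π.waiting ω t).Nodup :=
  (poolRun_nodup (arrivalOrder_nodup ω t)).filter _

lemma poolBefore_concat {ω : Outcome T} {t : ℝ} {b : T × ℕ}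
    (h : arrivalOrder ω t = arrivalOrder ω (arrivalTime ω b) ++ [b]) :
    π.poolBefore ω t = π.enter Prod.fst (π.waiting ω (arrivalTime ω b)) b := by
  rw [poolBefore, h, poolRun_concat]
  rfl

/-- Between two arrivals, the agents who abandon are those in the pool whose sojourn time ends. -/
lemma abandonCount_concat {ω : Outcome T} (hω : NoCoincidence ω) {t : ℝ} {b : T × ℕ}
    (hb : arrivalTime ω b < t) (h : ∀ s, arrivalTime ω b < s → s ≤ t →
      arrivalOrder ω s = arrivalOrder ω (arrivalTime ω b) ++ [b]) (i : T) :
    π.abandonCount ω t i = π.abandonCount ω (arrivalTime ω b) i +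
      typeCount Prod.fst
        ((π.poolBefore ω t).filter fun a => !decide (t ≤ departureTime ω a)) i := by
  set s := arrivalTime ω b with hs
  have hnd := arrivalOrder_nodup ω
  have hpb : ∀ u, s < u → u ≤ t → π.poolBefore ω u = π.poolBefore ω t := fun u hu hut => by
    rw [poolBefore, poolBefore, h u hu hut, h t hb le_rfl]
  -- Strictness comes from the absence of coincidences. It makes abandonments before and after the
  -- arrival of `b` disjoint.
  have hdep : ∀ a ∈ π.poolBefore ω t, s < departureTime ω a := by
    intro a ha
    have hne := hω.arrival_ne_departure a b
    rw [poolBefore_concat (h t hb le_rfl)] at ha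
    rcases enter_subset ha with ha | rfl
    · exact lt_of_le_of_ne (mem_waiting.1 ha).2 hne
    · have := hω.sojourn_pos a
      rw [departureTime]; linarith
  have hpn : (π.poolBefore ω t).Nodup := poolRun_nodup (hnd t)
  simp only [abandonCount, typeCount]
  rw [← List.toFinset_card_of_nodup ((hnd t).filter _),
    ← List.toFinset_card_of_nodup ((hnd s).filter _),
    ← List.toFinset_card_of_nodup ((hpn.filter _).filter _),
    ← Finset.card_union_of_disjoint]
  · congr 1
    ext a
    simp only [List.mem_toFinset, Finset.mem_union, List.mem_filter, decide_eq_true_eq,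
      mem_arrivalOrder (hω.finite_arrivedBefore _), Bool.not_eq_true', decide_eq_false_iff_not,
      not_le]
    constructor
    · rintro ⟨h1, rfl, h2, h3⟩
      -- An abandonment falls either after the arrival of `b`, when the pool list is the one at `t`,
      -- or before it, when it is already counted at `s`.
      rcases lt_or_gt_of_ne (hω.arrival_ne_departure a b) with h4 | h4
      · refine .inr ⟨⟨?_, h2⟩, rfl⟩
        rw [← hpb _ h4 h2.le]
        exact (mem_waiting.1 h3).1
      · exact .inl ⟨(arrivalTime_lt_of_mem_waiting h3).trans h4, rfl, h4, h3⟩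
    · rintro (⟨h1, rfl, h2, h3⟩ | ⟨⟨h1, h2⟩, rfl⟩)
      · exact ⟨h1.trans hb, rfl, h2.trans hb, h3⟩
      · refine ⟨arrivalTime_lt_of_mem (mem_of_mem_poolRun h1), rfl, h2, mem_waiting.2 ⟨?_, le_rfl⟩⟩
        rwa [hpb _ (hdep a h1) h2.le]
  · rw [Finset.disjoint_left]
    intro a h1 h2
    simp only [List.mem_toFinset, List.mem_filter, decide_eq_true_eq] at h1 h2
    exact (hdep a h2.1.1).not_gt h1.2.2.1

/-- Each agent who has arrived is present, has abandoned, or has been matched. -/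
lemma typeCount_arrivalOrder [Fintype T] {ω : Outcome T} (hω : NoCoincidence ω) (t : ℝ) (i : T) :
    typeCount Prod.fst (arrivalOrder ω t) i = π.present ω t i + π.abandonCount ω t i
      + ∑ j, π.matchCount ω t i j + ∑ j, π.matchCount ω t j i := by
  induction hn : (arrivalOrder ω t).length generalizing t with
  | zero =>
    rw [List.length_eq_zero_iff] at hn
    simp [hn, typeCount, present_eq_typeCount, abandonCount, matchCount, waiting, poolBefore,
      poolRun]
  | succ n ih =>
    obtain ⟨b, hb, hs⟩ := exists_last_arrival hω (t := t) (by rintro h; simp [h] at hn)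
    have ht := hs t hb le_rfl
    have hlen : (arrivalOrder ω (arrivalTime ω b)).length = n := by
      rw [ht] at hn; simpa using hn
    have h1 := ih _ hlen
    have h2 := typeCount_enter (π := π) (ty := Prod.fst) (π.waiting ω (arrivalTime ω b)) b i
    have h3 := typeCount_filter_add (ty := Prod.fst) (fun a => decide (t ≤ departureTime ω a))
      (π.poolBefore ω t) i
    rw [← poolBefore_concat ht, ← h3] at h2
    rw [← present_eq_typeCount] at h2
    simp only [matchCount_concat ht, abandonCount_concat hω hb hs, Finset.sum_add_distrib]
    have e1 : typeCount Prod.fst (arrivalOrder ω t) i =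
        typeCount Prod.fst (arrivalOrder ω (arrivalTime ω b)) i + if b.1 = i then 1 else 0 := by
      rw [ht, typeCount_append, typeCount_singleton]
    have e2 : π.present ω t i = typeCount Prod.fst
        ((π.poolBefore ω t).filter fun a => decide (t ≤ departureTime ω a)) i := by
      rw [present_eq_typeCount, waiting]
    have e3 : (∑ j, if b.1 = j ∧ π.IsTop j i (π.present ω (arrivalTime ω b)) then 1 else 0) =
        if π.IsTop b.1 i (π.present ω (arrivalTime ω b)) then 1 else 0 := by
      rw [Finset.sum_eq_single b.1 (by intro k _ hk; simp [hk.symm]) (by simp)]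
      simp
    have e4 : (∑ j, if b.1 = i ∧ π.IsTop i j (π.present ω (arrivalTime ω b)) then 1 else 0) =
        if b.1 = i then ∑ k, (if π.IsTop b.1 k (π.present ω (arrivalTime ω b)) then 1 else 0)
          else 0 := by
      by_cases h : b.1 = i
      · subst h; simp
      · simp [h]
    rw [e1, e2, e3, e4]
    omega

/-- If all agents who arrive before time `s` have left by then, the state at a later time depends
only on the agents who arrive after time `s`. -/
lemma waiting_eq_of_gone {ω : Outcome T} (hω : NoCoincidence ω) {s t : ℝ} (hst : s ≤ t)
    (hs : ∀ a, arrivalTime ω a < s → departureTime ω a < s) :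
    π.waiting ω t = (π.poolRun Prod.fst (liveAt ω) ((arrivalOrder ω t).filter
      fun a => decide (s ≤ arrivalTime ω a))).filter fun a => decide (t ≤ departureTime ω a) := by
  rw [waiting, poolBefore, arrivalOrder_append hω hst]
  rw [filter_poolRun_append_of_gone]
  · rw [List.filter_append, List.filter_eq_nil_iff (l := arrivalOrder ω s) |>.2, List.nil_append,
      List.filter_filter]
    · simp
    · intro a ha
      simpa using arrivalTime_lt_of_mem ha
  · intro a ha b hb
    simp only [List.mem_filter, decide_eq_true_eq] at hb
    simpa [liveAt] using (hs a (arrivalTime_lt_of_mem ha)).trans_le hb.2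
  · intro a ha
    simpa using (hs a (arrivalTime_lt_of_mem ha)).trans_le hst

/-- The state at time `t` depends only on the agents who arrive before time `t` and on how their
departure times compare with the arrival times before `t` and with `t`. -/
lemma waiting_congr {ω ω' : Outcome T} {t : ℝ}
    (h : arrivedBefore ω t = arrivedBefore ω' t)
    (h1 : ∀ a ∈ arrivedBefore ω t, arrivalTime ω a = arrivalTime ω' a)
    (h2 : ∀ a ∈ arrivedBefore ω t, departureTime ω a = departureTime ω' a ∨
      (t ≤ departureTime ω a ∧ t ≤ departureTime ω' a)) :
    π.waiting ω t = π.waiting ω' t := by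
  have ho : arrivalOrder ω t = arrivalOrder ω' t := by
    unfold arrivalOrder
    by_cases hf : (arrivedBefore ω t).Finite
    · rw [dif_pos hf, dif_pos (h ▸ hf)]
      have e : (h ▸ hf : (arrivedBefore ω' t).Finite).toFinset = hf.toFinset := by
        simp [h]
      rw [e]
      have := List.map_insertionSort (fun a b => arrivalTime ω a ≤ arrivalTime ω b)
        (fun a b => arrivalTime ω' a ≤ arrivalTime ω' b) id hf.toFinset.toList ?_
      · simpa using this
      · intro a ha b hb
        simp only [Finset.mem_toList, Set.Finite.mem_toFinset] at ha hb
        simp [h1 a ha, h1 b hb]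
    · rw [dif_neg hf, dif_neg (h ▸ hf)]
  have hm : ∀ a ∈ arrivalOrder ω t, a ∈ arrivedBefore ω t := fun a => arrivalTime_lt_of_mem
  rw [waiting, waiting, poolBefore, poolBefore, ← ho, poolRun_congr (live' := liveAt ω')]
  · refine List.filter_congr fun a ha => ?_
    rcases h2 a (hm a (mem_of_mem_poolRun ha)) with h | h
    · rw [h]
    · simp [h.1, h.2]
  · intro b hb a ha
    have hb' : arrivalTime ω b < t := hm b hb
    rw [liveAt, liveAt, ← h1 b (hm b hb)]
    rcases h2 a (hm a ha) with h | h
    · rw [h]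
    · simp [hb'.le.trans h.1, hb'.le.trans h.2]

end GreedyPolicy

end Paths

/-! ### Joint measurability of the state in outcome and time -/

section Measurability

open scoped Classical

/-- A function has measurable fibres; for countable `Y`, it is measurable for the discrete
`σ`-algebra on `Y`. -/
def FiberMeasurable {X Y : Type*} [MeasurableSpace X] (f : X → Y) : Prop :=
  ∀ y, MeasurableSet {x | f x = y}

namespace FiberMeasurable

variable {X Y Z α : Type*} [MeasurableSpace X]

lemma const (y : Y) : FiberMeasurable fun _ : X => y := fun _ => MeasurableSet.const _

/-- Splitting over the countably many values of `f` suffices. This lets list algorithms be treated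
step by step without putting a `σ`-algebra on lists. -/
lemma bind [Countable Y] {f : X → Y} {g : Y → X → Z} (hf : FiberMeasurable f)
    (hg : ∀ y, FiberMeasurable (g y)) : FiberMeasurable fun x => g (f x) x := by
  intro z
  have : {x | g (f x) x = z} = ⋃ y, {x | f x = y} ∩ {x | g y x = z} := by
    ext x; simp
  rw [this]
  exact MeasurableSet.iUnion fun y => (hf y).inter (hg y z)

lemma comp [Countable Y] {f : X → Y} (hf : FiberMeasurable f) (g : Y → Z) :
    FiberMeasurable fun x => g (f x) :=
  hf.bind fun y => const (g y)

lemma measurableSet [Countable Y] {f : X → Y} (hf : FiberMeasurable f) (p : Y → Prop) :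
    MeasurableSet {x | p (f x)} := by
  simpa using hf.comp p True

lemma of_decide {p : X → Prop} [DecidablePred p] (hp : MeasurableSet {x | p x}) :
    FiberMeasurable fun x => decide (p x) := by
  rintro (_ | _)
  · simp only [decide_eq_false_iff_not]
    exact hp.compl
  · simp only [decide_eq_true_eq]
    exact hp

lemma ite {p : X → Prop} [DecidablePred p] {f g : X → Y} (hp : MeasurableSet {x | p x}) (hf : FiberMeasurable f)
    (hg : FiberMeasurable g) : FiberMeasurable fun x => if p x then f x else g x := by
  intro y
  have : {x | (if p x then f x else g x) = y} =
      {x | p x} ∩ {x | f x = y} ∪ {x | p x}ᶜ ∩ {x | g x = y} := by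
    ext x
    by_cases h : p x <;> simp [h]
  rw [this]
  exact (hp.inter (hf y)).union (hp.compl.inter (hg y))

variable [Countable α]

lemma filter {q : X → α → Bool} (hq : ∀ a, FiberMeasurable fun x => q x a) (l : List α) :
    FiberMeasurable fun x => l.filter (q x) := by
  induction l with
  | nil => exact const []
  | cons a l ih =>
    have : (fun x => (a :: l).filter (q x)) =
        fun x => if q x a = true then a :: l.filter (q x) else l.filter (q x) := by
      ext1 x
      by_cases h : q x a = true <;> simp [h]
    rw [this]
    exact ite (hq a true) (ih.comp fun l => a :: l) ih

lemma orderedInsert {r : X → α → α → Prop} [∀ x, DecidableRel (r x)]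
    (hr : ∀ a b, MeasurableSet {x | r x a b}) (a : α)
    (l : List α) : FiberMeasurable fun x => l.orderedInsert (r x) a := by
  induction l with
  | nil => exact const [a]
  | cons b l ih =>
    simp only [List.orderedInsert_cons]
    exact ite (hr a b) (const _) (ih.comp _)

lemma insertionSort {r : X → α → α → Prop} [∀ x, DecidableRel (r x)]
    (hr : ∀ a b, MeasurableSet {x | r x a b})
    (l : List α) : FiberMeasurable fun x => l.insertionSort (r x) := by
  induction l with
  | nil => exact const []
  | cons b l ih =>
    simp only [List.insertionSort_cons]
    exact ih.bind fun l => orderedInsert hr b l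

lemma poolRun {T : Type*} (π : GreedyPolicy T) (ty : α → T) {live : X → α → α → Bool}
    (hl : ∀ a b, FiberMeasurable fun x => live x a b) (l : List α) :
    FiberMeasurable fun x => π.poolRun ty (live x) l := by
  induction l using List.reverseRecOn with
  | nil => exact const []
  | append_singleton l b ih =>
    simp only [GreedyPolicy.poolRun_concat]
    exact ih.bind fun p => (filter (hl b) p).comp fun p => π.enter ty p b

end FiberMeasurable

variable {T : Type*}

@[fun_prop]
lemma measurable_arrivalTime (a : T × ℕ) : Measurable fun ω : Outcome T => arrivalTime ω a := by
  unfold arrivalTime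
  fun_prop

@[fun_prop]
lemma measurable_departureTime (a : T × ℕ) :
    Measurable fun ω : Outcome T => departureTime ω a := by
  unfold departureTime
  fun_prop

/-- First the set `J` of arrived indices is measurable, having countably many finite values plus
`none` for an infinite set; for a fixed set, sorting involves only finitely many comparisons of
arrival times. Joint measurability in `(ω, t)` is needed for Tonelli and for evaluating the state at
random times. -/
lemma fiberMeasurable_arrivalOrder [Countable T] :
    FiberMeasurable fun x : Outcome T × ℝ => arrivalOrder x.1 x.2 := by
  let J : Outcome T × ℝ → Option (Finset (T × ℕ)) := fun x =>
    if h : (arrivedBefore x.1 x.2).Finite then some h.toFinset else none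
  have hs : ∀ s : Finset (T × ℕ), MeasurableSet {x | J x = some s} := by
    intro s
    have : {x | J x = some s} = ⋂ a, {x : Outcome T × ℝ | arrivalTime x.1 a < x.2 ↔ a ∈ s} := by
      ext x
      simp only [Set.mem_ofPred_eq, Set.mem_iInter, J]
      split_ifs with h
      · rw [Option.some.injEq, Finset.ext_iff]
        simp [arrivedBefore]
      · simp only [false_iff]
        intro h'
        exact h (s.finite_toSet.subset fun a ha => (h' a).1 ha)
    rw [this]
    refine MeasurableSet.iInter fun a => ?_
    by_cases ha : a ∈ s
    · simpa [ha] using measurableSet_lt (by fun_prop) (by fun_prop)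
    · simpa [ha] using measurableSet_le (by fun_prop) (by fun_prop)
  have hJ : FiberMeasurable J := by
    rintro (_ | s)
    · have : {x | J x = none} = (⋃ s, {x | J x = some s})ᶜ := by
        ext x
        cases h : J x <;> simp [h]
      rw [this]
      exact (MeasurableSet.iUnion hs).compl
    · exact hs s
  let G : Option (Finset (T × ℕ)) → Outcome T × ℝ → List (T × ℕ) := fun o x =>
    o.elim [] fun s => s.toList.insertionSort fun a b => arrivalTime x.1 a ≤ arrivalTime x.1 b
  have hG : ∀ o, FiberMeasurable (G o) := by
    rintro (_ | s)
    · exact FiberMeasurable.const _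
    · have hr : ∀ a b : T × ℕ, MeasurableSet
          {x : Outcome T × ℝ | arrivalTime x.1 a ≤ arrivalTime x.1 b} := fun a b =>
        measurableSet_le (by fun_prop) (by fun_prop)
      exact FiberMeasurable.insertionSort
        (r := fun (x : Outcome T × ℝ) a b => arrivalTime x.1 a ≤ arrivalTime x.1 b) hr _
  have e : (fun x : Outcome T × ℝ => arrivalOrder x.1 x.2) = fun x => G (J x) x := by
    ext1 x
    by_cases h : (arrivedBefore x.1 x.2).Finite
    · simp only [arrivalOrder, J, G, dif_pos h, Option.elim_some]
    · simp only [arrivalOrder, J, G, dif_neg h, Option.elim_none]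
  rw [e]
  exact hJ.bind hG

lemma GreedyPolicy.fiberMeasurable_waiting [Countable T] (π : GreedyPolicy T) :
    FiberMeasurable fun x : Outcome T × ℝ => π.waiting x.1 x.2 := by
  have hl : ∀ a b : T × ℕ, FiberMeasurable fun x : Outcome T × ℝ => liveAt x.1 a b :=
    fun a b => FiberMeasurable.of_decide (p := fun x : Outcome T × ℝ =>
      arrivalTime x.1 a ≤ departureTime x.1 b) (measurableSet_le (by fun_prop) (by fun_prop))
  have ht : ∀ a : T × ℕ,
      FiberMeasurable fun x : Outcome T × ℝ => decide (x.2 ≤ departureTime x.1 a) :=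
    fun a => FiberMeasurable.of_decide (p := fun x : Outcome T × ℝ =>
      x.2 ≤ departureTime x.1 a) (measurableSet_le (by fun_prop) (by fun_prop))
  have h0 : ∀ l, FiberMeasurable fun x : Outcome T × ℝ => π.poolRun Prod.fst (liveAt x.1) l :=
    fun l => FiberMeasurable.poolRun π Prod.fst (live := fun x : Outcome T × ℝ => liveAt x.1) hl l
  have h1 : FiberMeasurable fun x : Outcome T × ℝ => π.poolBefore x.1 x.2 :=
    fiberMeasurable_arrivalOrder.bind h0
  have h2 : ∀ l : List (T × ℕ), FiberMeasurable fun x : Outcome T × ℝ =>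
      l.filter fun a => decide (x.2 ≤ departureTime x.1 a) := fun l =>
    FiberMeasurable.filter (q := fun (x : Outcome T × ℝ) a => decide (x.2 ≤ departureTime x.1 a)) ht l
  exact h1.bind h2

lemma GreedyPolicy.measurableSet_waiting [Countable T] (π : GreedyPolicy T)
    (Q : List (T × ℕ) → Prop) :
    MeasurableSet {x : Outcome T × ℝ | Q (π.waiting x.1 x.2)} :=
  π.fiberMeasurable_waiting.measurableSet Q

end Measurability

/-! ### Exponential distribution: lack of memory and hazard rate -/

section Exponential

open scoped ENNReal

lemma lintegral_expMeasure {r : ℝ} (h : ℝ → ℝ≥0∞) (hh : Measurable h) :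
    ∫⁻ x, h x ∂expMeasure r =
      ∫⁻ x, (Set.Ioi 0).indicator (fun x => ENNReal.ofReal (r * Real.exp (-(r * x))) * h x) x := by
  have hm : Measurable (gammaPDF 1 r) := (measurable_gammaPDFReal 1 r).ennreal_ofReal
  rw [expMeasure, gammaMeasure, lintegral_withDensity_eq_lintegral_mul _ hm hh]
  refine lintegral_congr_ae ?_
  have : ∀ᵐ x : ℝ, x ≠ 0 := by simp [ae_iff]
  filter_upwards [this] with x hx
  have e : gammaPDF 1 r x = exponentialPDF r x := rfl
  rw [Pi.mul_apply, e, exponentialPDF_eq]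
  rcases lt_or_gt_of_ne hx with h | h
  · simp [h.not_gt, h.not_ge]
  · simp [h, h.le]

/-- The exponential distribution has no memory. -/
lemma expMeasure_shift {r c : ℝ} (hc : 0 ≤ c) {B : Set ℝ} (hB : MeasurableSet B) :
    expMeasure r {x | c ≤ x ∧ x - c ∈ B} =
      ENNReal.ofReal (Real.exp (-(r * c))) * expMeasure r B := by
  have hm : MeasurableSet {x : ℝ | c ≤ x ∧ x - c ∈ B} :=
    measurableSet_Ici.inter ((measurable_id.sub_const c) hB)
  rw [← lintegral_indicator_one hm, ← lintegral_indicator_one hB,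
    lintegral_expMeasure _ (measurable_one.indicator hm),
    lintegral_expMeasure _ (measurable_one.indicator hB),
    ← lintegral_const_mul' _ _ (by simp),
    ← lintegral_add_right_eq_self _ c]
  refine lintegral_congr_ae ?_
  have : ∀ᵐ x : ℝ, x ≠ 0 := by simp [ae_iff]
  filter_upwards [this] with x hx
  rcases lt_or_gt_of_ne hx with h | h
  · simp [Set.indicator, h.not_gt, h.not_ge]
  · have h1 : 0 < x + c := by linarith
    have e : Real.exp (-(r * (x + c))) = Real.exp (-(r * c)) * Real.exp (-(r * x)) := by
      rw [← Real.exp_add]; congr 1; ring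
    by_cases hx : x ∈ B
    · simp only [Set.indicator, Set.mem_Ioi, h1, if_true, h, hx, Set.mem_ofPred_eq,
        add_sub_cancel_right, le_add_iff_nonneg_left, h.le, and_self, Pi.one_apply, mul_one]
      rw [← ENNReal.ofReal_mul (Real.exp_nonneg _), e]
      congr 1; ring
    · simp [Set.indicator, hx]

lemma expMeasure_Ici {r c : ℝ} (hr : 0 < r) (hc : 0 ≤ c) :
    expMeasure r (Set.Ici c) = ENNReal.ofReal (Real.exp (-(r * c))) := by
  have := isProbabilityMeasure_expMeasure hr
  have h := expMeasure_shift (r := r) hc MeasurableSet.univ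
  simp only [Set.mem_univ, and_true, measure_univ, mul_one] at h
  exact h

/-- Integrals against the exponential distribution through its hazard rate. -/
lemma lintegral_expMeasure_eq {r : ℝ} (hr : 0 < r) {h : ℝ → ℝ≥0∞} (hh : Measurable h) :
    ∫⁻ x, h x ∂expMeasure r =
      ENNReal.ofReal r * ∫⁻ y, (∫⁻ x in Set.Ioc 0 y, h x) ∂expMeasure r := by
  have := isProbabilityMeasure_expMeasure hr
  -- Written with the indicator of `x ≤ y`, the inner integral can be swapped with the outer one;
  -- this leaves the tail `P(Y ≥ x) = exp (-(r x))`, and `r` times the tail is the density.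
  have e : ∀ y, ∫⁻ x in Set.Ioc 0 y, h x =
      ∫⁻ x, (Set.Ioi 0).indicator (fun x => (Set.Ici x).indicator 1 y * h x) x := by
    intro y
    rw [← lintegral_indicator measurableSet_Ioc]
    refine lintegral_congr fun x => ?_
    by_cases h1 : 0 < x <;> by_cases h2 : x ≤ y <;> simp [Set.indicator, h1, h2]
  have hm : Measurable (Function.uncurry fun (y x : ℝ) =>
      (Set.Ioi (0:ℝ)).indicator (fun x => (Set.Ici x).indicator (1 : ℝ → ℝ≥0∞) y * h x) x) := by
    have : (Function.uncurry fun (y x : ℝ) =>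
        (Set.Ioi (0:ℝ)).indicator (fun x => (Set.Ici x).indicator (1 : ℝ → ℝ≥0∞) y * h x) x) =
        fun p => {p : ℝ × ℝ | 0 < p.2 ∧ p.2 ≤ p.1}.indicator (fun p => h p.2) p := by
      ext ⟨y, x⟩
      by_cases h1 : 0 < x <;> by_cases h2 : x ≤ y <;> simp [Set.indicator, h1, h2]
    rw [this]
    exact (hh.comp measurable_snd).indicator
      ((measurableSet_lt measurable_const measurable_snd).inter
        (measurableSet_le measurable_snd measurable_fst))
  simp only [e]
  rw [lintegral_lintegral_swap hm.aemeasurable, lintegral_expMeasure h hh,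
    ← lintegral_const_mul' _ _ (by simp)]
  refine lintegral_congr fun x => ?_
  by_cases h1 : 0 < x
  · simp only [Set.indicator_of_mem (Set.mem_Ioi.2 h1)]
    rw [lintegral_mul_const _ (measurable_one.indicator measurableSet_Ici),
      lintegral_indicator_one measurableSet_Ici,
      expMeasure_Ici hr h1.le, ENNReal.ofReal_mul hr.le, mul_assoc]
  · simp [h1]

end Exponential

/-! ### Selecting coordinates from two independent families -/

section Product

open Measure

/-- Each coordinate is taken from one of two independent families of independent variables. -/
lemma infinitePi_prod_map_select {ι X : Type*} [MeasurableSpace X] (μ : ι → Measure X)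
    [∀ i, IsProbabilityMeasure (μ i)] (e : ι → ι ⊕ ι) (he : Function.Injective e)
    (hμ : ∀ i, Sum.elim μ μ (e i) = μ i) :
    ((infinitePi μ).prod (infinitePi μ)).map (fun p i => Sum.elim p.1 p.2 (e i)) =
      infinitePi μ := by
  classical
  have hmeas : Measurable fun (p : (ι → X) × (ι → X)) i => Sum.elim p.1 p.2 (e i) := by
    refine measurable_pi_iff.2 fun i => ?_
    cases e i with
    | inl j => exact (measurable_pi_apply j).comp measurable_fst
    | inr j => exact (measurable_pi_apply j).comp measurable_snd
  refine eq_infinitePi _ fun s t ht => ?_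
  rw [map_apply hmeas (MeasurableSet.pi s.countable_toSet fun i _ => ht i)]
  -- By injectivity at most one index of `s` is sent to `j`; `u j` is its constraint, or everything
  -- if there is none.
  let u : ι ⊕ ι → Set X := fun j => ⋂ i ∈ {i | i ∈ s ∧ e i = j}, t i
  have hu : ∀ i ∈ s, u (e i) = t i := by
    intro i hi
    have : {k | k ∈ s ∧ e k = e i} = {i} := by
      ext k
      simp only [Set.mem_ofPred_eq, Set.mem_singleton_iff]
      exact ⟨fun h => he h.2, by rintro rfl; exact ⟨hi, rfl⟩⟩
    change ⋂ k ∈ {k | k ∈ s ∧ e k = e i}, t k = t i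
    rw [this, Set.biInter_singleton]
  have hum : ∀ j, MeasurableSet (u j) := fun j =>
    MeasurableSet.biInter ((s.finite_toSet.subset fun i hi => hi.1).countable) fun i _ => ht i
  let s' := s.image e
  have hpre : (fun (p : (ι → X) × (ι → X)) i => Sum.elim p.1 p.2 (e i)) ⁻¹' (Set.pi s t) =
      (Set.pi s'.toLeft fun i => u (.inl i)) ×ˢ (Set.pi s'.toRight fun i => u (.inr i)) := by
    ext p
    simp only [Set.mem_preimage, Set.mem_pi, Set.mem_prod, Finset.mem_coe, Finset.mem_toLeft,
      Finset.mem_toRight, s', Finset.mem_image]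
    constructor
    · intro h
      constructor
      · rintro j ⟨i, hi, hij⟩
        rw [← hij, hu i hi]
        simpa [hij] using h i hi
      · rintro j ⟨i, hi, hij⟩
        rw [← hij, hu i hi]
        simpa [hij] using h i hi
    · rintro ⟨h1, h2⟩ i hi
      rw [← hu i hi]
      cases hij : e i with
      | inl j => exact h1 j ⟨i, hi, hij⟩
      | inr j => exact h2 j ⟨i, hi, hij⟩
  rw [hpre, prod_prod, infinitePi_pi _ fun i _ => hum _, infinitePi_pi _ fun i _ => hum _]
  have := Finset.prod_disjSum s'.toLeft s'.toRight (fun j => Sum.elim μ μ j (u j))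
  rw [Finset.toLeft_disjSum_toRight] at this
  simp only [Sum.elim_inl, Sum.elim_inr] at this
  rw [← this, Finset.prod_image fun i _ k _ h => he h]
  exact Finset.prod_congr rfl fun i hi => by rw [hμ, hu i hi]

end Product

/-! ### Resampling one agent and integrating over its exponential times -/

namespace MatchingInstance

open scoped ENNReal
open scoped Classical

variable {T : Type*} (I : MatchingInstance T)

instance isProbabilityMeasure_law : IsProbabilityMeasure I.law := by
  unfold law; infer_instance

lemma measurable_update_outcome (a : T × ℕ) :
    Measurable fun p : Outcome T × (ℝ × ℝ) => Function.update p.1 a p.2 := by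
  refine measurable_pi_iff.2 fun b => ?_
  by_cases h : b = a
  · subst h
    simpa using measurable_snd
  · simp only [Function.update_of_ne h]
    fun_prop

/-- Resampling the variables of one agent does not change the law. -/
lemma lintegral_update (a : T × ℕ) {F : Outcome T → ℝ≥0∞} (hF : Measurable F) :
    ∫⁻ ω, F ω ∂I.law = ∫⁻ ω, ∫⁻ y, F (Function.update ω a y)
      ∂((expMeasure (I.lam a.1)).prod (expMeasure (I.mu a.1))) ∂I.law := by
  set ν : T × ℕ → Measure (ℝ × ℝ) :=
    fun a => (expMeasure (I.lam a.1)).prod (expMeasure (I.mu a.1)) with hν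
  have hlaw : I.law = Measure.infinitePi ν := rfl
  have hinj : Function.Injective fun b : T × ℕ =>
      if b = a then (Sum.inr b : (T × ℕ) ⊕ (T × ℕ)) else Sum.inl b := by
    intro b c h
    dsimp only at h
    split_ifs at h <;> simp_all
  have hsel := infinitePi_prod_map_select ν (fun b => if b = a then Sum.inr b else Sum.inl b)
    hinj (fun b => by split_ifs <;> rfl)
  have e : (fun (p : Outcome T × Outcome T) (b : T × ℕ) =>
      Sum.elim p.1 p.2 (if b = a then Sum.inr b else Sum.inl b)) =
      fun p => Function.update p.1 a (p.2 a) := by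
    ext1 p
    ext1 b
    by_cases h : b = a
    · subst h; simp
    · simp [h]
  rw [e] at hsel
  have hm : Measurable fun p : Outcome T × Outcome T => Function.update p.1 a (p.2 a) :=
    (measurable_update_outcome a).comp
      (measurable_fst.prodMk ((measurable_pi_apply a).comp measurable_snd))
  conv_lhs => rw [hlaw, ← hsel]
  rw [lintegral_map hF hm, lintegral_prod
    (fun p : Outcome T × Outcome T => F (Function.update p.1 a (p.2 a)))
    (hF.comp hm).aemeasurable]
  refine lintegral_congr fun ω => ?_
  have h2 := Measure.infinitePi_map_eval ν a
  change _ = ∫⁻ y, F (Function.update ω a y) ∂(ν a)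
  rw [← h2, lintegral_map _ (measurable_pi_apply a)]
  exact hF.comp ((measurable_update_outcome a).comp (measurable_const.prodMk measurable_id))

/-- Integration over an interarrival time through the arrival rate. -/
lemma lintegral_interarrival (a : T × ℕ) {Φ : Outcome T → ℝ → ℝ≥0∞}
    (hΦ : Measurable (Function.uncurry Φ))
    (hinv : ∀ ω x y, Φ (Function.update ω a (x, (ω a).2)) y = Φ ω y) :
    ∫⁻ ω, Φ ω (ω a).1 ∂I.law =
      ENNReal.ofReal (I.lam a.1) * ∫⁻ ω, (∫⁻ x in Set.Ioc 0 (ω a).1, Φ ω x) ∂I.law := by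
  have hm1 : Measurable fun ω : Outcome T => Φ ω (ω a).1 :=
    hΦ.comp (measurable_id.prodMk (by fun_prop))
  have hm2 : Measurable fun ω : Outcome T => ∫⁻ x in Set.Ioc 0 (ω a).1, Φ ω x := by
    simp only [← lintegral_indicator measurableSet_Ioc]
    refine Measurable.lintegral_prod_right' (f := fun p : Outcome T × ℝ =>
      (Set.Ioc 0 (p.1 a).1).indicator (Φ p.1) p.2) ?_
    have : (fun p : Outcome T × ℝ => (Set.Ioc 0 (p.1 a).1).indicator (Φ p.1) p.2) =
        {p : Outcome T × ℝ | 0 < p.2 ∧ p.2 ≤ (p.1 a).1}.indicator (Function.uncurry Φ) := by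
      ext p; simp [Set.indicator, Function.uncurry]
    rw [this]
    exact hΦ.indicator ((measurableSet_lt measurable_const measurable_snd).inter
      (measurableSet_le measurable_snd (by fun_prop)))
  have hinv' : ∀ ω x x' d y, Φ (Function.update ω a (x, d)) y = Φ (Function.update ω a (x', d)) y :=
    fun ω x x' d y => by
      have := hinv (Function.update ω a (x', d)) x y
      simpa using this
  rw [I.lintegral_update a hm1, I.lintegral_update a hm2, ← lintegral_const_mul' _ _ (by simp)]
  refine lintegral_congr fun ω => ?_
  have hu : Measurable fun y : ℝ × ℝ => Function.update ω a y :=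
    (measurable_update_outcome a).comp (measurable_const.prodMk measurable_id)
  have hu1 : Measurable fun y : ℝ × ℝ =>
      Φ (Function.update ω a y) (Function.update ω a y a).1 := hm1.comp hu
  have hu2 : Measurable fun y : ℝ × ℝ =>
      ∫⁻ x in Set.Ioc 0 (Function.update ω a y a).1, Φ (Function.update ω a y) x := hm2.comp hu
  rw [lintegral_prod_symm _ hu1.aemeasurable, lintegral_prod_symm _ hu2.aemeasurable, ← lintegral_const_mul' _ _ (by simp)]
  refine lintegral_congr fun d => ?_
  simp only [Function.update_self]
  -- Since `Φ` ignores the interarrival time stored in its outcome, that time is replaced by the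
  -- dummy value `0`; the integrand is then a function of `x` alone and the one-dimensional hazard
  -- formula applies.
  refine (lintegral_congr fun x => hinv' ω x 0 d x).trans
    ((lintegral_expMeasure_eq (I.lam_pos a.1) (h := Φ (Function.update ω a (0, d)))
    (hΦ.comp (measurable_const.prodMk measurable_id))).trans ?_)
  congr 1
  exact lintegral_congr fun x => lintegral_congr fun y => hinv' ω 0 x d y

/-- Integration over a sojourn time through the abandonment rate. -/
lemma lintegral_sojourn (a : T × ℕ) {Φ : Outcome T → ℝ → ℝ≥0∞}
    (hΦ : Measurable (Function.uncurry Φ))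
    (hinv : ∀ ω x y, Φ (Function.update ω a ((ω a).1, x)) y = Φ ω y) :
    ∫⁻ ω, Φ ω (ω a).2 ∂I.law =
      ENNReal.ofReal (I.mu a.1) * ∫⁻ ω, (∫⁻ x in Set.Ioc 0 (ω a).2, Φ ω x) ∂I.law := by
  have hm1 : Measurable fun ω : Outcome T => Φ ω (ω a).2 :=
    hΦ.comp (measurable_id.prodMk (by fun_prop))
  have hm2 : Measurable fun ω : Outcome T => ∫⁻ x in Set.Ioc 0 (ω a).2, Φ ω x := by
    simp only [← lintegral_indicator measurableSet_Ioc]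
    refine Measurable.lintegral_prod_right' (f := fun p : Outcome T × ℝ =>
      (Set.Ioc 0 (p.1 a).2).indicator (Φ p.1) p.2) ?_
    have : (fun p : Outcome T × ℝ => (Set.Ioc 0 (p.1 a).2).indicator (Φ p.1) p.2) =
        {p : Outcome T × ℝ | 0 < p.2 ∧ p.2 ≤ (p.1 a).2}.indicator (Function.uncurry Φ) := by
      ext p; simp [Set.indicator, Function.uncurry]
    rw [this]
    exact hΦ.indicator ((measurableSet_lt measurable_const measurable_snd).inter
      (measurableSet_le measurable_snd (by fun_prop)))
  have hinv' : ∀ ω x x' d y, Φ (Function.update ω a (d, x)) y = Φ (Function.update ω a (d, x')) y :=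
    fun ω x x' d y => by
      have := hinv (Function.update ω a (d, x')) x y
      simpa using this
  rw [I.lintegral_update a hm1, I.lintegral_update a hm2, ← lintegral_const_mul' _ _ (by simp)]
  refine lintegral_congr fun ω => ?_
  have hu : Measurable fun y : ℝ × ℝ => Function.update ω a y :=
    (measurable_update_outcome a).comp (measurable_const.prodMk measurable_id)
  have hu1 : Measurable fun y : ℝ × ℝ =>
      Φ (Function.update ω a y) (Function.update ω a y a).2 := hm1.comp hu
  have hu2 : Measurable fun y : ℝ × ℝ =>
      ∫⁻ x in Set.Ioc 0 (Function.update ω a y a).2, Φ (Function.update ω a y) x := hm2.comp hu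
  rw [lintegral_prod _ hu1.aemeasurable, lintegral_prod _ hu2.aemeasurable, ← lintegral_const_mul' _ _ (by simp)]
  refine lintegral_congr fun d => ?_
  simp only [Function.update_self]
  refine (lintegral_congr fun x => hinv' ω x 0 d x).trans
    ((lintegral_expMeasure_eq (I.mu_pos a.1) (h := Φ (Function.update ω a (d, 0)))
    (hΦ.comp (measurable_const.prodMk measurable_id))).trans ?_)
  congr 1
  exact lintegral_congr fun x => lintegral_congr fun y => hinv' ω 0 x d y

end MatchingInstance

/-! ### Arrivals see time averages; almost sure absence of coincidences -/

section Arrivals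

open scoped ENNReal
open scoped Classical

variable {T : Type*}

/-- The sum of the first `k` interarrival times of type `i`. -/
noncomputable def arrivalSum (ω : Outcome T) (i : T) (k : ℕ) : ℝ :=
  ∑ l ∈ Finset.range k, (ω (i, l)).1

lemma arrivalTime_eq (ω : Outcome T) (i : T) (k : ℕ) :
    arrivalTime ω (i, k) = arrivalSum ω i k + (ω (i, k)).1 := by
  simp [arrivalTime, arrivalSum, Finset.sum_range_succ]

lemma arrivalTime_eq_arrivalSum (ω : Outcome T) (i : T) (k : ℕ) :
    arrivalTime ω (i, k) = arrivalSum ω i (k + 1) := rfl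

@[fun_prop]
lemma measurable_arrivalSum (i : T) (k : ℕ) :
    Measurable fun ω : Outcome T => arrivalSum ω i k := by
  unfold arrivalSum
  fun_prop

lemma strictMono_arrivalSum {ω : Outcome T} (h : ∀ a, 0 < (ω a).1) (i : T) :
    StrictMono (arrivalSum ω i) :=
  strictMono_nat_of_lt_succ fun k => by
    simp [arrivalSum, Finset.sum_range_succ, h]

lemma arrivalSum_zero (ω : Outcome T) (i : T) : arrivalSum ω i 0 = 0 := by simp [arrivalSum]

lemma arrivalSum_update_of_le {ω : Outcome T} {i : T} {k l : ℕ} (h : l ≤ k) (y : ℝ × ℝ) :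
    arrivalSum (Function.update ω (i, k) y) i l = arrivalSum ω i l := by
  unfold arrivalSum
  refine Finset.sum_congr rfl fun m hm => ?_
  rw [Function.update_of_ne]
  simp only [ne_eq, Prod.mk.injEq, not_and]
  have := Finset.mem_range.1 hm
  omega

lemma arrivalTime_update_of_ne {ω : Outcome T} {a b : T × ℕ} (h : b.1 ≠ a.1) (y : ℝ × ℝ) :
    arrivalTime (Function.update ω a y) b = arrivalTime ω b := by
  unfold arrivalTime
  refine Finset.sum_congr rfl fun m _ => ?_
  rw [Function.update_of_ne]
  rintro rfl
  exact h rfl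

lemma arrivalTime_update_snd (ω : Outcome T) (a b : T × ℕ) (x : ℝ) :
    arrivalTime (Function.update ω a ((ω a).1, x)) b = arrivalTime ω b := by
  unfold arrivalTime
  refine Finset.sum_congr rfl fun m _ => ?_
  by_cases h : (b.1, m) = a
  · subst h; simp
  · rw [Function.update_of_ne h]

/-- Turns a count along a list, whose order and length are random, into a sum over fixed agents `(i,
k)`, to which the formulas for a single agent apply term by term. -/
lemma tsum_ite_mem_eq_length (l : List (T × ℕ)) (hl : l.Nodup) (p : T × ℕ → Prop)
    [DecidablePred p] (i : T) :
    ∑' k : ℕ, (if (i, k) ∈ l ∧ p (i, k) then (1 : ℝ≥0∞) else 0) =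
      ((l.filter fun a => decide (a.1 = i ∧ p a)).length : ℝ≥0∞) := by
  induction l with
  | nil => simp
  | cons a l ih =>
    rw [List.nodup_cons] at hl
    have h1 : ∀ k : ℕ, (if (i, k) ∈ a :: l ∧ p (i, k) then (1 : ℝ≥0∞) else 0) =
        (if k = a.2 then (if a.1 = i ∧ p a then 1 else 0) else 0) +
          if (i, k) ∈ l ∧ p (i, k) then 1 else 0 := by
      intro k
      by_cases hk : (i, k) = a
      · subst hk
        simp [hl.1]
      · have h2 : ¬ (k = a.2 ∧ a.1 = i) := by
          rintro ⟨rfl, rfl⟩; exact hk rfl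
        by_cases hk2 : k = a.2
        · have : ¬ a.1 = i := fun h => h2 ⟨hk2, h⟩
          simp [hk, this]
        · simp [hk, hk2]
    simp only [h1]
    rw [ENNReal.tsum_add, ih hl.2, tsum_ite_eq]
    by_cases ha : a.1 = i ∧ p a
    · simp [ha, add_comm]
    · rw [if_neg ha, List.filter_cons_of_neg (by simpa using ha)]
      simp

namespace MatchingInstance

variable (I : MatchingInstance T)

lemma expMeasure_Iic_zero (r : ℝ) : expMeasure r (Set.Iic 0) = 0 := by
  rw [← lintegral_indicator_one measurableSet_Iic,
    lintegral_expMeasure _ (measurable_one.indicator measurableSet_Iic)]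
  simp only [Set.indicator]
  refine (lintegral_congr fun x => ?_).trans lintegral_zero
  by_cases h : 0 < x
  · simp [h]
  · simp [h]

lemma ae_pos [Countable T] : ∀ᵐ ω ∂I.law, ∀ a, 0 < (ω a).1 ∧ 0 < (ω a).2 := by
  rw [ae_all_iff]
  intro a
  have h := Measure.infinitePi_map_eval
    (fun a : T × ℕ => (expMeasure (I.lam a.1)).prod (expMeasure (I.mu a.1))) a
  have h2 : ∀ᵐ y ∂((expMeasure (I.lam a.1)).prod (expMeasure (I.mu a.1))), 0 < y.1 ∧ 0 < y.2 := by
    have e1 : ∀ᵐ x ∂expMeasure (I.lam a.1), 0 < x := by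
      rw [ae_iff]; simpa [Set.Iic] using expMeasure_Iic_zero (I.lam a.1)
    have e2 : ∀ᵐ x ∂expMeasure (I.mu a.1), 0 < x := by
      rw [ae_iff]; simpa [Set.Iic] using expMeasure_Iic_zero (I.mu a.1)
    exact (Measure.quasiMeasurePreserving_fst.ae e1).and
      (Measure.quasiMeasurePreserving_snd.ae e2)
  rw [← h] at h2
  exact ae_of_ae_map (measurable_pi_apply a).aemeasurable h2

/-- An interarrival time differs from any variable that does not depend on it. -/
lemma ae_interarrival_ne (a : T × ℕ) {f : Outcome T → ℝ} (hf : Measurable f)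
    (hinv : ∀ ω x, f (Function.update ω a (x, (ω a).2)) = f ω) :
    ∀ᵐ ω ∂I.law, (ω a).1 ≠ f ω := by
  have hm : MeasurableSet {p : Outcome T × ℝ | p.2 = f p.1} :=
    measurableSet_eq_fun measurable_snd (hf.comp measurable_fst)
  have h := I.lintegral_interarrival a
    (Φ := fun ω x => {p : Outcome T × ℝ | p.2 = f p.1}.indicator 1 (ω, x))
    (measurable_one.indicator hm) (fun ω x y => by simp [Set.indicator, hinv])
  -- For fixed `ω` the coincidence set is one point, hence Lebesgue-null, so the right side of the
  -- hazard formula vanishes.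
  have h0 : ∀ ω : Outcome T, ∫⁻ x in Set.Ioc 0 (ω a).1,
      {p : Outcome T × ℝ | p.2 = f p.1}.indicator (1 : Outcome T × ℝ → ℝ≥0∞) (ω, x) = 0 := by
    intro ω
    have : ∀ᵐ x : ℝ, x ≠ f ω := by simp [ae_iff]
    rw [← lintegral_zero (μ := volume.restrict (Set.Ioc 0 (ω a).1))]
    refine lintegral_congr_ae (ae_restrict_of_ae ?_)
    filter_upwards [this] with x hx
    simp [Set.indicator, hx]
  simp only [h0, lintegral_zero, mul_zero] at h
  have hm' : MeasurableSet {ω : Outcome T | (ω a).1 = f ω} :=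
    measurableSet_eq_fun (by fun_prop) hf
  have e : ∀ ω : Outcome T, {p : Outcome T × ℝ | p.2 = f p.1}.indicator
      (1 : Outcome T × ℝ → ℝ≥0∞) (ω, (ω a).1) =
      {ω : Outcome T | (ω a).1 = f ω}.indicator 1 ω := fun ω => by simp [Set.indicator]
  simp only [e] at h
  rw [lintegral_indicator_one hm'] at h
  rw [ae_iff]
  simpa using h

/-- A sojourn time differs from any variable that does not depend on it. -/
lemma ae_sojourn_ne (a : T × ℕ) {f : Outcome T → ℝ} (hf : Measurable f)
    (hinv : ∀ ω x, f (Function.update ω a ((ω a).1, x)) = f ω) :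
    ∀ᵐ ω ∂I.law, (ω a).2 ≠ f ω := by
  have hm : MeasurableSet {p : Outcome T × ℝ | p.2 = f p.1} :=
    measurableSet_eq_fun measurable_snd (hf.comp measurable_fst)
  have h := I.lintegral_sojourn a
    (Φ := fun ω x => {p : Outcome T × ℝ | p.2 = f p.1}.indicator 1 (ω, x))
    (measurable_one.indicator hm) (fun ω x y => by simp [Set.indicator, hinv])
  have h0 : ∀ ω : Outcome T, ∫⁻ x in Set.Ioc 0 (ω a).2,
      {p : Outcome T × ℝ | p.2 = f p.1}.indicator (1 : Outcome T × ℝ → ℝ≥0∞) (ω, x) = 0 := by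
    intro ω
    have : ∀ᵐ x : ℝ, x ≠ f ω := by simp [ae_iff]
    rw [← lintegral_zero (μ := volume.restrict (Set.Ioc 0 (ω a).2))]
    refine lintegral_congr_ae (ae_restrict_of_ae ?_)
    filter_upwards [this] with x hx
    simp [Set.indicator, hx]
  simp only [h0, lintegral_zero, mul_zero] at h
  have hm' : MeasurableSet {ω : Outcome T | (ω a).2 = f ω} :=
    measurableSet_eq_fun (by fun_prop) hf
  have e : ∀ ω : Outcome T, {p : Outcome T × ℝ | p.2 = f p.1}.indicator
      (1 : Outcome T × ℝ → ℝ≥0∞) (ω, (ω a).2) =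
      {ω : Outcome T | (ω a).2 = f ω}.indicator 1 ω := fun ω => by simp [Set.indicator]
  simp only [e] at h
  rw [lintegral_indicator_one hm'] at h
  rw [ae_iff]
  simpa using h

lemma measurable_setLIntegral_Ioc {f g : Outcome T → ℝ} (hf : Measurable f) (hg : Measurable g)
    {F : Outcome T × ℝ → ℝ≥0∞} (hF : Measurable F) :
    Measurable fun ω => ∫⁻ s in Set.Ioc (f ω) (g ω), F (ω, s) := by
  have h : Measurable fun ω : Outcome T => ∫⁻ s,
      {p : Outcome T × ℝ | f p.1 < p.2 ∧ p.2 ≤ g p.1}.indicator F (ω, s) :=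
    Measurable.lintegral_prod_right' (hF.indicator
      ((measurableSet_lt (hf.comp measurable_fst) measurable_snd).inter
        (measurableSet_le measurable_snd (hg.comp measurable_fst))))
  convert! h using 2 with ω
  rw [← lintegral_indicator measurableSet_Ioc]
  refine lintegral_congr fun s => ?_
  simp [Set.indicator]

lemma lintegral_Ioc_add (c y : ℝ) (f : ℝ → ℝ≥0∞) :
    ∫⁻ x in Set.Ioc 0 y, f (c + x) = ∫⁻ s in Set.Ioc c (c + y), f s := by
  rw [← lintegral_indicator measurableSet_Ioc, ← lintegral_indicator measurableSet_Ioc,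
    ← lintegral_add_left_eq_self ((Set.Ioc c (c + y)).indicator f) c]
  refine lintegral_congr fun x => ?_
  simp [Set.indicator]

/-- Shortening the `k`-th interarrival time of type `j` to `x` moves only the agents `(j, l)` with
`l ≥ k`. In both outcomes these arrive at or after the time considered, and the state counts only
strictly earlier arrivals. -/
lemma waiting_update_interarrival {ω : Outcome T} (hω : ∀ a, 0 < (ω a).1) (π : GreedyPolicy T)
    (j : T) (k : ℕ) {x : ℝ} (hx : 0 < x) (hx' : x ≤ (ω (j, k)).1) (d : ℝ) :
    π.waiting (Function.update ω (j, k) (x, d)) (arrivalSum ω j k + x) =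
      π.waiting ω (arrivalSum ω j k + x) := by
  set t := arrivalSum ω j k + x with ht
  have key : ∀ b : T × ℕ, ((b.1 ≠ j ∨ b.2 < k) ∧
      arrivalTime (Function.update ω (j, k) (x, d)) b = arrivalTime ω b) ∨
      (t ≤ arrivalTime (Function.update ω (j, k) (x, d)) b ∧ t ≤ arrivalTime ω b) := by
    rintro ⟨i, l⟩
    by_cases hi : i = j
    · subst hi
      rcases lt_or_ge l k with hl | hl
      · exact .inl ⟨.inr hl, arrivalSum_update_of_le (l := l + 1) hl _⟩
      · right
        constructor
        · have hpos : ∀ a, 0 < (Function.update ω (i, k) (x, d) a).1 := by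
            intro a
            by_cases ha : a = (i, k)
            · subst ha; simpa using hx
            · rw [Function.update_of_ne ha]; exact hω a
          have h1 := (strictMono_arrivalSum hpos i).monotone (Nat.succ_le_succ hl)
          have h2 := arrivalTime_eq (Function.update ω (i, k) (x, d)) i k
          rw [arrivalSum_update_of_le le_rfl, Function.update_self] at h2
          rw [ht, ← h2]
          exact h1
        · have h1 := (strictMono_arrivalSum hω i).monotone (Nat.succ_le_succ hl)
          have h2 := arrivalTime_eq ω i k
          refine le_trans ?_ h1
          change t ≤ arrivalTime ω (i, k)
          rw [h2]; linarith
    · exact .inl ⟨.inl hi, arrivalTime_update_of_ne hi _⟩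
  have hset : arrivedBefore (Function.update ω (j, k) (x, d)) t = arrivedBefore ω t := by
    ext b
    change arrivalTime _ b < t ↔ arrivalTime _ b < t
    rcases key b with h | h
    · rw [h.2]
    · simp [h.1.not_gt, h.2.not_gt]
  have hmem : ∀ b ∈ arrivedBefore (Function.update ω (j, k) (x, d)) t, (b.1 ≠ j ∨ b.2 < k) ∧
      arrivalTime (Function.update ω (j, k) (x, d)) b = arrivalTime ω b := by
    intro b hb
    rcases key b with h | h
    · exact h
    · exact absurd hb (not_lt.2 h.1)
  refine GreedyPolicy.waiting_congr hset (fun b hb => (hmem b hb).2) fun b hb => .inl ?_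
  rw [departureTime, departureTime, (hmem b hb).2, Function.update_of_ne]
  rintro rfl
  rcases (hmem _ hb).1 with h | h
  · exact h rfl
  · exact lt_irrefl _ h

/-- The state seen by the arrivals of one agent, averaged over its interarrival time. -/
lemma lintegral_arrivalTime [Countable T] (π : GreedyPolicy T) {w : ℝ → ℝ≥0∞} (hw : Measurable w)
    (Q : List (T × ℕ) → Prop) (j : T) (k : ℕ) :
    ∫⁻ ω, w (arrivalTime ω (j, k)) *
        (if Q (π.waiting ω (arrivalTime ω (j, k))) then 1 else 0) ∂I.law =
      ENNReal.ofReal (I.lam j) * ∫⁻ ω, (∫⁻ s in Set.Ioc (arrivalSum ω j k)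
        (arrivalTime ω (j, k)), w s * (if Q (π.waiting ω s) then 1 else 0)) ∂I.law := by
  -- The integrand looks at the outcome with the interarrival time reset to `x`, so it does not
  -- depend on the original one. At the true value of `x` it is the state found by the agent; at
  -- smaller values it is the state of `ω` itself, by `waiting_update_interarrival`.
  have hΦ : Measurable (Function.uncurry fun (ω : Outcome T) (x : ℝ) =>
      w (arrivalSum ω j k + x) * (if Q (π.waiting (Function.update ω (j, k) (x, (ω (j, k)).2))
        (arrivalSum ω j k + x)) then (1 : ℝ≥0∞) else 0)) := by
    have hs : Measurable fun p : Outcome T × ℝ => arrivalSum p.1 j k + p.2 := by fun_prop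
    have hu : Measurable fun p : Outcome T × ℝ =>
        Function.update p.1 (j, k) (p.2, (p.1 (j, k)).2) :=
      (measurable_update_outcome (j, k)).comp (measurable_fst.prodMk (by fun_prop))
    exact (hw.comp hs).mul (Measurable.ite ((hu.prodMk hs) (π.measurableSet_waiting Q))
      measurable_const measurable_const)
  have h := I.lintegral_interarrival (j, k) hΦ fun ω x y => by
    rw [arrivalSum_update_of_le le_rfl]
    simp
  have e : ∀ ω : Outcome T, Function.update ω (j, k) ((ω (j, k)).1, (ω (j, k)).2) = ω :=
    fun ω => Function.update_eq_self _ _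
  simp only [e, ← arrivalTime_eq] at h
  rw [h]
  congr 1
  refine lintegral_congr_ae ?_
  filter_upwards [I.ae_pos] with ω hω
  rw [arrivalTime_eq, ← lintegral_Ioc_add (f := fun s => w s *
    (if Q (π.waiting ω s) then (1 : ℝ≥0∞) else 0))]
  refine setLIntegral_congr_fun measurableSet_Ioc fun x hx => ?_
  rw [waiting_update_interarrival (fun a => (hω a).1) π j k hx.1 hx.2]

lemma tsum_lintegral_Ioc {ω : Outcome T} (hω : ∀ a, 0 < (ω a).1) (i : T) (f : ℝ → ℝ≥0∞) :
    ∑' k : ℕ, ∫⁻ s in Set.Ioc (arrivalSum ω i k) (arrivalTime ω (i, k)), f s =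
      ∫⁻ s in ⋃ k : ℕ, Set.Ioc (arrivalSum ω i k) (arrivalTime ω (i, k)), f s :=
  (lintegral_iUnion (fun _ => measurableSet_Ioc)
    (strictMono_arrivalSum hω i).monotone.pairwise_disjoint_on_Ioc_succ f).symm

lemma iUnion_Ioc_subset {ω : Outcome T} (hω : ∀ a, 0 < (ω a).1) (i : T) :
    ⋃ k : ℕ, Set.Ioc (arrivalSum ω i k) (arrivalTime ω (i, k)) ⊆ Set.Ioi 0 := by
  refine Set.iUnion_subset fun k s hs => ?_
  have := (strictMono_arrivalSum hω i).monotone (Nat.zero_le k)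
  rw [arrivalSum_zero] at this
  exact this.trans_lt hs.1

/-- The expected number of arrivals of type `i` before time `n` is `λ_i` times the expected length
of `(0, n)` covered by the disjoint intervals between successive arrivals, hence at most `λ_i n`.
Only the inclusion of these intervals in `(0, ∞)` is used; that they cover it is deduced from the
present result. -/
lemma ae_finite_arrivedBefore [Finite T] : ∀ᵐ ω ∂I.law, ∀ t, (arrivedBefore ω t).Finite := by
  have h1 : ∀ (i : T) (n : ℕ), ∀ᵐ ω ∂I.law, {k : ℕ | arrivalTime ω (i, k) < n}.Finite := by
    intro i n
    -- An arbitrary policy: the formula is applied with the trivial event, so the state plays no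
    -- role.
    let π : GreedyPolicy T := ⟨fun _ => WellOrderingRel, fun _ => inferInstance⟩
    have hm : ∀ k : ℕ, Measurable fun ω : Outcome T =>
        (Set.Iio (n : ℝ)).indicator (1 : ℝ → ℝ≥0∞) (arrivalTime ω (i, k)) := fun k =>
      (measurable_one.indicator measurableSet_Iio).comp (measurable_arrivalTime _)
    have hk := fun k : ℕ => I.lintegral_arrivalTime π
      (measurable_one.indicator (measurableSet_Iio (a := (n : ℝ)))) (fun _ => True) i k
    simp only [if_true, mul_one] at hk
    have hfin : ∫⁻ ω, ∑' k : ℕ, (Set.Iio (n : ℝ)).indicator (1 : ℝ → ℝ≥0∞)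
        (arrivalTime ω (i, k)) ∂I.law ≠ ∞ := by
      rw [lintegral_tsum fun k => (hm k).aemeasurable]
      simp only [hk]
      rw [ENNReal.tsum_mul_left, ← lintegral_tsum]
      · refine ENNReal.mul_ne_top (by simp) (ne_top_of_le_ne_top (b := ENNReal.ofReal n) (by simp) ?_)
        have : ∀ᵐ ω ∂I.law, ∑' k : ℕ, ∫⁻ s in Set.Ioc (arrivalSum ω i k) (arrivalTime ω (i, k)),
            (Set.Iio (n : ℝ)).indicator (1 : ℝ → ℝ≥0∞) s ≤ ENNReal.ofReal n := by
          filter_upwards [I.ae_pos] with ω hω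
          rw [tsum_lintegral_Ioc fun a => (hω a).1]
          refine (lintegral_mono_set (iUnion_Ioc_subset (fun a => (hω a).1) i)).trans ?_
          rw [lintegral_indicator_one measurableSet_Iio,
            Measure.restrict_apply measurableSet_Iio]
          refine (measure_mono (t := Set.Ioo 0 (n : ℝ)) fun x hx => ⟨hx.2, hx.1⟩).trans ?_
          simp
        exact (lintegral_mono_ae this).trans (by simp)
      · intro k
        exact (measurable_setLIntegral_Ioc (by fun_prop) (by fun_prop)
          ((measurable_one.indicator measurableSet_Iio).comp measurable_snd)).aemeasurable
    have := ae_lt_top' (AEMeasurable.tsum fun k => (hm k).aemeasurable) hfin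
    filter_upwards [this] with ω hω
    have hsum := ENNReal.finite_const_le_of_tsum_ne_top hω.ne one_ne_zero
    refine hsum.subset fun k hk => ?_
    simp only [Set.mem_ofPred_eq] at hk ⊢
    simp [hk]
  have h2 : ∀ᵐ ω ∂I.law, ∀ (i : T) (n : ℕ), {k : ℕ | arrivalTime ω (i, k) < n}.Finite := by
    rw [ae_all_iff]; intro i; rw [ae_all_iff]; exact h1 i
  filter_upwards [h2] with ω hω t
  obtain ⟨n, hn⟩ := exists_nat_gt t
  refine (Set.finite_iUnion fun i => (hω i n).image (Prod.mk i)).subset ?_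
  rintro ⟨i, k⟩ h
  simp only [Set.mem_iUnion]
  exact ⟨i, k, lt_trans h hn, rfl⟩

/-- Almost surely there are no coincidences. -/
lemma ae_noCoincidence [Finite T] : ∀ᵐ ω ∂I.law, NoCoincidence ω := by
  have h1 : ∀ᵐ ω ∂I.law, ∀ a b : T × ℕ, b.1 ≠ a.1 → arrivalTime ω a ≠ arrivalTime ω b := by
    rw [ae_all_iff]; rintro ⟨i, k⟩
    rw [ae_all_iff]; intro b
    by_cases hb : b.1 ≠ i
    · have := I.ae_interarrival_ne (i, k) (f := fun ω => arrivalTime ω b - arrivalSum ω i k)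
        (by fun_prop) (fun ω x => by
          rw [arrivalTime_update_of_ne hb, arrivalSum_update_of_le le_rfl])
      filter_upwards [this] with ω hω _ h
      rw [arrivalTime_eq] at h
      exact hω (by linarith)
    · filter_upwards with ω h
      exact absurd h hb
  have h2 : ∀ᵐ ω ∂I.law, ∀ a b : T × ℕ, arrivalTime ω b ≠ departureTime ω a := by
    rw [ae_all_iff]; intro a
    rw [ae_all_iff]; intro b
    have := I.ae_sojourn_ne a (f := fun ω => arrivalTime ω b - arrivalTime ω a)
      (by fun_prop) (fun ω x => by rw [arrivalTime_update_snd, arrivalTime_update_snd])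
    filter_upwards [this] with ω hω h
    rw [departureTime] at h
    exact hω (by linarith)
  filter_upwards [I.ae_pos, h1, h2, I.ae_finite_arrivedBefore] with ω h3 h1 h2 h4
  refine ⟨fun a => (h3 a).1, fun a => (h3 a).2, ?_, h2, h4⟩
  rintro ⟨i, k⟩ ⟨j, l⟩ h
  by_cases hij : j = i
  · subst hij
    have := (strictMono_arrivalSum (fun a => (h3 a).1) j).injective h
    simp only [Nat.add_right_cancel_iff] at this
    rw [this]
  · exact absurd h (h1 _ _ hij)

/-- Finitely many arrivals in finite time means that the arrival times of type `i` are unbounded.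
This lets the integrals between successive arrivals add up to an integral over all positive times.
-/
lemma iUnion_Ioc_eq {ω : Outcome T} (hω : NoCoincidence ω) (i : T) :
    ⋃ k : ℕ, Set.Ioc (arrivalSum ω i k) (arrivalTime ω (i, k)) = Set.Ioi 0 := by
  refine (iUnion_Ioc_subset hω.interarrival_pos i).antisymm fun s hs => ?_
  have hex : ∃ k, s ≤ arrivalTime ω (i, k) := by
    by_contra! h
    have hf := hω.finite_arrivedBefore s
    refine Set.infinite_of_injective_forall_mem (f := fun k : ℕ => (i, k)) ?_ ?_ hf
    · intro k l h; simpa using h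
    · intro k; exact h k
  rw [Set.mem_iUnion]
  refine ⟨Nat.find hex, ?_, Nat.find_spec hex⟩
  rcases h : Nat.find hex with _ | k
  · rw [arrivalSum_zero]; exact hs
  · have := Nat.find_min hex (m := k) (by omega)
    exact not_le.1 this

/-- Arrivals see time averages: the expected sum over the arrivals of type `j` of a function of the
arrival time and of the state just before. -/
lemma lintegral_tsum_arrivals [Finite T] (π : GreedyPolicy T) {w : ℝ → ℝ≥0∞} (hw : Measurable w)
    (Q : List (T × ℕ) → Prop) (j : T) :
    ∫⁻ ω, ∑' k : ℕ, w (arrivalTime ω (j, k)) *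
        (if Q (π.waiting ω (arrivalTime ω (j, k))) then 1 else 0) ∂I.law =
      ENNReal.ofReal (I.lam j) * ∫⁻ s in Set.Ioi 0, w s * I.law {ω | Q (π.waiting ω s)} := by
  have hQ : Measurable fun p : Outcome T × ℝ =>
      w p.2 * (if Q (π.waiting p.1 p.2) then (1 : ℝ≥0∞) else 0) :=
    (hw.comp measurable_snd).mul (Measurable.ite (π.measurableSet_waiting Q)
      measurable_const measurable_const)
  have hm : ∀ k : ℕ, Measurable fun ω : Outcome T => w (arrivalTime ω (j, k)) *
      (if Q (π.waiting ω (arrivalTime ω (j, k))) then (1 : ℝ≥0∞) else 0) := fun k =>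
    hQ.comp (measurable_id.prodMk (measurable_arrivalTime (j, k)))
  rw [lintegral_tsum fun k => (hm k).aemeasurable]
  simp only [I.lintegral_arrivalTime π hw]
  rw [ENNReal.tsum_mul_left]
  congr 1
  rw [← lintegral_tsum]
  · have h1 : ∀ᵐ ω ∂I.law, ∑' k : ℕ, ∫⁻ s in Set.Ioc (arrivalSum ω j k) (arrivalTime ω (j, k)),
        w s * (if Q (π.waiting ω s) then (1 : ℝ≥0∞) else 0) =
        ∫⁻ s in Set.Ioi 0, w s * (if Q (π.waiting ω s) then (1 : ℝ≥0∞) else 0) := by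
      filter_upwards [I.ae_noCoincidence] with ω hω
      rw [tsum_lintegral_Ioc hω.interarrival_pos, iUnion_Ioc_eq hω]
    rw [lintegral_congr_ae h1, lintegral_lintegral_swap hQ.aemeasurable]
    refine lintegral_congr fun s => ?_
    have hs : MeasurableSet {ω : Outcome T | Q (π.waiting ω s)} :=
      (measurable_id.prodMk measurable_const) (π.measurableSet_waiting Q)
    rw [lintegral_const_mul _ (Measurable.ite hs measurable_const measurable_const),
      ← lintegral_indicator_one hs]
    rfl
  · intro k
    exact (measurable_setLIntegral_Ioc (by fun_prop) (by fun_prop) hQ).aemeasurable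

end MatchingInstance

end Arrivals

/-! ### Expected match, abandonment and arrival counts -/

section Flow

open scoped ENNReal
open scoped Classical

variable {T : Type*}

/-- Up to the time `arrivalTime ω a + x` nobody can tell the two sojourn times of `a` apart: in both
outcomes `a` would leave no earlier than that. So the presence of `a` at a given age does not depend
on the excess of its sojourn time. -/
lemma waiting_update_sojourn (π : GreedyPolicy T) (ω : Outcome T) (a : T × ℕ) {x : ℝ}
    (hx : x ≤ (ω a).2) :
    π.waiting (Function.update ω a ((ω a).1, x)) (arrivalTime ω a + x) =
      π.waiting ω (arrivalTime ω a + x) := by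
  have harr := fun b => arrivalTime_update_snd ω a b x
  have hs : arrivedBefore (Function.update ω a ((ω a).1, x)) (arrivalTime ω a + x) =
      arrivedBefore ω (arrivalTime ω a + x) := by
    simp only [arrivedBefore, harr]
  refine GreedyPolicy.waiting_congr hs (fun b _ => harr b) fun b _ => ?_
  simp only [departureTime, harr]
  by_cases h : b = a
  · subst h
    exact .inr ⟨by simp, by linarith⟩
  · rw [Function.update_of_ne h]
    exact .inl rfl

namespace GreedyPolicy

variable (π : GreedyPolicy T)

lemma measurable_present [Countable T] (i : T) :
    Measurable fun p : Outcome T × ℝ => (π.present p.1 p.2 i : ℝ≥0∞) := by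
  simp only [present_eq_typeCount]
  have : Measurable fun p : Outcome T × ℝ => typeCount Prod.fst (π.waiting p.1 p.2) i :=
    measurable_to_countable' fun n =>
      π.measurableSet_waiting fun l => typeCount Prod.fst l i = n
  exact (measurable_of_countable (fun n : ℕ => (n : ℝ≥0∞))).comp this

/-- The probability that an agent of type `j` arriving at time `t` would be matched with an agent
of type `i`. -/
noncomputable def topProb (I : MatchingInstance T) (j i : T) (t : ℝ) : ℝ :=
  I.law.real {ω | π.IsTop j i (π.present ω t)}

/-- The expected number of agents of type `i` present at time `t`. -/
noncomputable def meanAt (I : MatchingInstance T) (i : T) (t : ℝ) : ℝ :=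
  ∫ ω, (π.present ω t i : ℝ) ∂I.law

lemma present_eq_tsum (ω : Outcome T) (t : ℝ) (i : T) :
    (π.present ω t i : ℝ≥0∞) =
      ∑' k : ℕ, if (i, k) ∈ π.waiting ω t then (1 : ℝ≥0∞) else 0 := by
  have h := tsum_ite_mem_eq_length (π.waiting ω t) (waiting_nodup ω t) (fun _ => True) i
  simp only [and_true] at h
  rw [h, present_eq_typeCount]
  rfl

lemma matchCount_eq_tsum {ω : Outcome T} (hω : NoCoincidence ω) (t : ℝ) (i j : T) :
    (π.matchCount ω t i j : ℝ≥0∞) =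
      ∑' k : ℕ, (Set.Iio t).indicator (1 : ℝ → ℝ≥0∞) (arrivalTime ω (j, k)) *
        (if π.IsTop j i (typeCount Prod.fst (π.waiting ω (arrivalTime ω (j, k)))) then 1
          else 0) := by
  rw [matchCount, ← tsum_ite_mem_eq_length _ (arrivalOrder_nodup ω t)
    (fun b => π.IsTop j i (π.present ω (arrivalTime ω b)))]
  refine tsum_congr fun k => ?_
  simp only [mem_arrivalOrder (hω.finite_arrivedBefore t), ← present_eq_typeCount, Set.indicator,
    Set.mem_Iio, Pi.one_apply, ite_and]
  split_ifs <;> simp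

lemma abandonCount_eq_tsum {ω : Outcome T} (hω : NoCoincidence ω) (t : ℝ) (i : T) :
    (π.abandonCount ω t i : ℝ≥0∞) =
      ∑' k : ℕ, if departureTime ω (i, k) < t ∧
        (i, k) ∈ π.waiting ω (departureTime ω (i, k)) then 1 else 0 := by
  rw [abandonCount, ← tsum_ite_mem_eq_length _ (arrivalOrder_nodup ω t)
    (fun a => departureTime ω a < t ∧ a ∈ π.waiting ω (departureTime ω a))]
  refine tsum_congr fun k => ?_
  simp only [mem_arrivalOrder (hω.finite_arrivedBefore t)]
  congr 1
  simp only [eq_iff_iff, and_iff_right_iff_imp]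
  exact fun h => (arrivalTime_lt_of_mem_waiting h.2).trans h.1

lemma typeCount_arrivalOrder_eq_tsum {ω : Outcome T} (hω : NoCoincidence ω) (t : ℝ) (i : T) :
    (typeCount Prod.fst (arrivalOrder ω t) i : ℝ≥0∞) =
      ∑' k : ℕ, (Set.Iio t).indicator (1 : ℝ → ℝ≥0∞) (arrivalTime ω (i, k)) := by
  have h := tsum_ite_mem_eq_length (arrivalOrder ω t) (arrivalOrder_nodup ω t) (fun _ => True) i
  simp only [and_true] at h
  rw [typeCount, ← h]
  refine tsum_congr fun k => ?_
  simp [mem_arrivalOrder (hω.finite_arrivedBefore t), Set.indicator]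

variable (I : MatchingInstance T)

lemma setLIntegral_Ioi_indicator_Iio (t : ℝ) (f : ℝ → ℝ≥0∞) :
    ∫⁻ s in Set.Ioi 0, (Set.Iio t).indicator 1 s * f s = ∫⁻ s in Set.Ioo 0 t, f s := by
  have : ∀ s, (Set.Iio t).indicator 1 s * f s = (Set.Iio t).indicator f s := fun s => by
    by_cases h : s < t <;> simp [Set.indicator, h]
  simp only [this]
  rw [lintegral_indicator measurableSet_Iio, Measure.restrict_restrict measurableSet_Iio,
    Set.inter_comm]
  rfl

lemma lintegral_matchCount [Finite T] (t : ℝ) (i j : T) :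
    ∫⁻ ω, (π.matchCount ω t i j : ℝ≥0∞) ∂I.law =
      ENNReal.ofReal (I.lam j) *
        ∫⁻ s in Set.Ioo 0 t, I.law {ω | π.IsTop j i (π.present ω s)} := by
  rw [lintegral_congr_ae (I.ae_noCoincidence.mono fun ω hω => π.matchCount_eq_tsum hω t i j),
    I.lintegral_tsum_arrivals π (measurable_one.indicator measurableSet_Iio)
      (fun l => π.IsTop j i (typeCount Prod.fst l)), setLIntegral_Ioi_indicator_Iio]
  simp only [present_eq_typeCount]

lemma lintegral_typeCount_arrivalOrder [Finite T] (t : ℝ) (i : T) :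
    ∫⁻ ω, (typeCount Prod.fst (arrivalOrder ω t) i : ℝ≥0∞) ∂I.law =
      ENNReal.ofReal (I.lam i) * ENNReal.ofReal t := by
  have h := I.lintegral_tsum_arrivals
    (⟨fun _ => WellOrderingRel, fun _ => inferInstance⟩ : GreedyPolicy T)
    (measurable_one.indicator (measurableSet_Iio (a := t))) (fun _ => True) i
  have h1 : I.law {ω : Outcome T | True} = 1 := by
    rw [← measure_univ (μ := I.law)]; congr 1
  rw [setLIntegral_Ioi_indicator_Iio, h1] at h
  simp only [if_true, mul_one] at h
  rw [lintegral_congr_ae (I.ae_noCoincidence.mono fun ω hω =>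
      typeCount_arrivalOrder_eq_tsum hω t i), h]
  simp

/-- The hazard rate of abandonment is `μ` for as long as the agent waits, so the probability of
abandoning before `t` is `μ` times the expected time spent waiting in `(0, t)`. The event at age `x`
is evaluated with the sojourn time reset to `x`, which makes it independent of that time. -/
lemma lintegral_abandon [Countable T] (t : ℝ) (a : T × ℕ) :
    ∫⁻ ω, (if departureTime ω a < t ∧ a ∈ π.waiting ω (departureTime ω a) then 1 else 0) ∂I.law =
      ENNReal.ofReal (I.mu a.1) * ∫⁻ ω, (∫⁻ s in Set.Ioo 0 t,
        if a ∈ π.waiting ω s then (1 : ℝ≥0∞) else 0) ∂I.law := by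
  have hΦ : Measurable (Function.uncurry fun (ω : Outcome T) (x : ℝ) =>
      if arrivalTime ω a + x < t ∧ a ∈ π.waiting (Function.update ω a ((ω a).1, x))
        (arrivalTime ω a + x) then (1 : ℝ≥0∞) else 0) := by
    have hs : Measurable fun p : Outcome T × ℝ => arrivalTime p.1 a + p.2 := by fun_prop
    have hu : Measurable fun p : Outcome T × ℝ =>
        Function.update p.1 a ((p.1 a).1, p.2) :=
      (MatchingInstance.measurable_update_outcome a).comp (measurable_fst.prodMk (by fun_prop))
    exact Measurable.ite ((measurableSet_lt hs measurable_const).inter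
      ((hu.prodMk hs) (π.measurableSet_waiting fun l => a ∈ l))) measurable_const measurable_const
  have h := I.lintegral_sojourn a hΦ fun ω x y => by
    rw [arrivalTime_update_snd]
    simp
  have e : ∀ ω : Outcome T, Function.update ω a ((ω a).1, (ω a).2) = ω :=
    fun ω => Function.update_eq_self _ _
  simp only [e] at h
  have e2 : ∀ ω : Outcome T, arrivalTime ω a + (ω a).2 = departureTime ω a := fun _ => rfl
  simp only [e2] at h
  rw [h]
  congr 1
  refine lintegral_congr_ae ?_
  filter_upwards [I.ae_pos] with ω hω
  have h1 : ∫⁻ x in Set.Ioc 0 (ω a).2, (if arrivalTime ω a + x < t ∧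
      a ∈ π.waiting (Function.update ω a ((ω a).1, x)) (arrivalTime ω a + x) then
        (1 : ℝ≥0∞) else 0) =
      ∫⁻ x in Set.Ioc 0 (ω a).2, (fun s => if s < t ∧ a ∈ π.waiting ω s then
        (1 : ℝ≥0∞) else 0) (arrivalTime ω a + x) := by
    refine setLIntegral_congr_fun measurableSet_Ioc fun x hx => ?_
    rw [waiting_update_sojourn π ω a hx.2]
  rw [h1, MatchingInstance.lintegral_Ioc_add (arrivalTime ω a) (ω a).2 (fun s =>
    if s < t ∧ a ∈ π.waiting ω s then (1 : ℝ≥0∞) else 0), ← lintegral_indicator measurableSet_Ioc,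
    ← lintegral_indicator measurableSet_Ioo]
  refine lintegral_congr fun s => ?_
  have harr : 0 < arrivalTime ω a := by
    have := strictMono_arrivalSum (fun b => (hω b).1) a.1 (Nat.zero_lt_succ a.2)
    rwa [arrivalSum_zero] at this
  simp only [Set.indicator, Set.mem_Ioc, Set.mem_Ioo, e2]
  -- A waiting agent has arrived before `s` and departs no earlier, so restricting `s` to the
  -- sojourn interval changes nothing.
  by_cases hs : a ∈ π.waiting ω s
  · have h2 := arrivalTime_lt_of_mem_waiting hs
    have h3 := (mem_waiting.1 hs).2
    simp [hs, h2, h3, harr.trans h2]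
  · simp [hs]

lemma lintegral_abandonCount [Finite T] (t : ℝ) (i : T) :
    ∫⁻ ω, (π.abandonCount ω t i : ℝ≥0∞) ∂I.law =
      ENNReal.ofReal (I.mu i) *
        ∫⁻ s in Set.Ioo 0 t, ∫⁻ ω, (π.present ω s i : ℝ≥0∞) ∂I.law := by
  have hm1 : ∀ k : ℕ, Measurable fun ω : Outcome T => if departureTime ω (i, k) < t ∧
      (i, k) ∈ π.waiting ω (departureTime ω (i, k)) then (1 : ℝ≥0∞) else 0 := fun k =>
    Measurable.ite ((measurableSet_lt (measurable_departureTime (i, k)) measurable_const).inter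
      ((measurable_id.prodMk (measurable_departureTime (i, k)))
        (π.measurableSet_waiting fun l => (i, k) ∈ l))) measurable_const measurable_const
  have hm2 : ∀ k : ℕ, Measurable fun p : Outcome T × ℝ =>
      if (i, k) ∈ π.waiting p.1 p.2 then (1 : ℝ≥0∞) else 0 := fun k =>
    Measurable.ite (π.measurableSet_waiting fun l => (i, k) ∈ l) measurable_const measurable_const
  rw [lintegral_congr_ae (I.ae_noCoincidence.mono fun ω hω => π.abandonCount_eq_tsum hω t i),
    lintegral_tsum fun k => (hm1 k).aemeasurable]
  simp only [lintegral_abandon]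
  rw [ENNReal.tsum_mul_left]
  congr 1
  rw [← lintegral_tsum fun k => (Measurable.lintegral_prod_right' (hm2 k)).aemeasurable,
    lintegral_lintegral_swap (f := fun s ω => (π.present ω s i : ℝ≥0∞))
      ((π.measurable_present i).comp measurable_swap).aemeasurable]
  refine lintegral_congr fun ω => ?_
  simp only [present_eq_tsum]
  have hm3 : ∀ k : ℕ, Measurable fun s => if (i, k) ∈ π.waiting ω s then (1 : ℝ≥0∞) else 0 :=
    fun k => (hm2 k).comp (measurable_prodMk_left (x := ω))
  rw [lintegral_tsum fun k => (hm3 k).aemeasurable]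

/-- Only almost everywhere measurability is needed: the representation as a sum over agents is
available on outcomes without coincidences. -/
lemma aemeasurable_matchCount [Finite T] (t : ℝ) (i j : T) :
    AEMeasurable (fun ω : Outcome T => (π.matchCount ω t i j : ℝ≥0∞)) I.law := by
  have h := I.ae_noCoincidence.mono fun ω hω => π.matchCount_eq_tsum hω t i j
  rw [aemeasurable_congr h]
  have hk : ∀ k : ℕ, Measurable fun ω : Outcome T =>
      (Set.Iio t).indicator (1 : ℝ → ℝ≥0∞) (arrivalTime ω (j, k)) *
      (if π.IsTop j i (typeCount Prod.fst (π.waiting ω (arrivalTime ω (j, k)))) then 1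
        else 0) := fun k =>
    ((measurable_one.indicator measurableSet_Iio).comp (measurable_arrivalTime (j, k))).mul
      (Measurable.ite ((measurable_id.prodMk (measurable_arrivalTime (j, k)))
        (π.measurableSet_waiting fun l => π.IsTop j i (typeCount Prod.fst l)))
        measurable_const measurable_const)
  exact AEMeasurable.tsum fun k => (hk k).aemeasurable

variable [Fintype T]

/-- The expectation of the pathwise conservation law `typeCount_arrivalOrder`. In `ℝ≥0∞` it requires
no integrability; since the left side is finite, it proves that every term on the right is finite
too. -/
lemma lintegral_flow (t : ℝ) (i : T) :
    ENNReal.ofReal (I.lam i) * ENNReal.ofReal t =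
      ∫⁻ ω, (π.present ω t i : ℝ≥0∞) ∂I.law +
      ENNReal.ofReal (I.mu i) *
        (∫⁻ s in Set.Ioo 0 t, ∫⁻ ω, (π.present ω s i : ℝ≥0∞) ∂I.law) +
      ∑ j, ENNReal.ofReal (I.lam j) *
        (∫⁻ s in Set.Ioo 0 t, I.law {ω | π.IsTop j i (π.present ω s)}) +
      ∑ j, ENNReal.ofReal (I.lam i) *
        (∫⁻ s in Set.Ioo 0 t, I.law {ω | π.IsTop i j (π.present ω s)}) := by
  have hm1 : Measurable fun ω : Outcome T => (π.present ω t i : ℝ≥0∞) := by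
    have h : Measurable fun ω : Outcome T => (ω, t) := measurable_id.prodMk measurable_const
    have h2 := (π.measurable_present i).comp h
    exact h2
  have hm2 := π.aemeasurable_matchCount I t
  rw [← lintegral_typeCount_arrivalOrder, ← lintegral_abandonCount]
  simp only [← lintegral_matchCount]
  rw [← lintegral_finsetSum' _ fun j _ => hm2 i j, ← lintegral_finsetSum' _ fun j _ => hm2 j i,
    ← lintegral_add_left hm1, ← lintegral_add_right',
    ← lintegral_add_right' _ (Finset.aemeasurable_fun_sum _ fun j _ => hm2 j i)]
  · refine lintegral_congr_ae ?_
    filter_upwards [I.ae_noCoincidence] with ω hω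
    rw [typeCount_arrivalOrder (π := π) hω]
    push_cast
    rfl
  · exact Finset.aemeasurable_fun_sum _ fun j _ => hm2 i j

end GreedyPolicy

end Flow

/-! ### The Markov property: restarting the primitives at a fixed time -/

section Restart

open scoped ENNReal
open scoped Classical

variable {T : Type*}

/-- The number of arrivals of type `i` before time `h`. -/
noncomputable def arrivedCount (ω : Outcome T) (h : ℝ) (i : T) : ℕ :=
  sInf {k | h ≤ arrivalTime ω (i, k)}

/-- The outcome that follows `ω` for the first `κ i` arrivals of each type `i`, and from time `h` on
follows `ω'`, delayed by `h`. -/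
noncomputable def glue (h : ℝ) (κ : T → ℕ) (ω ω' : Outcome T) : Outcome T := fun a =>
  if a.2 < κ a.1 then ω a
  else if a.2 = κ a.1 then
    (h - arrivalSum ω a.1 (κ a.1) + (ω' (a.1, 0)).1, (ω' (a.1, 0)).2)
  else ω' (a.1, a.2 - κ a.1)

/-- The outcome that follows `ω` before time `h`, and from time `h` on follows `ω'`, delayed by
`h`. -/
noncomputable def restart (h : ℝ) (ω ω' : Outcome T) : Outcome T :=
  glue h (arrivedCount ω h) ω ω'

/-- The variables of `ω` for the first `κ i` arrivals of each type `i`, followed by those of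
`ω'`. -/
noncomputable def concatAt (κ : T → ℕ) (ω ω' : Outcome T) : Outcome T := fun a =>
  if a.2 < κ a.1 then ω a else ω' (a.1, a.2 - κ a.1)

/-- The first interarrival time of each type `i` is reduced by `c i`. -/
noncomputable def reduceFirst (c : T → ℝ) (ω : Outcome T) : Outcome T := fun a =>
  if a.2 = 0 then ((ω a).1 - c a.1, (ω a).2) else ω a

lemma measurable_glue (h : ℝ) (κ : T → ℕ) :
    Measurable fun p : Outcome T × Outcome T => glue h κ p.1 p.2 := by
  refine measurable_pi_iff.2 fun a => ?_
  unfold glue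
  split_ifs <;> fun_prop

lemma measurable_concatAt (κ : T → ℕ) :
    Measurable fun p : Outcome T × Outcome T => concatAt κ p.1 p.2 := by
  refine measurable_pi_iff.2 fun a => ?_
  unfold concatAt
  split_ifs <;> fun_prop

lemma measurable_reduceFirst (c : T → ℝ) : Measurable (reduceFirst c) := by
  refine measurable_pi_iff.2 fun a => ?_
  unfold reduceFirst
  split_ifs <;> fun_prop

lemma arrivalSum_congr {ω ω' : Outcome T} {i : T} {k : ℕ} (h : ∀ l < k, ω (i, l) = ω' (i, l)) :
    arrivalSum ω i k = arrivalSum ω' i k := by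
  unfold arrivalSum
  exact Finset.sum_congr rfl fun l hl => by rw [h l (Finset.mem_range.1 hl)]

lemma arrivalSum_glue_of_le {h : ℝ} {κ : T → ℕ} {ω ω' : Outcome T} {i : T} {k : ℕ}
    (hk : k ≤ κ i) : arrivalSum (glue h κ ω ω') i k = arrivalSum ω i k :=
  arrivalSum_congr fun l hl => by simp [glue, hl.trans_le hk]

lemma arrivalSum_concatAt_of_le {κ : T → ℕ} {ω ω' : Outcome T} {i : T} {k : ℕ}
    (hk : k ≤ κ i) : arrivalSum (concatAt κ ω ω') i k = arrivalSum ω i k :=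
  arrivalSum_congr fun l hl => by simp [concatAt, hl.trans_le hk]

lemma arrivalTime_glue_of_lt {h : ℝ} {κ : T → ℕ} {ω ω' : Outcome T} {a : T × ℕ}
    (hk : a.2 < κ a.1) : arrivalTime (glue h κ ω ω') a = arrivalTime ω a :=
  arrivalSum_glue_of_le (k := a.2 + 1) hk

/-- The summand `h - arrivalSum` in `glue` bridges the gap from the last arrival before `h` to time
`h`; from then on the interarrival times are those of `ω'`. -/
lemma arrivalTime_glue_add (h : ℝ) (κ : T → ℕ) (ω ω' : Outcome T) (i : T) (k : ℕ) :
    arrivalTime (glue h κ ω ω') (i, κ i + k) = h + arrivalTime ω' (i, k) := by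
  induction k with
  | zero =>
    rw [add_zero, arrivalTime_eq, arrivalSum_glue_of_le le_rfl, arrivalTime_eq, arrivalSum_zero]
    simp only [glue, lt_irrefl, if_false, if_true]
    ring
  | succ k ih =>
    rw [← add_assoc, arrivalTime_eq, ← arrivalTime_eq_arrivalSum, ih, arrivalTime_eq ω' i (k + 1),
      ← arrivalTime_eq_arrivalSum]
    simp only [glue]
    rw [if_neg (by omega), if_neg (by omega)]
    rw [show κ i + k + 1 - κ i = k + 1 by omega, add_assoc]

lemma departureTime_glue_of_lt {h : ℝ} {κ : T → ℕ} {ω ω' : Outcome T} {a : T × ℕ}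
    (hk : a.2 < κ a.1) : departureTime (glue h κ ω ω') a = departureTime ω a := by
  rw [departureTime, departureTime, arrivalTime_glue_of_lt hk]
  simp [glue, hk]

lemma departureTime_glue_add (h : ℝ) (κ : T → ℕ) (ω ω' : Outcome T) (i : T) (k : ℕ) :
    departureTime (glue h κ ω ω') (i, κ i + k) = h + departureTime ω' (i, k) := by
  rw [departureTime, departureTime, arrivalTime_glue_add, add_assoc]
  congr 2
  rcases k with _ | k
  · simp [glue]
  · simp [glue]

/-- For each type `i`, exactly `κ i` agents arrive before time `h`. -/
def CountsAt (h : ℝ) (κ : T → ℕ) (ω : Outcome T) : Prop :=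
  ∀ i, (∀ l < κ i, arrivalTime ω (i, l) < h) ∧ h ≤ arrivalTime ω (i, κ i)

lemma CountsAt.eq_arrivedCount {h : ℝ} {κ : T → ℕ} {ω : Outcome T} (hκ : CountsAt h κ ω) :
    κ = arrivedCount ω h := by
  ext i
  refine le_antisymm ?_ (Nat.sInf_le (hκ i).2)
  refine le_csInf ⟨_, (hκ i).2⟩ fun k hk => ?_
  by_contra! hlt
  exact ((hκ i).1 k hlt).not_ge hk

lemma countsAt_arrivedCount {ω : Outcome T} (hω : NoCoincidence ω) (h : ℝ) :
    CountsAt h (arrivedCount ω h) ω := by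
  intro i
  have hne : {k | h ≤ arrivalTime ω (i, k)}.Nonempty := by
    by_contra hne
    rw [Set.not_nonempty_iff_eq_empty, Set.eq_empty_iff_forall_notMem] at hne
    refine Set.infinite_of_injective_forall_mem (f := fun k : ℕ => (i, k)) ?_ ?_
      (hω.finite_arrivedBefore h)
    · intro k l h; simpa using h
    · intro k
      have : ¬ h ≤ arrivalTime ω (i, k) := hne k
      exact not_le.1 this
  refine ⟨fun l hl => ?_, Nat.sInf_mem hne⟩
  have := Nat.notMem_of_lt_sInf hl
  exact not_le.1 this

lemma lt_arrivedCount_iff {ω : Outcome T} (hω : NoCoincidence ω) {h : ℝ} {a : T × ℕ} :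
    a.2 < arrivedCount ω h a.1 ↔ arrivalTime ω a < h := by
  have hc := countsAt_arrivedCount hω h a.1
  refine ⟨fun hl => hc.1 _ hl, fun hl => ?_⟩
  by_contra! hle
  have := (strictMono_arrivalSum hω.interarrival_pos a.1).monotone (Nat.succ_le_succ hle)
  exact (hc.2.trans this).not_gt hl

/-- Separates the two independent pieces: a condition on the first alone, and a lower bound on each
first interarrival time of the second. The latter is the event on which lack of memory is applied.
-/
lemma countsAt_concatAt_iff {h : ℝ} {κ : T → ℕ} {ω ω' : Outcome T} :
    CountsAt h κ (concatAt κ ω ω') ↔ (∀ i, ∀ l < κ i, arrivalTime ω (i, l) < h) ∧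
      ∀ i, h - arrivalSum ω i (κ i) ≤ (ω' (i, 0)).1 := by
  have h1 : ∀ i, ∀ l < κ i, arrivalTime (concatAt κ ω ω') (i, l) = arrivalTime ω (i, l) :=
    fun i l hl => arrivalSum_concatAt_of_le (k := l + 1) hl
  have h2 : ∀ i, arrivalTime (concatAt κ ω ω') (i, κ i) =
      arrivalSum ω i (κ i) + (ω' (i, 0)).1 := by
    intro i
    rw [arrivalTime_eq, arrivalSum_concatAt_of_le le_rfl]
    simp [concatAt]
  simp only [CountsAt, h2, forall_and, sub_le_iff_le_add']
  constructor
  · rintro ⟨h3, h4⟩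
    exact ⟨fun i l hl => by rw [← h1 i l hl]; exact h3 i l hl, h4⟩
  · rintro ⟨h3, h4⟩
    exact ⟨fun i l hl => by rw [h1 i l hl]; exact h3 i l hl, h4⟩

/-- The interarrival interval that straddles `h` is cut at `h`: subtracting the part before `h`
leaves the residual time, and `glue` adds that part back. -/
lemma concatAt_eq_glue (h : ℝ) (κ : T → ℕ) (ω ω' : Outcome T) :
    concatAt κ ω ω' =
      glue h κ ω (reduceFirst (fun i => h - arrivalSum ω i (κ i)) ω') := by
  ext1 a
  unfold concatAt glue reduceFirst
  split_ifs with h1 h2 h3 h4 <;> first | rfl | (exfalso; omega) | skip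
  simp [h2]

lemma glue_concatAt (h : ℝ) (κ : T → ℕ) (ω ω' ω'' : Outcome T) :
    glue h κ (concatAt κ ω ω') ω'' = glue h κ ω ω'' := by
  ext1 a
  unfold glue
  rw [arrivalSum_concatAt_of_le le_rfl]
  split_ifs with h1 h2
  · simp [concatAt, h1]
  · rfl
  · rfl

namespace MatchingInstance

variable (I : MatchingInstance T)

lemma prod_expMeasure_shift {r m c : ℝ} [IsProbabilityMeasure (expMeasure r)]
    [IsProbabilityMeasure (expMeasure m)] (hc : 0 ≤ c) {B : Set (ℝ × ℝ)} (hB : MeasurableSet B) :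
    (expMeasure r).prod (expMeasure m) {y | c ≤ y.1 ∧ (y.1 - c, y.2) ∈ B} =
      ENNReal.ofReal (Real.exp (-(r * c))) * (expMeasure r).prod (expMeasure m) B := by
  have hm : Measurable fun y : ℝ × ℝ => (y.1 - c, y.2) := by fun_prop
  have hs : MeasurableSet {y : ℝ × ℝ | c ≤ y.1 ∧ (y.1 - c, y.2) ∈ B} :=
    (measurableSet_le measurable_const measurable_fst).inter (hm hB)
  rw [Measure.prod_apply_symm hB, Measure.prod_apply_symm hs,
    ← lintegral_const_mul' _ _ (by simp)]
  refine lintegral_congr fun d => ?_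
  exact expMeasure_shift hc (measurable_prodMk_right hB)

/-- Every coordinate is read from one of two independent copies, no coordinate is read twice, and
types are preserved, so the law is unchanged. -/
lemma law_map_concatAt (κ : T → ℕ) :
    (I.law.prod I.law).map (fun p => concatAt κ p.1 p.2) = I.law := by
  have hinj : Function.Injective fun a : T × ℕ => if a.2 < κ a.1 then
      (Sum.inl a : (T × ℕ) ⊕ (T × ℕ)) else Sum.inr (a.1, a.2 - κ a.1) := by
    rintro ⟨i, k⟩ ⟨j, l⟩ h
    dsimp only at h
    split_ifs at h with h1 h2 h2
    · simpa using h
    · simp only [Sum.inr.injEq, Prod.mk.injEq] at h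
      obtain ⟨rfl, h⟩ := h
      simp only [Prod.mk.injEq, true_and]
      omega
  have := infinitePi_prod_map_select
    (fun a : T × ℕ => (expMeasure (I.lam a.1)).prod (expMeasure (I.mu a.1)))
    (fun a : T × ℕ => if a.2 < κ a.1 then Sum.inl a else Sum.inr (a.1, a.2 - κ a.1)) hinj
    (fun a => by split_ifs <;> rfl)
  have e : (fun (p : Outcome T × Outcome T) (a : T × ℕ) =>
      Sum.elim p.1 p.2 (if a.2 < κ a.1 then Sum.inl a else Sum.inr (a.1, a.2 - κ a.1))) =
      fun p => concatAt κ p.1 p.2 := by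
    ext1 p
    ext1 a
    unfold concatAt
    split_ifs <;> rfl
  rw [e] at this
  exact this

variable [Fintype T]

/-- On a box the coordinates are independent. Lack of memory gives one factor `exp (-(λ_i c_i))` for
each first arrival, including those that the box does not constrain, which is why `z` is adjoined to
`s`. -/
lemma law_reduceFirst_box {c : T → ℝ} (hc : ∀ i, 0 ≤ c i) (s : Finset (T × ℕ))
    {t : T × ℕ → Set (ℝ × ℝ)} (ht : ∀ a, MeasurableSet (t a)) :
    I.law {ω | (∀ i, c i ≤ (ω (i, 0)).1) ∧ reduceFirst c ω ∈ Set.pi s t} =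
      (∏ i, ENNReal.ofReal (Real.exp (-(I.lam i * c i)))) *
        ∏ a ∈ s, ((expMeasure (I.lam a.1)).prod (expMeasure (I.mu a.1))) (t a) := by
  set z : Finset (T × ℕ) := Finset.univ.image fun i => (i, 0) with hz
  have hmz : ∀ a : T × ℕ, a ∈ z ↔ a.2 = 0 := by
    rintro ⟨i, k⟩
    simp [hz, eq_comm]
  let t' : T × ℕ → Set (ℝ × ℝ) := fun a =>
    if a.2 = 0 then {y | c a.1 ≤ y.1 ∧ (y.1 - c a.1, y.2) ∈ if a ∈ s then t a else Set.univ}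
    else t a
  have hset : {ω : Outcome T | (∀ i, c i ≤ (ω (i, 0)).1) ∧ reduceFirst c ω ∈ Set.pi s t} =
      Set.pi (s ∪ z : Finset (T × ℕ)) t' := by
    ext ω
    simp only [Set.mem_ofPred_eq, Set.mem_pi, Finset.mem_coe, Finset.mem_union, hmz, t']
    constructor
    · rintro ⟨h1, h2⟩ ⟨i, k⟩ h3
      by_cases hk : k = 0
      · subst hk
        refine ⟨h1 i, ?_⟩
        split_ifs with h4
        · simpa [reduceFirst] using h2 _ h4
        · trivial
      · simpa [reduceFirst, hk] using h2 (i, k) (by simpa [hk] using h3)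
    · intro h
      refine ⟨fun i => ?_, ?_⟩
      · have := h (i, 0) (.inr rfl)
        exact this.1
      · rintro ⟨i, k⟩ h3
        have := h (i, k) (.inl h3)
        by_cases hk : k = 0
        · subst hk
          simpa [reduceFirst, h3] using this.2
        · simpa [reduceFirst, hk] using this
  have hm : ∀ a, MeasurableSet (if a ∈ s then t a else Set.univ) := fun a => by
    split_ifs
    · exact ht a
    · exact MeasurableSet.univ
  have ht' : ∀ a, MeasurableSet (t' a) := by
    intro a
    simp only [t']
    split_ifs with h1 h2
    · exact (measurableSet_le measurable_const measurable_fst).inter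
        ((by fun_prop : Measurable fun y : ℝ × ℝ => (y.1 - c a.1, y.2)) (ht a))
    · exact (measurableSet_le measurable_const measurable_fst).inter
        ((by fun_prop : Measurable fun y : ℝ × ℝ => (y.1 - c a.1, y.2)) MeasurableSet.univ)
    · exact ht a
  have hval : ∀ a ∈ s ∪ z, ((expMeasure (I.lam a.1)).prod (expMeasure (I.mu a.1))) (t' a) =
      (if a ∈ z then ENNReal.ofReal (Real.exp (-(I.lam a.1 * c a.1))) else 1) *
      (if a ∈ s then ((expMeasure (I.lam a.1)).prod (expMeasure (I.mu a.1))) (t a) else 1) := by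
    intro a ha
    by_cases h1 : a.2 = 0
    · simp only [t', h1, if_true, hmz]
      rw [prod_expMeasure_shift (hc a.1) (hm a)]
      split_ifs <;> simp
    · have h2 : a ∈ s := by simpa [hmz, h1] using ha
      simp [t', h1, hmz, h2]
  rw [hset, law, Measure.infinitePi_pi _ fun a _ => ht' a, Finset.prod_congr rfl hval,
    Finset.prod_mul_distrib, Finset.prod_ite_mem, Finset.prod_ite_mem,
    Finset.inter_eq_right.2 Finset.subset_union_right,
    Finset.inter_eq_right.2 Finset.subset_union_left]
  congr 1
  rw [hz, Finset.prod_image (by intro i _ j _ h; simpa using h)]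

/-- The residual times until the first arrivals have the law of the times themselves. -/
lemma law_reduceFirst {c : T → ℝ} (hc : ∀ i, 0 ≤ c i) {D : Set (Outcome T)}
    (hD : MeasurableSet D) :
    I.law {ω | (∀ i, c i ≤ (ω (i, 0)).1) ∧ reduceFirst c ω ∈ D} =
      I.law {ω | ∀ i, c i ≤ (ω (i, 0)).1} * I.law D := by
  set H : Set (Outcome T) := {ω | ∀ i, c i ≤ (ω (i, 0)).1} with hH
  have hHm : MeasurableSet H := by
    have : H = ⋂ i, {ω : Outcome T | c i ≤ (ω (i, 0)).1} := by ext; simp [hH]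
    rw [this]
    exact MeasurableSet.iInter fun i => measurableSet_le measurable_const (by fun_prop)
  set K : ℝ≥0∞ := ∏ i, ENNReal.ofReal (Real.exp (-(I.lam i * c i))) with hK
  have hK0 : K ≠ 0 := by
    rw [hK, Finset.prod_ne_zero_iff]
    intro i _
    simp [Real.exp_pos]
  have hKt : K ≠ ∞ := by
    rw [hK]
    exact ENNReal.prod_ne_top fun i _ => by simp
  have hlawH : I.law H = K := by
    have := I.law_reduceFirst_box hc ∅ (t := fun _ => Set.univ) fun _ => MeasurableSet.univ
    simpa using this
  -- The left side is the conditional law of the residual outcome given `H`. It agrees with the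
  -- product law on boxes, and these determine it.
  have key : K⁻¹ • (I.law.restrict H).map (reduceFirst c) = I.law := by
    refine Measure.eq_infinitePi _ fun s t ht => ?_
    have hpi : MeasurableSet (Set.pi (s : Set (T × ℕ)) t) :=
      MeasurableSet.pi s.countable_toSet fun a _ => ht a
    rw [Measure.smul_apply, Measure.map_apply (measurable_reduceFirst c) hpi,
      Measure.restrict_apply (measurable_reduceFirst c hpi), Set.inter_comm]
    have := I.law_reduceFirst_box hc s ht
    change K⁻¹ * I.law {ω | (∀ i, c i ≤ (ω (i, 0)).1) ∧ reduceFirst c ω ∈ Set.pi s t} = _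
    rw [this, ← mul_assoc, ENNReal.inv_mul_cancel hK0 hKt, one_mul]
  have h2 : I.law D = K⁻¹ * I.law {ω | (∀ i, c i ≤ (ω (i, 0)).1) ∧ reduceFirst c ω ∈ D} := by
    conv_lhs => rw [← key]
    rw [Measure.smul_apply, Measure.map_apply (measurable_reduceFirst c) hD,
      Measure.restrict_apply (measurable_reduceFirst c hD), Set.inter_comm]
    rfl
  rw [hlawH, h2, ← mul_assoc, ENNReal.mul_inv_cancel hK0 hKt, one_mul]

lemma measurableSet_countsAt (h : ℝ) (κ : T → ℕ) :
    MeasurableSet {ω : Outcome T | CountsAt h κ ω} := by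
  have : {ω : Outcome T | CountsAt h κ ω} = ⋂ i,
      (⋂ l, ⋂ (_ : l < κ i), {ω | arrivalTime ω (i, l) < h}) ∩
        {ω | h ≤ arrivalTime ω (i, κ i)} := by
    ext; simp [CountsAt]
  rw [this]
  exact MeasurableSet.iInter fun i => (MeasurableSet.iInter fun l => MeasurableSet.iInter fun _ =>
    measurableSet_lt (by fun_prop) measurable_const).inter
      (measurableSet_le measurable_const (by fun_prop))

/-- The outcome is written as the concatenation at `κ` of two independent ones. For a fixed first
part whose first `κ i` arrivals precede `h`, the remaining event is a lower bound on the first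
interarrival times of the second part, and on it the residual outcome is independent with the
original law (`law_reduceFirst`). If the first part violates this, both sides vanish. -/
lemma law_inter_countsAt {h : ℝ} (hh : 0 ≤ h) (κ : T → ℕ) {B : Set (Outcome T)}
    (hB : MeasurableSet B) :
    I.law (B ∩ {ω | CountsAt h κ ω}) =
      ∫⁻ ω in {ω | CountsAt h κ ω}, I.law {ω' | glue h κ ω ω' ∈ B} ∂I.law := by
  have hE := measurableSet_countsAt h κ
  have hmc := measurable_concatAt κ
  have hg : Measurable fun ω => I.law {ω' | glue h κ ω ω' ∈ B} :=
    measurable_measure_prodMk_left (measurable_glue h κ hB)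
  conv_lhs => rw [← I.law_map_concatAt κ]
  conv_rhs => rw [← lintegral_indicator hE, ← I.law_map_concatAt κ]
  rw [Measure.map_apply hmc (hB.inter hE), Measure.prod_apply (hmc (hB.inter hE)),
    lintegral_map _ hmc]
  swap
  · rw [I.law_map_concatAt κ]
    exact hg.indicator hE
  rw [lintegral_prod]
  swap
  · rw [I.law_map_concatAt κ]
    exact ((hg.indicator hE).comp hmc).aemeasurable
  refine lintegral_congr fun η => ?_
  have e1 : ∀ ω', Set.indicator {ω | CountsAt h κ ω}
      (fun ω => (Measure.map (fun p => concatAt κ p.1 p.2) (I.law.prod I.law))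
        {ω' | glue h κ ω ω' ∈ B}) (concatAt κ η ω') =
      I.law {ω' | glue h κ η ω' ∈ B} *
        {ω' | CountsAt h κ (concatAt κ η ω')}.indicator 1 ω' := by
    intro ω'
    rw [I.law_map_concatAt κ]
    by_cases hc : CountsAt h κ (concatAt κ η ω')
    · simp [Set.indicator, hc, glue_concatAt]
    · simp [Set.indicator, hc]
  have hm1 : MeasurableSet {ω' | CountsAt h κ (concatAt κ η ω')} :=
    (hmc.comp measurable_prodMk_left) hE
  simp only [e1]
  rw [lintegral_const_mul _ (measurable_one.indicator hm1), lintegral_indicator_one hm1]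
  by_cases hP : ∀ i, ∀ l < κ i, arrivalTime η (i, l) < h
  · have hc : ∀ i, 0 ≤ h - arrivalSum η i (κ i) := by
      intro i
      rcases hk : κ i with _ | k
      · simpa [arrivalSum_zero] using hh
      · have := hP i k (by omega)
        rw [arrivalTime_eq_arrivalSum] at this
        linarith
    have hD : MeasurableSet {ω' | glue h κ η ω' ∈ B} :=
      ((measurable_glue h κ).comp measurable_prodMk_left) hB
    have h1 := I.law_reduceFirst hc hD
    have e2 : {ω' | CountsAt h κ (concatAt κ η ω')} =
        {ω' | ∀ i, h - arrivalSum η i (κ i) ≤ (ω' (i, 0)).1} := by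
      ext ω'
      simp only [Set.mem_ofPred_eq, countsAt_concatAt_iff]
      exact and_iff_right hP
    rw [e2, mul_comm, ← h1]
    congr 1
    ext ω'
    simp only [Set.mem_preimage, Set.mem_inter_iff, Set.mem_ofPred_eq, countsAt_concatAt_iff,
      ← concatAt_eq_glue]
    tauto
  · have e2 : {ω' | CountsAt h κ (concatAt κ η ω')} = ∅ := by
      ext ω'
      simp only [Set.mem_ofPred_eq, countsAt_concatAt_iff, Set.mem_empty_iff_false, iff_false]
      exact fun h => hP h.1
    rw [e2, measure_empty, mul_zero]
    convert! measure_empty (μ := I.law) using 2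
    ext ω'
    simp only [Set.mem_preimage, Set.mem_inter_iff, Set.mem_ofPred_eq, countsAt_concatAt_iff,
      Set.mem_empty_iff_false, iff_false]
    exact fun h => hP h.2.1

lemma measurable_restart (h : ℝ) :
    Measurable fun p : Outcome T × Outcome T => restart h p.1 p.2 := by
  have hfm : FiberMeasurable fun ω : Outcome T => arrivedCount ω h := by
    intro κ
    have h1 : ∀ i, Measurable fun ω : Outcome T => arrivedCount ω h i := by
      intro i
      refine measurable_to_countable' fun n => ?_
      -- The second piece accounts for the convention `sInf ∅ = 0` on outcomes with infinitely many
      -- arrivals before `h`.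
      have : (fun ω : Outcome T => arrivedCount ω h i) ⁻¹' {n} =
          ({ω | h ≤ arrivalTime ω (i, n)} ∩ ⋂ l, ⋂ (_ : l < n), {ω | arrivalTime ω (i, l) < h}) ∪
          ({ω | n = 0} ∩ ⋂ l, {ω | arrivalTime ω (i, l) < h}) := by
        ext ω
        simp only [Set.mem_preimage, Set.mem_singleton_iff, Set.mem_union, Set.mem_inter_iff,
          Set.mem_ofPred_eq, Set.mem_iInter]
        constructor
        · rintro rfl
          by_cases hne : {k | h ≤ arrivalTime ω (i, k)}.Nonempty
          · exact .inl ⟨Nat.sInf_mem hne, fun l hl => not_le.1 (Nat.notMem_of_lt_sInf hl)⟩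
          · rw [Set.not_nonempty_iff_eq_empty] at hne
            refine .inr ⟨by simp [arrivedCount, hne], fun l => ?_⟩
            rw [Set.eq_empty_iff_forall_notMem] at hne
            exact not_le.1 (hne l)
        · rintro (⟨h1, h2⟩ | ⟨rfl, h2⟩)
          · refine le_antisymm (Nat.sInf_le h1) (le_csInf ⟨n, h1⟩ fun k hk => ?_)
            by_contra! hlt
            exact (h2 k hlt).not_ge hk
          · have : {k | h ≤ arrivalTime ω (i, k)} = ∅ := by
              ext k; simpa using h2 k
            simp [arrivedCount, this]
      rw [this]
      have hl : ∀ l, MeasurableSet {ω : Outcome T | arrivalTime ω (i, l) < h} := fun l =>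
        measurableSet_lt (by fun_prop) measurable_const
      exact ((measurableSet_le measurable_const (by fun_prop)).inter
        (MeasurableSet.iInter fun l => MeasurableSet.iInter fun _ => hl l)).union
        ((MeasurableSet.const _).inter (MeasurableSet.iInter hl))
    have : {ω : Outcome T | arrivedCount ω h = κ} = ⋂ i, {ω | arrivedCount ω h i = κ i} := by
      ext; simp [funext_iff]
    rw [this]
    exact MeasurableSet.iInter fun i => h1 i (measurableSet_singleton _)
  intro B hB
  have : (fun p : Outcome T × Outcome T => restart h p.1 p.2) ⁻¹' B =
      ⋃ κ : T → ℕ, (Prod.fst ⁻¹' {ω | arrivedCount ω h = κ}) ∩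
        (fun p : Outcome T × Outcome T => glue h κ p.1 p.2) ⁻¹' B := by
    ext p; simp [restart]
  rw [this]
  exact MeasurableSet.iUnion fun κ => (measurable_fst (hfm κ)).inter (measurable_glue h κ hB)

/-- The Markov property of the primitives: what happens from time `h` on is independent of what
happens before, and has the same law as what happens from time `0` on. -/
theorem law_map_restart {h : ℝ} (hh : 0 ≤ h) :
    (I.law.prod I.law).map (fun p => restart h p.1 p.2) = I.law := by
  ext B hB
  have hm := measurable_restart (T := T) h
  -- The vector of counts at time `h` takes countably many values and partitions almost all
  -- outcomes. On each piece `restart` is `glue` at a fixed `κ`, the case settled by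
  -- `law_inter_countsAt`.
  have hae : ∀ᵐ ω ∂I.law, ω ∈ ⋃ κ : T → ℕ, {ω | CountsAt h κ ω} := by
    filter_upwards [I.ae_noCoincidence] with ω hω
    exact Set.mem_iUnion.2 ⟨_, countsAt_arrivedCount hω h⟩
  have hdisj : Pairwise (Function.onFun Disjoint
      fun κ : T → ℕ => {ω : Outcome T | CountsAt h κ ω}) := by
    intro κ κ' hne
    rw [Function.onFun, Set.disjoint_left]
    intro ω h1 h2
    exact hne (h1.eq_arrivedCount.trans h2.eq_arrivedCount.symm)
  have hE := fun κ : T → ℕ => measurableSet_countsAt h κ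
  have h1 : I.law B = ∑' κ : T → ℕ, I.law (B ∩ {ω | CountsAt h κ ω}) := by
    rw [← measure_iUnion (fun κ κ' hne => (hdisj hne).mono Set.inter_subset_right
      Set.inter_subset_right) (fun κ => hB.inter (hE κ)), ← Set.inter_iUnion]
    refine measure_congr ?_
    filter_upwards [hae] with ω hω
    exact propext ⟨fun hb => ⟨hb, hω⟩, fun hb => hb.1⟩
  rw [Measure.map_apply hm hB, Measure.prod_apply (hm hB), h1]
  have h2 : I.law.restrict (⋃ κ : T → ℕ, {ω | CountsAt h κ ω}) = I.law :=
    Measure.restrict_eq_self_of_ae_mem hae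
  conv_lhs => rw [← h2, lintegral_iUnion hE hdisj]
  refine tsum_congr fun κ => ?_
  rw [I.law_inter_countsAt hh κ hB, h2]
  refine setLIntegral_congr_fun (hE κ) fun ω hω => ?_
  have : κ = arrivedCount ω h := CountsAt.eq_arrivedCount hω
  subst this
  rfl

end MatchingInstance

end Restart

/-! ### Emptying times and coupling with a fresh system -/

section Ergodic

open scoped ENNReal
open scoped Classical

variable {T : Type*}

/-- All agents who arrive before time `s` would have abandoned before time `u`. -/
def LeftBy (ω : Outcome T) (s u : ℝ) : Prop := ∀ a, arrivalTime ω a < s → departureTime ω a < u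

lemma LeftBy.mono {ω : Outcome T} {s u v : ℝ} (h : LeftBy ω s u) (huv : u ≤ v) : LeftBy ω s v :=
  fun a ha => (h a ha).trans_le huv

lemma measurableSet_leftBy [Countable T] (s u : ℝ) :
    MeasurableSet {ω : Outcome T | LeftBy ω s u} := by
  have : {ω : Outcome T | LeftBy ω s u} =
      ⋂ a, ({ω | arrivalTime ω a < s}ᶜ ∪ {ω | departureTime ω a < u}) := by
    ext ω
    simp only [LeftBy, Set.mem_ofPred_eq, Set.mem_iInter, Set.mem_union, Set.mem_compl_iff]
    exact forall_congr' fun a => imp_iff_not_or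
  rw [this]
  exact MeasurableSet.iInter fun a => (measurableSet_lt (by fun_prop) measurable_const).compl.union
    (measurableSet_lt (by fun_prop) measurable_const)

lemma arrivalTime_pos {ω : Outcome T} (hω : ∀ a, 0 < (ω a).1) (a : T × ℕ) :
    0 < arrivalTime ω a := by
  have := strictMono_arrivalSum hω a.1 (Nat.zero_lt_succ a.2)
  rwa [arrivalSum_zero] at this

lemma leftBy_zero {ω : Outcome T} (hω : ∀ a, 0 < (ω a).1) (u : ℝ) : LeftBy ω 0 u :=
  fun a ha => absurd ha (arrivalTime_pos hω a).not_gt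

lemma leftBy_of_le_first {ω : Outcome T} (hω : ∀ a, 0 < (ω a).1) {s : ℝ}
    (h : ∀ i, s ≤ (ω (i, 0)).1) (u : ℝ) : LeftBy ω s u := by
  intro a ha
  have h1 := (strictMono_arrivalSum hω a.1).monotone (Nat.succ_le_succ (Nat.zero_le a.2))
  have h2 := arrivalTime_eq ω a.1 0
  rw [arrivalSum_zero, zero_add, arrivalTime_eq_arrivalSum] at h2
  rw [← Nat.zero_add 1] at h2
  have h3 : (ω (a.1, 0)).1 ≤ arrivalTime ω a := h2 ▸ h1
  exact absurd ha ((h a.1).trans h3).not_gt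

/-- An agent of the restarted system is either an agent who arrives before, or a delayed agent. -/
lemma restart_cases {h : ℝ} {ω : Outcome T} (hω : NoCoincidence ω) (ω' : Outcome T) (a : T × ℕ) :
    (arrivalTime ω a < h ∧ arrivalTime (restart h ω ω') a = arrivalTime ω a ∧
      departureTime (restart h ω ω') a = departureTime ω a) ∨
    ∃ k, a = (a.1, arrivedCount ω h a.1 + k) := by
  rcases lt_or_ge a.2 (arrivedCount ω h a.1) with hk | hk
  · exact .inl ⟨(lt_arrivedCount_iff hω).1 hk, arrivalTime_glue_of_lt hk,
      departureTime_glue_of_lt hk⟩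
  · refine .inr ⟨a.2 - arrivedCount ω h a.1, ?_⟩
    rw [Nat.add_sub_cancel' hk]

lemma arrivalTime_restart_add (h : ℝ) (ω ω' : Outcome T) (i : T) (k : ℕ) :
    arrivalTime (restart h ω ω') (i, arrivedCount ω h i + k) = h + arrivalTime ω' (i, k) :=
  arrivalTime_glue_add _ _ _ _ _ _

lemma departureTime_restart_add (h : ℝ) (ω ω' : Outcome T) (i : T) (k : ℕ) :
    departureTime (restart h ω ω') (i, arrivedCount ω h i + k) = h + departureTime ω' (i, k) :=
  departureTime_glue_add _ _ _ _ _ _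

/-- The agents of the restarted outcome are those of `ω` arriving before `h` and those of `ω'`
delayed by `h`. As `s ≥ 0`, all of the former arrive before `h + s`, so the condition decouples into
two independent ones. -/
lemma leftBy_restart_add_iff {h s : ℝ} (hs : 0 ≤ s) {ω ω' : Outcome T} (hω : NoCoincidence ω)
    (u : ℝ) :
    LeftBy (restart h ω ω') (h + s) (h + u) ↔ LeftBy ω h (h + u) ∧ LeftBy ω' s u := by
  constructor
  · intro hl
    refine ⟨fun a ha => ?_, fun a ha => ?_⟩
    · have hk := (lt_arrivedCount_iff hω).2 ha
      have := hl a
      rw [restart, arrivalTime_glue_of_lt hk, departureTime_glue_of_lt hk] at this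
      exact this (by linarith)
    · have := hl (a.1, arrivedCount ω h a.1 + a.2)
      rw [arrivalTime_restart_add, departureTime_restart_add] at this
      simpa using this (by simpa using ha)
  · rintro ⟨h1, h2⟩ a ha
    rcases restart_cases hω ω' a with ⟨h3, h4, h5⟩ | ⟨k, hk⟩
    · rw [h5]; exact h1 a h3
    · rw [hk, arrivalTime_restart_add] at ha
      rw [hk, departureTime_restart_add]
      simpa using h2 (a.1, k) (by simpa using ha)

lemma leftBy_restart_iff {h : ℝ} {ω ω' : Outcome T} (hω : NoCoincidence ω)
    (hω' : NoCoincidence ω') (u : ℝ) : LeftBy (restart h ω ω') h u ↔ LeftBy ω h u := by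
  have := leftBy_restart_add_iff (h := h) le_rfl (ω' := ω') hω (u - h)
  rw [add_zero, add_sub_cancel] at this
  rw [this]
  exact and_iff_left (leftBy_zero hω'.interarrival_pos _)

/-- If the pool of the restarted system is empty at some time after the restart, then from that time
on the system is in the same state as a system that starts empty. -/
lemma present_restart (π : GreedyPolicy T) {h s t : ℝ} (hs : 0 ≤ s) (hst : s ≤ t)
    {ω ω' : Outcome T} (hω : NoCoincidence ω) (hω' : NoCoincidence ω')
    (hR : NoCoincidence (restart h ω ω')) (hl : LeftBy (restart h ω ω') (h + s) (h + s)) :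
    π.present (restart h ω ω') (h + t) = π.present ω' t := by
  have hl' := ((leftBy_restart_add_iff hs hω s).1 hl).2
  set R := restart h ω ω' with hRdef
  -- Renumbers an agent of `ω'` as an agent of the restarted outcome. It shifts all times by `h` and
  -- so preserves every comparison on which the dynamics depend.
  let sh : T × ℕ → T × ℕ := fun a => (a.1, arrivedCount ω h a.1 + a.2)
  have hsa : ∀ a, arrivalTime R (sh a) = h + arrivalTime ω' a := fun a =>
    arrivalTime_restart_add _ _ _ _ _
  have hsd : ∀ a, departureTime R (sh a) = h + departureTime ω' a := fun a =>
    departureTime_restart_add _ _ _ _ _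
  have horder : (arrivalOrder R (h + t)).filter (fun a => decide (h + s ≤ arrivalTime R a)) =
      ((arrivalOrder ω' t).filter fun a => decide (s ≤ arrivalTime ω' a)).map sh := by
    have hanti : Std.Antisymm (fun a b : T × ℕ => arrivalTime R a < arrivalTime R b) :=
      ⟨fun a b h h' => absurd h' h.asymm⟩
    have hp1 := (pairwise_arrivalOrder hR.arrival_injective (h + t)).filter
      (fun a => decide (h + s ≤ arrivalTime R a))
    have hp2 : (((arrivalOrder ω' t).filter fun a => decide (s ≤ arrivalTime ω' a)).map
        sh).Pairwise fun a b => arrivalTime R a < arrivalTime R b := by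
      rw [List.pairwise_map]
      refine ((pairwise_arrivalOrder hω'.arrival_injective t).filter _).imp ?_
      intro a b hab
      rw [hsa, hsa]
      linarith
    have hnd : ∀ l : List (T × ℕ), l.Pairwise (fun a b => arrivalTime R a < arrivalTime R b) →
        l.Nodup := fun l hl => hl.imp fun h => by rintro rfl; exact lt_irrefl _ h
    refine List.Perm.eq_of_pairwise' hp1 hp2 ?_
    rw [List.perm_ext_iff_of_nodup (hnd _ hp1) (hnd _ hp2)]
    intro a
    rw [List.mem_filter, mem_arrivalOrder (hR.finite_arrivedBefore _), decide_eq_true_eq,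
      List.mem_map]
    constructor
    · rintro ⟨h1, h2⟩
      rcases restart_cases hω ω' a with ⟨h3, h4, h5⟩ | ⟨k, hk⟩
      · rw [hRdef, h4] at h2
        linarith
      · refine ⟨(a.1, k), ?_, hk.symm⟩
        rw [hk] at h1 h2
        rw [hRdef, arrivalTime_restart_add] at h1 h2
        rw [List.mem_filter, mem_arrivalOrder (hω'.finite_arrivedBefore _), decide_eq_true_eq]
        constructor <;> linarith
    · rintro ⟨b, hb, rfl⟩
      rw [List.mem_filter, mem_arrivalOrder (hω'.finite_arrivedBefore _),
        decide_eq_true_eq] at hb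
      rw [hsa]
      constructor <;> linarith [hb.1, hb.2]
  rw [GreedyPolicy.present_eq_typeCount, GreedyPolicy.present_eq_typeCount,
    GreedyPolicy.waiting_eq_of_gone hR (by linarith : h + s ≤ h + t) hl,
    GreedyPolicy.waiting_eq_of_gone hω' hst hl', horder, GreedyPolicy.poolRun_map]
  have e1 : (fun b a => liveAt R (sh b) (sh a)) = liveAt ω' := by
    ext b a
    simp [liveAt, hsa, hsd]
  have e2 : (Prod.fst ∘ sh : T × ℕ → T) = Prod.fst := rfl
  rw [e1, e2, List.filter_map]
  have e3 : ((fun a => decide (h + t ≤ departureTime R a)) ∘ sh) =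
      fun a => decide (t ≤ departureTime ω' a) := by
    ext a
    simp [hsd]
  rw [e3]
  ext i
  rw [GreedyPolicy.typeCount, List.filter_map, List.length_map]
  rfl

namespace MatchingInstance

variable (I : MatchingInstance T)

/-- The reflection `s ↦ h - s` turns the integrand into `1 / μ` times the exponential density, of
total mass one. -/
lemma lintegral_exp_Iio {μ : ℝ} (hμ : 0 < μ) (h : ℝ) :
    ∫⁻ s, (Set.Iio h).indicator (fun s => ENNReal.ofReal (Real.exp (-(μ * (h - s))))) s =
      ENNReal.ofReal μ⁻¹ := by
  have := isProbabilityMeasure_expMeasure hμ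
  have h1 := lintegral_expMeasure (r := μ) (fun _ => ENNReal.ofReal μ⁻¹) measurable_const
  rw [lintegral_const, measure_univ, mul_one] at h1
  rw [h1, ← lintegral_sub_left_eq_self _ h]
  refine lintegral_congr fun s => ?_
  by_cases hs : 0 < s
  · simp only [Set.indicator, Set.mem_Iio, Set.mem_Ioi, sub_lt_self_iff, hs, if_true,
      sub_sub_cancel]
    rw [← ENNReal.ofReal_mul (by positivity)]
    congr 1
    field_simp
  · simp [Set.indicator, hs]

/-- The probability that an agent arrives before time `h` and would still wait at time `h + L`. -/
lemma law_survive (a : T × ℕ) {h L : ℝ} (hL : 0 ≤ L) :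
    I.law {ω | arrivalTime ω a < h ∧ h + L ≤ departureTime ω a} =
      ∫⁻ ω, (Set.Iio h).indicator
        (fun s => ENNReal.ofReal (Real.exp (-(I.mu a.1 * (h + L - s))))) (arrivalTime ω a)
        ∂I.law := by
  have hms : MeasurableSet {ω : Outcome T | arrivalTime ω a < h ∧ h + L ≤ departureTime ω a} :=
    (measurableSet_lt (measurable_arrivalTime a) measurable_const).inter
      (measurableSet_le measurable_const (measurable_departureTime a))
  have hmw : Measurable ((Set.Iio h).indicator
      fun s => ENNReal.ofReal (Real.exp (-(I.mu a.1 * (h + L - s))))) :=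
    Measurable.indicator (by fun_prop) measurableSet_Iio
  have hm2 : Measurable fun ω : Outcome T => (Set.Iio h).indicator
      (fun s => ENNReal.ofReal (Real.exp (-(I.mu a.1 * (h + L - s))))) (arrivalTime ω a) :=
    hmw.comp (measurable_arrivalTime a)
  rw [← lintegral_indicator_one hms, I.lintegral_update a (measurable_one.indicator hms),
    I.lintegral_update a hm2]
  refine lintegral_congr fun ω => ?_
  have hu : Measurable fun y : ℝ × ℝ => Function.update ω a y :=
    (measurable_update_outcome a).comp (measurable_const.prodMk measurable_id)
  have hu1 : Measurable fun y : ℝ × ℝ =>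
      {ω : Outcome T | arrivalTime ω a < h ∧ h + L ≤ departureTime ω a}.indicator
        (1 : Outcome T → ℝ≥0∞) (Function.update ω a y) := (measurable_one.indicator hms).comp hu
  have hu2 : Measurable fun y : ℝ × ℝ => (Set.Iio h).indicator
      (fun s => ENNReal.ofReal (Real.exp (-(I.mu a.1 * (h + L - s)))))
      (arrivalTime (Function.update ω a y) a) := hm2.comp hu
  rw [lintegral_prod _ hu1.aemeasurable, lintegral_prod _ hu2.aemeasurable]
  refine lintegral_congr fun x => ?_
  have harr : ∀ d, arrivalTime (Function.update ω a (x, d)) a = arrivalSum ω a.1 a.2 + x := by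
    intro d
    have h1 := arrivalTime_eq (Function.update ω (a.1, a.2) (x, d)) a.1 a.2
    rw [arrivalSum_update_of_le le_rfl, Function.update_self] at h1
    exact h1
  have hdep : ∀ d, departureTime (Function.update ω a (x, d)) a =
      arrivalSum ω a.1 a.2 + x + d := fun d => by
    rw [departureTime, harr, Function.update_self]
  simp only [harr, hdep, Set.indicator, Set.mem_ofPred_eq, Set.mem_Iio, Pi.one_apply]
  set y := arrivalSum ω a.1 a.2 + x
  by_cases hy : y < h
  · simp only [hy, true_and, if_true, lintegral_const, measure_univ, mul_one]
    have h2 := expMeasure_Ici (I.mu_pos a.1) (c := h + L - y) (by linarith)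
    rw [← h2, ← lintegral_indicator_one measurableSet_Ici]
    refine lintegral_congr fun d => ?_
    simp [Set.indicator, add_comm]
  · simp [hy]

variable [Fintype T]

/-- It is unlikely that some agent who arrives before time `h` would still wait much later. -/
lemma law_not_leftBy_le (h : ℝ) {L : ℝ} (hL : 0 ≤ L) :
    I.law {ω | ¬ LeftBy ω h (h + L)} ≤
      ENNReal.ofReal (∑ i, I.lam i / I.mu i * Real.exp (-(I.mu i * L))) := by
  have h1 : {ω : Outcome T | ¬ LeftBy ω h (h + L)} =
      ⋃ i : T, ⋃ k : ℕ, {ω | arrivalTime ω (i, k) < h ∧ h + L ≤ departureTime ω (i, k)} := by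
    ext ω
    simp [LeftBy]
  rw [h1, ENNReal.ofReal_sum_of_nonneg fun i _ => mul_nonneg
    (div_nonneg (I.lam_pos i).le (I.mu_pos i).le) (Real.exp_nonneg _)]
  refine (measure_iUnion_fintype_le _ _).trans (Finset.sum_le_sum fun i _ => ?_)
  refine (measure_iUnion_le _).trans ?_
  simp only [I.law_survive (i, _) hL]
  have hmw : Measurable ((Set.Iio h).indicator
      fun s => ENNReal.ofReal (Real.exp (-(I.mu i * (h + L - s))))) :=
    Measurable.indicator (by fun_prop) measurableSet_Iio
  have hmk : ∀ k, Measurable fun ω : Outcome T => (Set.Iio h).indicator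
      (fun s => ENNReal.ofReal (Real.exp (-(I.mu i * (h + L - s))))) (arrivalTime ω (i, k)) :=
    fun k => hmw.comp (measurable_arrivalTime (i, k))
  rw [← lintegral_tsum fun k => (hmk k).aemeasurable]
  -- After the union bound, the sum over agents is an integral over arrival times, `λ_i ∫_0^h exp
  -- (-(μ_i (h + L - s))) ds ≤ (λ_i / μ_i) exp (-(μ_i L))`, a bound independent of `h`.
  have h2 := I.lintegral_tsum_arrivals
    (⟨fun _ => WellOrderingRel, fun _ => inferInstance⟩ : GreedyPolicy T) hmw (fun _ => True) i
  have h3 : I.law {ω : Outcome T | True} = 1 := by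
    rw [← measure_univ (μ := I.law)]; congr 1
  rw [h3] at h2
  simp only [if_true, mul_one] at h2
  rw [h2]
  have h4 : ∫⁻ s in Set.Ioi 0, (Set.Iio h).indicator
      (fun s => ENNReal.ofReal (Real.exp (-(I.mu i * (h + L - s))))) s ≤
      ENNReal.ofReal (Real.exp (-(I.mu i * L))) * ENNReal.ofReal (I.mu i)⁻¹ := by
    refine (setLIntegral_le_lintegral _ _).trans ?_
    rw [← lintegral_exp_Iio (I.mu_pos i) h, ← lintegral_const_mul' _ _ (by simp)]
    refine lintegral_mono fun s => ?_
    by_cases hs : s < h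
    · simp only [Set.indicator, Set.mem_Iio, hs, if_true]
      rw [← ENNReal.ofReal_mul (Real.exp_nonneg _), ← Real.exp_add]
      refine ENNReal.ofReal_le_ofReal (Real.exp_le_exp.2 (le_of_eq ?_))
      ring
    · simp [Set.indicator, hs]
  refine (mul_le_mul_right h4 _).trans (le_of_eq ?_)
  rw [← ENNReal.ofReal_mul (Real.exp_nonneg _), ← ENNReal.ofReal_mul (I.lam_pos i).le]
  congr 1
  ring

lemma tendsto_survive : Tendsto (fun L : ℝ => ENNReal.ofReal
    (∑ i, I.lam i / I.mu i * Real.exp (-(I.mu i * L)))) atTop (𝓝 0) := by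
  rw [← ENNReal.ofReal_zero]
  refine ENNReal.tendsto_ofReal ?_
  have : (0 : ℝ) = ∑ i : T, I.lam i / I.mu i * 0 := by simp
  rw [this]
  refine tendsto_finsetSum _ fun i _ => Tendsto.const_mul _ ?_
  exact Real.tendsto_exp_neg_atTop_nhds_zero.comp (tendsto_id.const_mul_atTop (I.mu_pos i))

lemma ae_restart {h : ℝ} (hh : 0 ≤ h) : ∀ᵐ p ∂(I.law.prod I.law),
    NoCoincidence p.1 ∧ NoCoincidence p.2 ∧ NoCoincidence (restart h p.1 p.2) := by
  have h1 := I.ae_noCoincidence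
  refine (Measure.quasiMeasurePreserving_fst.ae h1).and
    ((Measure.quasiMeasurePreserving_snd.ae h1).and ?_)
  have h2 := h1
  rw [← I.law_map_restart hh] at h2
  exact ae_of_ae_map (measurable_restart h).aemeasurable h2

/-- The probability of an event, computed by restarting at time `h`. -/
lemma law_eq_restart {h : ℝ} (hh : 0 ≤ h) {A : Set (Outcome T)} (hA : MeasurableSet A) :
    I.law A = (I.law.prod I.law) {p | restart h p.1 p.2 ∈ A} := by
  conv_lhs => rw [← I.law_map_restart hh]
  rw [Measure.map_apply (measurable_restart h) hA]
  rfl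

lemma law_first_pos {L : ℝ} (hL : 0 ≤ L) : 0 < I.law {ω | ∀ i, L ≤ (ω (i, 0)).1} := by
  have h1 := I.law_reduceFirst_box (c := fun _ => L) (fun _ => hL) ∅ (t := fun _ => Set.univ)
    fun _ => MeasurableSet.univ
  have h2 : {ω : Outcome T | (∀ i, L ≤ (ω (i, 0)).1) ∧ reduceFirst (fun _ => L) ω ∈
      Set.pi ((∅ : Finset (T × ℕ)) : Set (T × ℕ)) fun _ => Set.univ} =
      {ω | ∀ i, L ≤ (ω (i, 0)).1} := by
    ext; simp
  rw [h2, Finset.prod_empty, mul_one] at h1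
  rw [h1, pos_iff_ne_zero, Finset.prod_ne_zero_iff]
  intro i _
  simp [Real.exp_pos]

/-- The system is empty at any given time with probability bounded from below. -/
lemma exists_le_law_leftBy : ∃ c : ℝ≥0∞, 0 < c ∧ ∀ s : ℝ, c ≤ I.law {ω | LeftBy ω s s} := by
  -- With this `L`, at any time all agents who have arrived would be gone `L` later with probability
  -- at least `1/2`. The constant is this `1/2` times the probability `m` of no arrivals during a
  -- time `L`.
  obtain ⟨L, hL, hL0⟩ := (((tendsto_order.1 I.tendsto_survive).2 (1 / 2) (by simp)).and
    (eventually_ge_atTop 0)).exists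
  set m := I.law {ω | ∀ i, L ≤ (ω (i, 0)).1} with hm
  have hmp : 0 < m := I.law_first_pos hL0
  have hfm : MeasurableSet {ω : Outcome T | ∀ i, L ≤ (ω (i, 0)).1} := by
    have : {ω : Outcome T | ∀ i, L ≤ (ω (i, 0)).1} = ⋂ i, {ω | L ≤ (ω (i, 0)).1} := by ext; simp
    rw [this]
    exact MeasurableSet.iInter fun i => measurableSet_le measurable_const (by fun_prop)
  refine ⟨1 / 2 * m, ENNReal.mul_pos (by simp) hmp.ne', fun s => ?_⟩
  have hhalf : (1 / 2 : ℝ≥0∞) * m ≤ m :=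
    (mul_le_mul_left (by simp : (1 / 2 : ℝ≥0∞) ≤ 1) m).trans_eq (one_mul m)
  rcases le_total s L with hs | hs
  · refine hhalf.trans (measure_mono_ae ?_)
    filter_upwards [I.ae_noCoincidence] with ω hω h
    exact leftBy_of_le_first hω.interarrival_pos (fun i => hs.trans (h i)) s
  -- Restart at `s - L`: the earlier agents are gone by `s`, and independently nobody arrives in
  -- between.
  · have hh : 0 ≤ s - L := by linarith
    rw [I.law_eq_restart hh (measurableSet_leftBy s s)]
    have h1 : (1 / 2 : ℝ≥0∞) ≤ I.law {ω | LeftBy ω (s - L) (s - L + L)} := by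
      have h2 := prob_compl_eq_one_sub (μ := I.law) (measurableSet_leftBy (T := T) (s - L) (s - L + L)).compl
      rw [compl_compl] at h2
      rw [h2]
      have h3 : I.law {ω | LeftBy ω (s - L) (s - L + L)}ᶜ ≤ 1 / 2 :=
        (I.law_not_leftBy_le (s - L) hL0).trans hL.le
      calc (1 / 2 : ℝ≥0∞) = 1 - 1 / 2 := by simp
        _ ≤ _ := tsub_le_tsub_left h3 1
    calc 1 / 2 * m ≤ I.law {ω | LeftBy ω (s - L) (s - L + L)} * m := mul_le_mul_left h1 m
      _ = (I.law.prod I.law) ({ω | LeftBy ω (s - L) (s - L + L)} ×ˢ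
          {ω | ∀ i, L ≤ (ω (i, 0)).1}) := (Measure.prod_prod _ _).symm
      _ ≤ _ := measure_mono_ae ?_
    filter_upwards [I.ae_restart hh] with p hp hmem
    have := (leftBy_restart_add_iff hL0 hp.1 (ω' := p.2) L).2
      ⟨hmem.1, leftBy_of_le_first hp.2.1.interarrival_pos hmem.2 L⟩
    change LeftBy _ s s
    simpa using this

/-- The probability that the system is not empty at any of the times `L, 2 L, …, K L`. -/
noncomputable def busyProb (L : ℝ) (K : ℕ) : ℝ≥0∞ :=
  I.law {ω | ∀ m : ℕ, 1 ≤ m → m ≤ K → ¬ LeftBy ω (m * L) (m * L)}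

/-- The last time at which the system is empty splits into an empty system and a busy restarted
system. -/
lemma law_last_empty {L : ℝ} (hL : 0 ≤ L) {k K : ℕ} (hk : k ≤ K) :
    I.law {ω | LeftBy ω (k * L) (k * L) ∧ ∀ m : ℕ, k < m → m ≤ K → ¬ LeftBy ω (m * L) (m * L)} =
      I.law {ω | LeftBy ω (k * L) (k * L)} * I.busyProb L (K - k) := by
  have hh : (0 : ℝ) ≤ k * L := by positivity
  have hms : MeasurableSet {ω : Outcome T | LeftBy ω (k * L) (k * L) ∧
      ∀ m : ℕ, k < m → m ≤ K → ¬ LeftBy ω (m * L) (m * L)} := by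
    have : {ω : Outcome T | LeftBy ω (k * L) (k * L) ∧
      ∀ m : ℕ, k < m → m ≤ K → ¬ LeftBy ω (m * L) (m * L)} = {ω | LeftBy ω (k * L) (k * L)} ∩
      ⋂ m : ℕ, ⋂ (_ : k < m), ⋂ (_ : m ≤ K), {ω | LeftBy ω (m * L) (m * L)}ᶜ := by
      ext; simp
    rw [this]
    exact (measurableSet_leftBy _ _).inter (MeasurableSet.iInter fun m =>
      MeasurableSet.iInter fun _ => MeasurableSet.iInter fun _ => (measurableSet_leftBy _ _).compl)
  rw [I.law_eq_restart hh hms, busyProb, ← Measure.prod_prod]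
  refine measure_congr ?_
  filter_upwards [I.ae_restart hh] with p hp
  have hadd : ∀ m : ℕ, LeftBy (restart (k * L) p.1 p.2) ((k + m : ℕ) * L) ((k + m : ℕ) * L) ↔
      LeftBy p.1 (k * L) ((k + m : ℕ) * L) ∧ LeftBy p.2 (m * L) (m * L) := fun m => by
    have := leftBy_restart_add_iff (h := k * L) (s := m * L) (by positivity) hp.1 (ω' := p.2)
      (m * L)
    rw [Nat.cast_add, add_mul]
    exact this
  refine propext ?_
  change (LeftBy (restart (k * L) p.1 p.2) (k * L) (k * L) ∧ ∀ m : ℕ, k < m → m ≤ K →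
    ¬ LeftBy (restart (k * L) p.1 p.2) (m * L) (m * L)) ↔ (LeftBy p.1 (k * L) (k * L) ∧
    ∀ m : ℕ, 1 ≤ m → m ≤ K - k → ¬ LeftBy p.2 (m * L) (m * L))
  rw [leftBy_restart_iff hp.1 hp.2.1]
  refine and_congr_right fun h1 => ?_
  constructor
  · intro h2 m hm1 hm2 hm3
    refine h2 (k + m) (by omega) (by omega) ((hadd m).2 ⟨h1.mono ?_, hm3⟩)
    rw [Nat.cast_add, add_mul]
    linarith [(by positivity : (0 : ℝ) ≤ m * L)]
  · intro h2 m hm1 hm2 hm3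
    obtain ⟨l, rfl⟩ := Nat.exists_eq_add_of_lt hm1
    rw [add_assoc] at hm3
    exact h2 (l + 1) (by omega) (by omega) ((hadd (l + 1)).1 hm3).2

/-- The system becomes empty eventually. -/
lemma tendsto_busyProb {L : ℝ} (hL : 0 ≤ L) : Tendsto (I.busyProb L) atTop (𝓝 0) := by
  obtain ⟨c, hc, hcu⟩ := I.exists_le_law_leftBy
  have hc1 : c ≠ ∞ := ne_top_of_le_ne_top ENNReal.one_ne_top ((hcu 0).trans prob_le_one)
  -- Let `B k` say that `k` is the last of `0, …, K` at which the system is empty. These `K + 1`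
  -- events are disjoint, and `B k` has probability at least `c * busyProb L (K - k) ≥ c * busyProb
  -- L K`, so `(K + 1) * c * busyProb L K ≤ 1`.
  have key : ∀ K : ℕ, I.busyProb L K ≤ c⁻¹ * ((K + 1 : ℕ) : ℝ≥0∞)⁻¹ := by
    intro K
    set B : ℕ → Set (Outcome T) := fun k => {ω | LeftBy ω (k * L) (k * L) ∧
      ∀ m : ℕ, k < m → m ≤ K → ¬ LeftBy ω (m * L) (m * L)} with hB
    have hBm : ∀ k, MeasurableSet (B k) := fun k => by
      have : B k = {ω | LeftBy ω (k * L) (k * L)} ∩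
          ⋂ m : ℕ, ⋂ (_ : k < m), ⋂ (_ : m ≤ K), {ω | LeftBy ω (m * L) (m * L)}ᶜ := by
        ext; simp [hB]
      rw [this]
      exact (measurableSet_leftBy _ _).inter (MeasurableSet.iInter fun m =>
        MeasurableSet.iInter fun _ => MeasurableSet.iInter fun _ =>
          (measurableSet_leftBy _ _).compl)
    have hdisj : (↑(Finset.range (K + 1)) : Set ℕ).PairwiseDisjoint B := by
      intro k hk l hl hkl
      rw [Function.onFun, Set.disjoint_left]
      rintro ω ⟨h1, h2⟩ ⟨h3, h4⟩
      simp only [Finset.coe_range, Set.mem_Iio] at hk hl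
      rcases lt_or_gt_of_ne hkl with h | h
      · exact h2 l h (by omega) h3
      · exact h4 k h (by omega) h1
    have h1 := measure_biUnion_finset (μ := I.law) hdisj fun k _ => hBm k
    have h2 : ∑ k ∈ Finset.range (K + 1), I.law (B k) ≤ 1 := by
      rw [← h1]; exact prob_le_one
    have h3 : ∑ k ∈ Finset.range (K + 1), c * I.busyProb L K ≤
        ∑ k ∈ Finset.range (K + 1), I.law (B k) := by
      refine Finset.sum_le_sum fun k hk => ?_
      rw [hB, I.law_last_empty hL (by simpa [Nat.lt_succ_iff] using hk)]
      exact mul_le_mul' (hcu _) (measure_mono fun _ hω m h1 h2 =>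
        hω m h1 (h2.trans (Nat.sub_le K k)))
    have h4 := h3.trans h2
    rw [Finset.sum_const, Finset.card_range, nsmul_eq_mul] at h4
    rw [← ENNReal.mul_inv (.inl hc.ne') (.inl hc1), ← one_div]
    rw [ENNReal.le_div_iff_mul_le (.inl (mul_ne_zero hc.ne' (by simp)))
      (.inl (ENNReal.mul_ne_top hc1 (by simp)))]
    calc _ = ((K + 1 : ℕ) : ℝ≥0∞) * (c * I.busyProb L K) := by ring
      _ ≤ 1 := h4
  have hlim : Tendsto (fun K : ℕ => c⁻¹ * ((K + 1 : ℕ) : ℝ≥0∞)⁻¹) atTop (𝓝 0) := by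
    have h1 : Tendsto (fun K : ℕ => ((K + 1 : ℕ) : ℝ≥0∞)⁻¹) atTop (𝓝 0) :=
      ENNReal.tendsto_inv_nat_nhds_zero.comp (tendsto_add_atTop_nat 1)
    simpa using ENNReal.Tendsto.const_mul h1 (.inr (ENNReal.inv_ne_top.2 hc.ne'))
  exact tendsto_of_tendsto_of_tendsto_of_le_of_le tendsto_const_nhds hlim (fun _ => bot_le) key

/-- The restarted system and the system that starts empty are in the same state, except with small
probability. -/
lemma exists_law_present_ne_le (π : GreedyPolicy T) {ε : ℝ≥0∞} (hε : 0 < ε) :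
    ∃ t₀ : ℝ, 0 ≤ t₀ ∧ ∀ t ≥ t₀, ∀ h ≥ 0, (I.law.prod I.law)
      {p | π.present (restart h p.1 p.2) (h + t) ≠ π.present p.2 t} ≤ ε := by
  have hε2 : 0 < ε / 2 := ENNReal.half_pos hε.ne'
  obtain ⟨L, hL, hL0⟩ := (((tendsto_order.1 I.tendsto_survive).2 (ε / 2) hε2).and
    (eventually_ge_atTop 0)).exists
  obtain ⟨K, hK⟩ := ((tendsto_order.1 (I.tendsto_busyProb hL0)).2 (ε / 2) hε2).exists
  -- If the agents from before `h` are gone by `h + L` and the fresh system is empty at some `m L`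
  -- with `1 ≤ m ≤ K`, then the restarted system is empty at `h + m L` and the two agree from then
  -- on. Each condition fails with probability at most `ε / 2`.
  refine ⟨K * L, by positivity, fun t ht h hh => ?_⟩
  have h1 : (I.law.prod I.law) {p | π.present (restart h p.1 p.2) (h + t) ≠ π.present p.2 t} ≤
      (I.law.prod I.law) ({ω | ¬ LeftBy ω h (h + L)} ×ˢ Set.univ ∪ Set.univ ×ˢ
        {ω | ∀ m : ℕ, 1 ≤ m → m ≤ K → ¬ LeftBy ω (m * L) (m * L)}) := by
    refine measure_mono_ae ?_
    filter_upwards [I.ae_restart hh] with p hp hne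
    by_contra hcon
    have hcon' : LeftBy p.1 h (h + L) ∧ ∃ m : ℕ, 1 ≤ m ∧ m ≤ K ∧ LeftBy p.2 (m * L) (m * L) := by
      by_contra hcc
      refine hcon ?_
      by_cases h3 : LeftBy p.1 h (h + L)
      · refine .inr ⟨trivial, fun m h4 h5 h6 => hcc ⟨h3, m, h4, h5, h6⟩⟩
      · exact .inl ⟨h3, trivial⟩
    obtain ⟨h3, m, h4, h5, h6⟩ := hcon'
    have hm1 : L ≤ m * L := by
      have : (1 : ℝ) ≤ m := by exact_mod_cast h4
      nlinarith
    have hm2 : m * L ≤ t := by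
      have : (m : ℝ) ≤ K := by exact_mod_cast h5
      nlinarith
    refine hne (present_restart π (s := m * L) (by positivity) hm2 hp.1 hp.2.1 hp.2.2 ?_)
    exact (leftBy_restart_add_iff (by positivity) hp.1 _).2 ⟨h3.mono (by linarith), h6⟩
  refine h1.trans ((measure_union_le _ _).trans ?_)
  rw [Measure.prod_prod, Measure.prod_prod, measure_univ, mul_one, one_mul]
  calc _ ≤ ε / 2 + ε / 2 := add_le_add ((I.law_not_leftBy_le h hL0).trans hL.le) hK.le
    _ = ε := ENNReal.add_halves ε

end MatchingInstance

end Ergodic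

/-! ### The relaxation equation and time averages -/

section Relaxation

/-- From some time on, the primitive decreases at rate at least `δ` wherever it is at or above `c`.
It must therefore reach `c`, and by continuity it cannot exceed `c` again. -/
lemma eventually_primitive_le {φ : ℝ → ℝ} (hφ : ∀ a b, IntervalIntegrable φ volume a b) {c δ : ℝ}
    (hδ : 0 < δ) (h : ∀ᶠ u in atTop, c ≤ ∫ v in (0 : ℝ)..u, φ v → φ u ≤ -δ) :
    ∀ᶠ t in atTop, ∫ v in (0 : ℝ)..t, φ v ≤ c := by
  set F : ℝ → ℝ := fun t => ∫ v in (0 : ℝ)..t, φ v with hF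
  have hcont : Continuous F := intervalIntegral.continuous_primitive hφ 0
  obtain ⟨T₀, hT⟩ := eventually_atTop.1 h
  have hinc : ∀ s t, T₀ ≤ s → s ≤ t → (∀ u ∈ Set.Ioc s t, c ≤ F u) → F t ≤ F s - δ * (t - s) := by
    intro s t hs hst hu
    have h1 : F s + ∫ v in s..t, φ v = F t :=
      intervalIntegral.integral_add_adjacent_intervals (hφ 0 s) (hφ s t)
    have h2 : ∫ v in s..t, φ v ≤ ∫ _ in s..t, -δ := by
      refine intervalIntegral.integral_mono_on_of_le_Ioo hst (hφ s t)
        intervalIntegrable_const fun u hu' => ?_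
      exact hT u (hs.trans hu'.1.le) (hu u ⟨hu'.1, hu'.2.le⟩)
    rw [intervalIntegral.integral_const, smul_eq_mul] at h2
    linarith
  have hex : ∃ s ≥ T₀, F s ≤ c := by
    by_contra! hcon
    -- The time by which a decrease at rate `δ` would have brought the primitive down to `c`.
    have h1 := hinc T₀ (T₀ + (F T₀ - c) / δ) le_rfl
      (by have := hcon T₀ le_rfl; linarith [div_nonneg (sub_nonneg.2 this.le) hδ.le])
      fun u hu => (hcon u hu.1.le).le
    have h2 := hcon (T₀ + (F T₀ - c) / δ)
      (by have := hcon T₀ le_rfl; linarith [div_nonneg (sub_nonneg.2 this.le) hδ.le])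
    rw [add_sub_cancel_left, mul_div_cancel₀ _ hδ.ne'] at h1
    linarith
  obtain ⟨s, hs, hsc⟩ := hex
  filter_upwards [eventually_ge_atTop s] with t ht
  by_contra! hcon
  have hcomp : IsCompact (Set.Icc s t ∩ F ⁻¹' Set.Iic c) :=
    isCompact_Icc.inter_right (isClosed_Iic.preimage hcont)
  -- The last time in `[s, t]` at which the primitive is at most `c`; after it the primitive only
  -- decreases, so it cannot exceed `c` at `t`.
  obtain ⟨u, ⟨hu1, hu2⟩, hu3⟩ := hcomp.exists_isGreatest ⟨s, ⟨le_rfl, ht⟩, hsc⟩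
  have h1 := hinc u t (hs.trans hu1.1) hu1.2 fun v hv => by
    by_contra! hvc
    exact absurd (hu3 ⟨⟨hu1.1.trans hv.1.le, hv.2⟩, hvc.le⟩) (not_le.2 hv.1)
  have h2 : F u ≤ c := hu2
  nlinarith [mul_nonneg hδ.le (sub_nonneg.2 hu1.2)]

/-- A solution of `f' = g - μ f` converges if `g` does. -/
lemma tendsto_of_relaxation {f g : ℝ → ℝ} {μ a : ℝ} (hμ : 0 < μ)
    (hfi : ∀ a b, IntervalIntegrable f volume a b) (hgi : ∀ a b, IntervalIntegrable g volume a b)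
    (hf : ∀ t ≥ 0, f t = ∫ u in (0 : ℝ)..t, (g u - μ * f u)) (hg : Tendsto g atTop (𝓝 a)) :
    Tendsto f atTop (𝓝 (a / μ)) := by
  have hi : ∀ a b, IntervalIntegrable (fun u => g u - μ * f u) volume a b := fun a b =>
    (hgi a b).sub ((hfi a b).const_mul μ)
  have hup : ∀ η > 0, ∀ᶠ t in atTop, f t ≤ a / μ + η := by
    intro η hη
    -- Where `f ≥ a / μ + η` and `g < a + μ η / 2`, the drift `g - μ f` is below `-(μ η / 2)`. The
    -- lower bound is the same argument for `-f`.
    have h1 := eventually_primitive_le hi (c := a / μ + η) (δ := μ * η / 2) (by positivity) (by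
      filter_upwards [eventually_ge_atTop 0, hg.eventually_lt_const
        (show a < a + μ * η / 2 by linarith [mul_pos hμ hη])] with u hu0 hu1 hu2
      rw [← hf u hu0] at hu2
      have : μ * (a / μ + η) ≤ μ * f u := mul_le_mul_of_nonneg_left hu2 hμ.le
      rw [mul_add, mul_div_cancel₀ _ hμ.ne'] at this
      linarith)
    filter_upwards [h1, eventually_ge_atTop 0] with t ht ht0
    rwa [hf t ht0]
  have hlo : ∀ η > 0, ∀ᶠ t in atTop, a / μ - η ≤ f t := by
    intro η hη
    have h1 := eventually_primitive_le (fun a b => (hi a b).neg) (c := -(a / μ - η))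
      (δ := μ * η / 2) (by positivity) (by
      filter_upwards [eventually_ge_atTop 0, hg.eventually_const_lt
        (show a - μ * η / 2 < a by linarith [mul_pos hμ hη])] with u hu0 hu1 hu2
      simp only [Pi.neg_apply, intervalIntegral.integral_neg] at hu2 ⊢
      rw [← hf u hu0] at hu2
      have : μ * f u ≤ μ * (a / μ - η) := mul_le_mul_of_nonneg_left (by linarith) hμ.le
      rw [mul_sub, mul_div_cancel₀ _ hμ.ne'] at this
      linarith)
    filter_upwards [h1, eventually_ge_atTop 0] with t ht ht0
    simp only [Pi.neg_apply, intervalIntegral.integral_neg] at ht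
    rw [hf t ht0]
    linarith
  rw [tendsto_order]
  constructor
  · intro b hb
    filter_upwards [hlo ((a / μ - b) / 2) (by linarith)] with t ht
    linarith
  · intro b hb
    filter_upwards [hup ((b - a / μ) / 2) (by linarith)] with t ht
    linarith

/-- The time averages of a convergent function converge to the same limit. -/
lemma tendsto_average {f : ℝ → ℝ} {a : ℝ} (hfi : ∀ a b, IntervalIntegrable f volume a b)
    (hf : Tendsto f atTop (𝓝 a)) :
    Tendsto (fun t => (1 / t) * ∫ u in (0 : ℝ)..t, f u) atTop (𝓝 a) := by
  rw [Metric.tendsto_atTop]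
  intro ε hε
  obtain ⟨T₀, hT⟩ := Metric.tendsto_atTop.1 hf (ε / 2) (by linarith)
  set C := |∫ u in (0 : ℝ)..T₀, (f u - a)| with hC
  have hC0 : 0 ≤ C := abs_nonneg _
  -- The second bound (in which `ε⁻¹ * ε = 1`) makes `2 C + ε |T₀| < ε t`, so the initial segment,
  -- after division by `t`, costs less than the `ε / 2` left over by the tail.
  refine ⟨max (max T₀ 1) (2 * C / ε + ε⁻¹ * ε + |T₀| + 1), fun t ht => ?_⟩
  have ht1 : T₀ ≤ t := ((le_max_left _ _).trans (le_max_left _ _)).trans ht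
  have ht2 : 1 ≤ t := ((le_max_right _ _).trans (le_max_left _ _)).trans ht
  have ht3 : 2 * C / ε + ε⁻¹ * ε + |T₀| + 1 ≤ t := (le_max_right _ _).trans ht
  rw [inv_mul_cancel₀ hε.ne'] at ht3
  have ht0 : 0 < t := by linarith
  have hi : ∀ b c, IntervalIntegrable (fun u => f u - a) volume b c := fun b c =>
    (hfi b c).sub intervalIntegrable_const
  have h1 : (1 / t) * (∫ u in (0 : ℝ)..t, f u) - a =
      (1 / t) * ((∫ u in (0 : ℝ)..T₀, (f u - a)) + ∫ u in T₀..t, (f u - a)) := by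
    rw [intervalIntegral.integral_add_adjacent_intervals (hi _ _) (hi _ _),
      intervalIntegral.integral_sub (hfi _ _) intervalIntegrable_const,
      intervalIntegral.integral_const, smul_eq_mul, sub_zero]
    field_simp
  have h2 : ‖∫ u in T₀..t, (f u - a)‖ ≤ ε / 2 * |t - T₀| := by
    refine intervalIntegral.norm_integral_le_of_norm_le_const fun u hu => ?_
    rw [Set.uIoc_of_le ht1] at hu
    exact (hT u hu.1.le).le
  rw [Real.dist_eq, h1, abs_mul, abs_of_pos (by positivity : 0 < 1 / t), one_div,
    inv_mul_lt_iff₀ ht0]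
  have h3 := abs_add_le (∫ u in (0 : ℝ)..T₀, (f u - a)) (∫ u in T₀..t, (f u - a))
  rw [abs_of_nonneg (sub_nonneg.2 ht1), Real.norm_eq_abs] at h2
  have h4 : 2 * C + ε * |T₀| < ε * t := by
    have : ε * (2 * C / ε + 1 + |T₀| + 1) ≤ ε * t := mul_le_mul_of_nonneg_left ht3 hε.le
    have h5 : ε * (2 * C / ε) = 2 * C := by field_simp
    nlinarith
  have h6 : -(ε * T₀) ≤ ε * |T₀| := by nlinarith [neg_abs_le T₀]
  nlinarith

end Relaxation

/-! ### Convergence of the law of the state -/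

section Limits

open scoped ENNReal
open scoped Classical

variable {T : Type*}

namespace GreedyPolicy

lemma measurableSet_present [Countable T] (π : GreedyPolicy T) (A : Set (T → ℕ)) :
    MeasurableSet {x : Outcome T × ℝ | π.present x.1 x.2 ∈ A} := by
  simp only [present_eq_typeCount]
  exact π.measurableSet_waiting fun l => typeCount Prod.fst l ∈ A

lemma measurableSet_present_at [Countable T] (π : GreedyPolicy T) (t : ℝ) (A : Set (T → ℕ)) :
    MeasurableSet {ω : Outcome T | π.present ω t ∈ A} := by
  have h : Measurable fun ω : Outcome T => (ω, t) := measurable_id.prodMk measurable_const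
  exact h (π.measurableSet_present A)

variable [Fintype T] (π : GreedyPolicy T) (I : MatchingInstance T)

lemma measurable_present_at (t : ℝ) : Measurable fun ω : Outcome T => π.present ω t :=
  measurable_to_countable' fun m => π.measurableSet_present_at t {m}

/-- The distribution of the state at time `t`. -/
noncomputable def stateLaw (t : ℝ) : Measure (T → ℕ) := I.law.map fun ω => π.present ω t

instance isProbabilityMeasure_stateLaw (t : ℝ) : IsProbabilityMeasure (π.stateLaw I t) :=
  Measure.isProbabilityMeasure_map (π.measurable_present_at t).aemeasurable

lemma stateLaw_real (t : ℝ) (A : Set (T → ℕ)) :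
    (π.stateLaw I t).real A = I.law.real {ω | π.present ω t ∈ A} :=
  map_measureReal_apply (π.measurable_present_at t) A.to_countable.measurableSet

/-- The coupling inequality: under the product law the restarted state at `h + t` has the law at `h
+ t`, the fresh state has the law at `t`, and they differ with probability at most `ε`. The bound is
uniform in `A`, which gives both the Cauchy property and countable additivity of the limit. -/
lemma exists_abs_stateLaw_sub_le {ε : ℝ} (hε : 0 < ε) : ∃ t₀ : ℝ, ∀ t ≥ t₀, ∀ h ≥ 0,
    ∀ A : Set (T → ℕ), |(π.stateLaw I (h + t)).real A - (π.stateLaw I t).real A| ≤ ε := by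
  obtain ⟨t₀, _, ht⟩ := I.exists_law_present_ne_le π (ENNReal.ofReal_pos.2 hε)
  refine ⟨t₀, fun t htt h hh A => ?_⟩
  set D : Set (Outcome T × Outcome T) :=
    {p | π.present (restart h p.1 p.2) (h + t) ≠ π.present p.2 t} with hD
  set X : Set (Outcome T × Outcome T) := {p | π.present (restart h p.1 p.2) (h + t) ∈ A} with hX
  set Y : Set (Outcome T × Outcome T) := {p | π.present p.2 t ∈ A} with hY
  have hD' : (I.law.prod I.law).real D ≤ ε := by
    rw [measureReal_def]
    exact ENNReal.toReal_le_of_le_ofReal hε.le (ht t htt h hh)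
  have h1 : (π.stateLaw I (h + t)).real A = (I.law.prod I.law).real X := by
    rw [stateLaw_real, measureReal_def, I.law_eq_restart hh (π.measurableSet_present_at _ A)]
    rfl
  have h2 : (π.stateLaw I t).real A = (I.law.prod I.law).real Y := by
    rw [stateLaw_real, measureReal_def, measureReal_def]
    have : Y = Set.univ ×ˢ {ω | π.present ω t ∈ A} := by ext; simp [hY]
    rw [this, Measure.prod_prod, measure_univ, one_mul]
  have h3 : X ⊆ Y ∪ D := fun p hp => by
    by_cases h : p ∈ D
    · exact .inr h
    · rw [hD, Set.mem_ofPred_eq, not_not] at h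
      exact .inl (show π.present p.2 t ∈ A from h ▸ hp)
  have h4 : Y ⊆ X ∪ D := fun p hp => by
    by_cases h : p ∈ D
    · exact .inr h
    · rw [hD, Set.mem_ofPred_eq, not_not] at h
      exact .inl (show π.present (restart _ p.1 p.2) _ ∈ A from h.symm ▸ hp)
  have h5 := (measureReal_mono h3).trans (measureReal_union_le (μ := I.law.prod I.law) Y D)
  have h6 := (measureReal_mono h4).trans (measureReal_union_le (μ := I.law.prod I.law) X D)
  rw [h1, h2, abs_le]
  constructor <;> linarith

/-- The limiting probability that the state is in `A`. -/
noncomputable def stateLimit (A : Set (T → ℕ)) : ℝ :=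
  limUnder atTop fun t => (π.stateLaw I t).real A

lemma tendsto_stateLaw (A : Set (T → ℕ)) :
    Tendsto (fun t => (π.stateLaw I t).real A) atTop (𝓝 (π.stateLimit I A)) := by
  refine tendsto_nhds_limUnder (cauchySeq_tendsto_of_complete (Metric.cauchySeq_iff'.2 ?_))
  intro ε hε
  obtain ⟨t₀, ht⟩ := π.exists_abs_stateLaw_sub_le I (half_pos hε)
  refine ⟨t₀, fun t htt => ?_⟩
  have := ht t₀ le_rfl (t - t₀) (sub_nonneg.2 htt) A
  rw [sub_add_cancel] at this
  rw [Real.dist_eq]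
  linarith

lemma exists_abs_stateLimit_sub_le {ε : ℝ} (hε : 0 < ε) : ∃ t : ℝ,
    ∀ A : Set (T → ℕ), |π.stateLimit I A - (π.stateLaw I t).real A| ≤ ε := by
  obtain ⟨t₀, ht⟩ := π.exists_abs_stateLaw_sub_le I hε
  refine ⟨t₀, fun A => ?_⟩
  refine le_of_tendsto ((π.tendsto_stateLaw I A).sub_const _).abs ?_
  filter_upwards [eventually_ge_atTop t₀] with t htt
  have := ht t₀ le_rfl (t - t₀) (sub_nonneg.2 htt) A
  rwa [sub_add_cancel] at this

lemma stateLimit_nonneg (A : Set (T → ℕ)) : 0 ≤ π.stateLimit I A :=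
  ge_of_tendsto' (π.tendsto_stateLaw I A) fun _ => measureReal_nonneg

lemma sum_stateLimit_singleton (F : Finset (T → ℕ)) :
    ∑ m ∈ F, π.stateLimit I {m} = π.stateLimit I F := by
  refine tendsto_nhds_unique (tendsto_finsetSum F fun m _ => π.tendsto_stateLaw I {m}) ?_
  simp only [sum_measureReal_singleton]
  exact π.tendsto_stateLaw I F

/-- No mass escapes to infinity: the limit is within `ε / 4` of the law at one time, uniformly over
all sets, and that law is countably additive. The partial sums are limits of probabilities of finite
sets, so they inherit the approximation. -/
lemma hasSum_stateLimit (A : Set (T → ℕ)) :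
    HasSum (A.indicator fun m => π.stateLimit I {m}) (π.stateLimit I A) := by
  rw [HasSum, Metric.tendsto_nhds]
  intro ε hε
  obtain ⟨t, ht⟩ := π.exists_abs_stateLimit_sub_le I (show 0 < ε / 4 by linarith)
  have h1 : HasSum (A.indicator fun m => (π.stateLaw I t).real {m}) ((π.stateLaw I t).real A) := by
    have h2 := (π.stateLaw I t).tsum_indicator_apply_singleton A A.to_countable.measurableSet
    have h3 := ENNReal.hasSum_toReal (f := A.indicator fun m => π.stateLaw I t {m})
      (by rw [h2]; exact measure_ne_top _ _)
    rw [← ENNReal.tsum_toReal_eq (ENNReal.ne_top_of_tsum_ne_top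
      (by rw [h2]; exact measure_ne_top _ _)), h2] at h3
    have h4 : (A.indicator fun m => (π.stateLaw I t).real {m}) =
        fun m => (A.indicator (fun m => π.stateLaw I t {m}) m).toReal := by
      ext m
      by_cases hm : m ∈ A <;> simp [hm, measureReal_def]
    rw [h4, measureReal_def]
    exact h3
  have hfil : ∀ (F : Finset (T → ℕ)) (f : (T → ℕ) → ℝ),
      ∑ m ∈ F, A.indicator f m = ∑ m ∈ F.filter (· ∈ A), f m := fun F f => by
    rw [Finset.sum_filter]
    rfl
  rw [HasSum, Metric.tendsto_nhds] at h1
  filter_upwards [h1 (ε / 4) (by linarith)] with F hF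
  rw [Real.dist_eq] at hF ⊢
  rw [hfil] at hF ⊢
  simp only [sum_measureReal_singleton, sum_stateLimit_singleton] at hF ⊢
  have h4 := abs_le.1 (ht ↑(F.filter (· ∈ A)))
  have h5 := abs_le.1 (ht A)
  have h6 := abs_lt.1 hF
  rw [abs_lt]
  constructor <;> linarith [h4.1, h4.2, h5.1, h5.2, h6.1, h6.2]

/-- `steadyState` is assembled from the limits at single states; by countable additivity it gives
every set the limit of its probabilities. -/
lemma steadyState_real (A : Set (T → ℕ)) : (π.steadyState I).real A = π.stateLimit I A := by
  have hs : ∀ m, (limUnder atTop fun t : ℝ => I.law.real {ω | π.present ω t = m}) =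
      π.stateLimit I {m} := fun m => by
    rw [stateLimit]
    simp only [stateLaw_real]
    rfl
  have h1 : π.steadyState I A = ENNReal.ofReal (π.stateLimit I A) := by
    rw [steadyState, Measure.sum_apply _ A.to_countable.measurableSet,
      ← (π.hasSum_stateLimit I A).tsum_eq, ENNReal.ofReal_tsum_of_nonneg
        (fun m => Set.indicator_nonneg (fun m _ => π.stateLimit_nonneg I {m}) m)
        (π.hasSum_stateLimit I A).summable]
    refine tsum_congr fun m => ?_
    rw [hs, Measure.smul_apply, Measure.dirac_apply]
    by_cases hm : m ∈ A <;> simp [hm]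
  rw [measureReal_def, h1, ENNReal.toReal_ofReal (π.stateLimit_nonneg I A)]

lemma topProb_eq (i j : T) (t : ℝ) :
    π.topProb I j i t = (π.stateLaw I t).real {m | π.IsTop j i m} :=
  (π.stateLaw_real I t {m | π.IsTop j i m}).symm

lemma tendsto_topProb (j i : T) :
    Tendsto (π.topProb I j i) atTop (𝓝 (π.stateLimit I {m | π.IsTop j i m})) := by
  have : π.topProb I j i = fun t => (π.stateLaw I t).real {m | π.IsTop j i m} :=
    funext (π.topProb_eq I i j)
  rw [this]
  exact π.tendsto_stateLaw I _

end GreedyPolicy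

end Limits

/-! ### Limits of means and reward rates, and steady-state balance -/

section Rates

open scoped ENNReal
open scoped Classical

lemma setLIntegral_Ioo_ofReal {f : ℝ → ℝ} (hfi : ∀ a b, IntervalIntegrable f volume a b)
    (hf : ∀ s, 0 ≤ f s) {t : ℝ} (ht : 0 ≤ t) :
    ∫⁻ s in Set.Ioo 0 t, ENNReal.ofReal (f s) = ENNReal.ofReal (∫ s in (0 : ℝ)..t, f s) := by
  rw [intervalIntegral.integral_of_le ht, integral_Ioc_eq_integral_Ioo,
    ofReal_integral_eq_lintegral_ofReal _ (ae_of_all _ hf)]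
  exact ((hfi 0 t).1).mono_set Set.Ioo_subset_Ioc_self

variable {T : Type*}

lemma intervalIntegrable_sum [Fintype T] {f : T → ℝ → ℝ} {a b : ℝ}
    (h : ∀ j, IntervalIntegrable (f j) volume a b) :
    IntervalIntegrable (fun s => ∑ j, f j s) volume a b :=
  ⟨integrable_finsetSum _ fun j _ => (h j).1, integrable_finsetSum _ fun j _ => (h j).2⟩

namespace GreedyPolicy

variable (π : GreedyPolicy T) (I : MatchingInstance T)

lemma topProb_nonneg (j i : T) (t : ℝ) : 0 ≤ π.topProb I j i t := measureReal_nonneg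

lemma law_isTop (j i : T) (t : ℝ) :
    I.law {ω | π.IsTop j i (π.present ω t)} = ENNReal.ofReal (π.topProb I j i t) :=
  (ofReal_measureReal).symm

lemma meanAt_nonneg (i : T) (t : ℝ) : 0 ≤ π.meanAt I i t :=
  integral_nonneg fun _ => Nat.cast_nonneg _

variable [Fintype T]

lemma measurable_topProb (j i : T) : Measurable (π.topProb I j i) :=
  (measurable_measure_prodMk_right (μ := I.law)
    (π.measurableSet_present {m | π.IsTop j i m})).ennreal_toReal

lemma intervalIntegrable_topProb (j i : T) (a b : ℝ) :
    IntervalIntegrable (π.topProb I j i) volume a b := by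
  refine (intervalIntegrable_const (c := (1 : ℝ))).mono_fun'
    (π.measurable_topProb I j i).aestronglyMeasurable (ae_of_all _ fun t => ?_)
  change ‖π.topProb I j i t‖ ≤ 1
  rw [Real.norm_of_nonneg (π.topProb_nonneg I j i t)]
  exact measureReal_le_one

lemma setLIntegral_law_isTop (j i : T) {t : ℝ} (ht : 0 ≤ t) :
    ∫⁻ s in Set.Ioo 0 t, I.law {ω | π.IsTop j i (π.present ω s)} =
      ENNReal.ofReal (∫ s in (0 : ℝ)..t, π.topProb I j i s) := by
  simp only [law_isTop]
  exact setLIntegral_Ioo_ofReal (π.intervalIntegrable_topProb I j i) (π.topProb_nonneg I j i) ht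

/-- One term of the flow identity is bounded by the whole, which supplies the finiteness needed to
pass to real-valued means. -/
lemma lintegral_present_le (i : T) (t : ℝ) :
    ∫⁻ ω, (π.present ω t i : ℝ≥0∞) ∂I.law ≤ ENNReal.ofReal (I.lam i) * ENNReal.ofReal t := by
  rw [π.lintegral_flow I t i, add_assoc, add_assoc]
  exact le_self_add

lemma meanAt_eq_toReal (i : T) (t : ℝ) :
    π.meanAt I i t = (∫⁻ ω, (π.present ω t i : ℝ≥0∞) ∂I.law).toReal := by
  rw [meanAt, integral_eq_lintegral_of_nonneg_ae (ae_of_all _ fun _ => Nat.cast_nonneg _)]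
  · simp
  · exact ((measurable_of_countable (fun m : T → ℕ => (m i : ℝ))).comp
      (π.measurable_present_at t)).aestronglyMeasurable

lemma lintegral_present (i : T) (t : ℝ) :
    ∫⁻ ω, (π.present ω t i : ℝ≥0∞) ∂I.law = ENNReal.ofReal (π.meanAt I i t) := by
  rw [meanAt_eq_toReal, ENNReal.ofReal_toReal]
  exact ne_top_of_le_ne_top (ENNReal.mul_ne_top (by simp) (by simp)) (π.lintegral_present_le I i t)

lemma intervalIntegrable_meanAt (i : T) (a b : ℝ) :
    IntervalIntegrable (π.meanAt I i) volume a b := by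
  have hm : Measurable (π.meanAt I i) := by
    have h : π.meanAt I i = fun t => (∫⁻ ω, (π.present ω t i : ℝ≥0∞) ∂I.law).toReal :=
      funext (π.meanAt_eq_toReal I i)
    rw [h]
    exact ((π.measurable_present i).lintegral_prod_left' (μ := I.law)).ennreal_toReal
  have hc : Continuous fun t : ℝ => I.lam i * |t| := by fun_prop
  refine (hc.intervalIntegrable a b).mono_fun' hm.aestronglyMeasurable (ae_of_all _ fun t => ?_)
  change ‖π.meanAt I i t‖ ≤ _
  rw [Real.norm_of_nonneg (π.meanAt_nonneg I i t)]
  have h1 := π.lintegral_present_le I i t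
  have hl := I.lam_pos i
  rw [lintegral_present, ← ENNReal.ofReal_mul hl.le] at h1
  have h2 : ENNReal.ofReal (π.meanAt I i t) ≤ ENNReal.ofReal (I.lam i * |t|) :=
    h1.trans (ENNReal.ofReal_le_ofReal (mul_le_mul_of_nonneg_left (le_abs_self t) hl.le))
  exact (ENNReal.ofReal_le_ofReal_iff (by positivity)).1 h2

lemma meanAt_flow (i : T) {t : ℝ} (ht : 0 ≤ t) :
    π.meanAt I i t = ∫ s in (0 : ℝ)..t,
      (I.lam i - (∑ j, I.lam j * π.topProb I j i s + ∑ j, I.lam i * π.topProb I i j s) -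
        I.mu i * π.meanAt I i s) := by
  have hflow := π.lintegral_flow I t i
  have hint : ∀ j k, 0 ≤ ∫ s in (0 : ℝ)..t, π.topProb I j k s := fun j k =>
    intervalIntegral.integral_nonneg ht fun s _ => π.topProb_nonneg I j k s
  have hint' : 0 ≤ ∫ s in (0 : ℝ)..t, π.meanAt I i s :=
    intervalIntegral.integral_nonneg ht fun s _ => π.meanAt_nonneg I i s
  have h1 : ∀ j k l, 0 ≤ I.lam l * ∫ s in (0 : ℝ)..t, π.topProb I j k s := fun j k l =>
    mul_nonneg (I.lam_pos l).le (hint j k)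
  simp only [lintegral_present, π.setLIntegral_law_isTop I _ _ ht,
    setLIntegral_Ioo_ofReal (π.intervalIntegrable_meanAt I i) (π.meanAt_nonneg I i) ht,
    ← ENNReal.ofReal_mul (I.lam_pos _).le, ← ENNReal.ofReal_mul (I.mu_pos _).le] at hflow
  have h2 := I.mu_pos i
  have h3 := π.meanAt_nonneg I i t
  have h4 : 0 ≤ ∑ j, I.lam j * ∫ s in (0 : ℝ)..t, π.topProb I j i s :=
    Finset.sum_nonneg fun j _ => h1 j i j
  have h5 : 0 ≤ ∑ j, I.lam i * ∫ s in (0 : ℝ)..t, π.topProb I i j s :=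
    Finset.sum_nonneg fun j _ => h1 i j i
  rw [← ENNReal.ofReal_sum_of_nonneg fun j _ => h1 j i j,
    ← ENNReal.ofReal_sum_of_nonneg fun j _ => h1 i j i,
    ← ENNReal.ofReal_add h3 (by positivity), ← ENNReal.ofReal_add (by positivity) h4,
    ← ENNReal.ofReal_add (by positivity) h5, ENNReal.ofReal_eq_ofReal_iff
      (mul_nonneg (I.lam_pos i).le ht) (by positivity)] at hflow
  have hti : ∀ j k l, IntervalIntegrable (fun s => I.lam l * π.topProb I j k s) volume 0 t :=
    fun j k l => (π.intervalIntegrable_topProb I j k 0 t).const_mul _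
  have hs1 : IntervalIntegrable (fun s => ∑ j, I.lam j * π.topProb I j i s) volume 0 t :=
    intervalIntegrable_sum fun j => hti j i j
  have hs2 : IntervalIntegrable (fun s => ∑ j, I.lam i * π.topProb I i j s) volume 0 t :=
    intervalIntegrable_sum fun j => hti i j i
  rw [intervalIntegral.integral_sub (intervalIntegrable_const.sub (hs1.add hs2))
      ((π.intervalIntegrable_meanAt I i 0 t).const_mul _),
    intervalIntegral.integral_sub intervalIntegrable_const (hs1.add hs2),
    intervalIntegral.integral_add hs1 hs2,
    intervalIntegral.integral_finsetSum fun j _ => hti j i j,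
    intervalIntegral.integral_finsetSum fun j _ => hti i j i]
  simp only [intervalIntegral.integral_const_mul, intervalIntegral.integral_const, smul_eq_mul,
    sub_zero]
  linarith

/-- The limiting probability that an arriving agent of type `j` is matched with type `i`. -/
noncomputable def topLimit (j i : T) : ℝ := π.stateLimit I {m | π.IsTop j i m}

/-- The mean relaxes at rate `μ_i` towards a net inflow, arrivals minus matches in either role, that
converges because match probabilities do. No uniform integrability is needed, and the form of the
limit is already the balance equation. -/
lemma tendsto_meanAt (i : T) : Tendsto (π.meanAt I i) atTop (𝓝 ((I.lam i -
    (∑ j, I.lam j * π.topLimit I j i + ∑ j, I.lam i * π.topLimit I i j)) / I.mu i)) := by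
  refine tendsto_of_relaxation (I.mu_pos i) (π.intervalIntegrable_meanAt I i) (fun a b => ?_)
    (fun t ht => π.meanAt_flow I i ht) ?_
  · exact intervalIntegrable_const.sub
      ((intervalIntegrable_sum fun j =>
        (π.intervalIntegrable_topProb I j i a b).const_mul _).add
      (intervalIntegrable_sum fun j =>
        (π.intervalIntegrable_topProb I i j a b).const_mul _))
  · exact tendsto_const_nhds.sub
      ((tendsto_finsetSum _ fun j _ => (π.tendsto_topProb I j i).const_mul _).add
      (tendsto_finsetSum _ fun j _ => (π.tendsto_topProb I i j).const_mul _))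

/-- Balance of arrivals, abandonments and matches in the steady state. -/
lemma meanPresent_balance (i : T) :
    π.meanPresent I i * I.mu i + ∑ j, I.lam j * π.topLimit I j i + ∑ j, I.lam i * π.topLimit I i j =
      I.lam i := by
  have h : π.meanPresent I i = _ := (π.tendsto_meanAt I i).limUnder_eq
  rw [h, div_mul_cancel₀ _ (I.mu_pos i).ne']
  ring

lemma integral_matchCount (i j : T) {t : ℝ} (ht : 0 ≤ t) :
    Integrable (fun ω : Outcome T => (π.matchCount ω t i j : ℝ)) I.law ∧
    ∫ ω, (π.matchCount ω t i j : ℝ) ∂I.law = I.lam j * ∫ s in (0 : ℝ)..t, π.topProb I j i s := by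
  have h1 := π.lintegral_matchCount I t i j
  rw [π.setLIntegral_law_isTop I j i ht, ← ENNReal.ofReal_mul (I.lam_pos j).le] at h1
  have h2 : AEStronglyMeasurable (fun ω : Outcome T => (π.matchCount ω t i j : ℝ)) I.law := by
    have := (π.aemeasurable_matchCount I t i j).ennreal_toReal
    simpa using this.aestronglyMeasurable
  have h3 : ∫⁻ ω, ENNReal.ofReal (π.matchCount ω t i j : ℝ) ∂I.law =
      ENNReal.ofReal (I.lam j * ∫ s in (0 : ℝ)..t, π.topProb I j i s) := by
    rw [← h1]
    simp
  have h0 : 0 ≤ᵐ[I.law] fun ω : Outcome T => (π.matchCount ω t i j : ℝ) :=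
    ae_of_all _ fun _ => Nat.cast_nonneg _
  constructor
  · refine ⟨h2, ?_⟩
    rw [hasFiniteIntegral_iff_ofReal h0, h3]
    exact ENNReal.ofReal_lt_top
  · rw [integral_eq_lintegral_of_nonneg_ae h0 h2, h3, ENNReal.toReal_ofReal]
    exact mul_nonneg (I.lam_pos j).le
      (intervalIntegral.integral_nonneg ht fun s _ => π.topProb_nonneg I j i s)

lemma valueAt_eq {t : ℝ} (ht : 0 ≤ t) : π.valueAt I t =
    ∑ i, ∑ j, I.r i j * (I.lam j * ((1 / t) * ∫ s in (0 : ℝ)..t, π.topProb I j i s)) := by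
  rw [valueAt, integral_congr_ae (I.ae_noCoincidence.mono fun ω hω => π.totalReward_eq I hω t),
    integral_finsetSum _ fun i _ => integrable_finsetSum _ fun j _ =>
      (π.integral_matchCount I i j ht).1.const_mul _, Finset.mul_sum]
  refine Finset.sum_congr rfl fun i _ => ?_
  rw [integral_finsetSum _ fun j _ => (π.integral_matchCount I i j ht).1.const_mul _,
    Finset.mul_sum]
  refine Finset.sum_congr rfl fun j _ => ?_
  rw [integral_const_mul, (π.integral_matchCount I i j ht).2]
  ring

/-- The reward by time `t` accrues at rate `∑ r_ij λ_j topProb`, so `valueAt` is a time average of a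
convergent function. -/
lemma tendsto_valueAt : Tendsto (π.valueAt I) atTop
    (𝓝 (∑ i, ∑ j, I.r i j * (I.lam j * π.topLimit I j i))) := by
  have h : Tendsto (fun t : ℝ => ∑ i, ∑ j, I.r i j *
      (I.lam j * ((1 / t) * ∫ s in (0 : ℝ)..t, π.topProb I j i s))) atTop
      (𝓝 (∑ i, ∑ j, I.r i j * (I.lam j * π.topLimit I j i))) :=
    tendsto_finsetSum _ fun i _ => tendsto_finsetSum _ fun j _ => Tendsto.const_mul _
      (Tendsto.const_mul _ (tendsto_average (π.intervalIntegrable_topProb I j i)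
        (π.tendsto_topProb I j i)))
  refine h.congr' ?_
  filter_upwards [eventually_ge_atTop 0] with t ht
  exact (π.valueAt_eq I ht).symm

lemma topLimit_eq_zero {j i : T} (h : ¬ π.prefers j (some i) none) : π.topLimit I j i = 0 := by
  have h1 : {m | π.IsTop j i m} = ∅ := Set.eq_empty_of_forall_notMem fun m hm => h hm.1
  refine tendsto_nhds_unique (π.tendsto_stateLaw I _) ?_
  rw [h1]
  simp only [measureReal_empty]
  exact tendsto_const_nhds

/-- An arriving agent is matched within a prefix of its preferences whenever such a match is
possible. -/
lemma sum_topLimit {j : T} {S : Finset T} (hS : S ∈ π.prefixes j) :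
    ∑ i ∈ S, π.topLimit I j i = π.stateLimit I {m | 0 < ∑ i ∈ S, m i} := by
  refine tendsto_nhds_unique (tendsto_finsetSum S fun i _ => π.tendsto_stateLaw I _) ?_
  refine (π.tendsto_stateLaw I {m | 0 < ∑ i ∈ S, m i}).congr fun t => ?_
  have := π.isStrictTotalOrder j
  have htr : ∀ {a b c}, π.prefers j a b → π.prefers j b c → π.prefers j a c :=
    fun h h' => _root_.trans h h'
  have hirr : ∀ a, ¬ π.prefers j a a := fun a => irrefl a
  obtain ⟨i₀, hi₀, hmem⟩ := hS
  -- A prefix is closed under passing to preferred types and contains only acceptable ones. So if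
  -- some type of `S` is present, the best type present lies in `S`, and it is unique: the union is
  -- disjoint.
  have hset : {m : T → ℕ | 0 < ∑ i ∈ S, m i} = ⋃ i ∈ S, {m | π.IsTop j i m} := by
    ext m
    simp only [Set.mem_ofPred_eq, Set.mem_iUnion, exists_prop]
    constructor
    · intro h
      obtain ⟨i, hi, him⟩ := Finset.exists_ne_zero_of_sum_ne_zero h.ne'
      have hne : (S.filter fun k => 0 < m k).Nonempty :=
        ⟨i, Finset.mem_filter.2 ⟨hi, Nat.pos_of_ne_zero him⟩⟩
      -- Since `prefers j u v` means `u ≻_j v`, a minimal element for this relation is a most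
      -- preferred type.
      have hwf : WellFounded fun a b : T => π.prefers j (some a) (some b) := by
        have : IsTrans T fun a b : T => π.prefers j (some a) (some b) := ⟨fun _ _ _ => htr⟩
        have : Std.Irrefl fun a b : T => π.prefers j (some a) (some b) := ⟨fun a => hirr _⟩
        exact Finite.wellFounded_of_trans_of_irrefl _
      obtain ⟨k, hk, hmin⟩ := hwf.has_min (↑(S.filter fun k => 0 < m k) : Set T) hne
      rw [Finset.mem_coe, Finset.mem_filter] at hk
      have hk0 : ∀ l, π.prefers j (some l) (some k) → l ∈ S := fun l hl => by
        rcases (hmem k).1 hk.1 with rfl | h'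
        · exact (hmem l).2 (.inr hl)
        · exact (hmem l).2 (.inr (htr hl h'))
      refine ⟨k, hk.1, ?_, hk.2, fun l hl => ?_⟩
      · rcases (hmem k).1 hk.1 with rfl | h'
        · exact hi₀
        · exact htr h' hi₀
      · by_contra hl0
        exact hmin l (Finset.mem_coe.2 (Finset.mem_filter.2 ⟨hk0 l hl, Nat.pos_of_ne_zero hl0⟩)) hl
    · rintro ⟨i, hi, -, him, -⟩
      exact him.trans_le (Finset.single_le_sum (f := m) (fun _ _ => Nat.zero_le _) hi)
  rw [hset, measureReal_biUnion_finset]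
  · intro i hi k hk hik
    rw [Function.onFun, Set.disjoint_left]
    rintro m ⟨-, h1, h2⟩ ⟨-, h3, h4⟩
    have htri := trichotomous_of (π.prefers j) (some i) (some k)
    rcases htri with h | h | h
    · exact h1.ne' (h4 i h)
    · exact hik (Option.some.inj h)
    · exact h3.ne' (h2 k h)
  · exact fun i _ => (Set.to_countable _).measurableSet

end GreedyPolicy

end Rates

/-! ### Comparing an optimal solution with an infeasible point -/

section LinearProgram

/-- A single inequality constraint along the ray from `p` away from `q`: if it is slack at `p`, a
small step keeps it; if it is tight, the step moves in the permitted direction. -/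
lemma eventually_nonneg_add_mul_sub {a b : ℝ} (ha : 0 ≤ a) (hab : a = 0 → b ≤ 0) :
    ∀ᶠ ε in 𝓝[>] (0 : ℝ), 0 ≤ a + ε * (a - b) := by
  rcases ha.eq_or_lt with h | h
  · filter_upwards [self_mem_nhdsWithin] with ε hε
    have hε' : 0 < ε := hε
    have := hab h.symm
    rw [← h]
    nlinarith
  · have hc : Tendsto (fun ε : ℝ => a + ε * (a - b)) (𝓝[>] 0) (𝓝 (a + 0 * (a - b))) :=
      (Continuous.tendsto (by fun_prop) 0).mono_left nhdsWithin_le_nhds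
    rw [zero_mul, add_zero] at hc
    exact (hc.eventually_const_lt h).mono fun _ => le_of_lt

namespace LPPoint

variable {T : Type*} [Fintype T] [DecidableEq T]

/-- A point that satisfies the equality constraints, and violates only inequality constraints that
are not tight at the optimal solution `p`, on the side opposite to a feasible direction, is at
least as good as `p`. -/
lemma IsOptimal.objective_le {I : MatchingInstance T} {M : Finset (T × T)} {p q : LPPoint T}
    (hp : p.IsOptimal I M)
    (hb : ∀ i, q.n i * I.mu i + ∑ j with (i, j) ∈ M, q.x i j + ∑ j with (j, i) ∈ M, q.x j i
      = I.lam i)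
    (hm : ∀ j S, IsSlackIndex M S j →
      ∑ i ∈ S, q.x i j + q.psi S j = I.lam j * I.gamma S * ∑ i ∈ S, q.n i)
    (hx : ∀ i j, (i, j) ∈ M → p.x i j = 0 → q.x i j ≤ 0)
    (hψ : ∀ j S, IsSlackIndex M S j → p.psi S j = 0 → q.psi S j ≤ 0) :
    p.objective I M ≤ q.objective I M := by
  obtain ⟨hpf, hpo⟩ := hp
  have h1 : ∀ᶠ ε in 𝓝[>] (0 : ℝ), ∀ i j, (i, j) ∈ M →
      0 ≤ p.x i j + ε * (p.x i j - q.x i j) := by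
    refine eventually_all.2 fun i => eventually_all.2 fun j => ?_
    by_cases h : (i, j) ∈ M
    · exact (eventually_nonneg_add_mul_sub (hpf.x_nonneg i j h) (hx i j h)).mono fun _ h' _ => h'
    · exact Eventually.of_forall fun _ h' => absurd h' h
  have h2 : ∀ᶠ ε in 𝓝[>] (0 : ℝ), ∀ j S, IsSlackIndex M S j →
      0 ≤ p.psi S j + ε * (p.psi S j - q.psi S j) := by
    refine eventually_all.2 fun j => eventually_all.2 fun S => ?_
    by_cases h : IsSlackIndex M S j
    · exact (eventually_nonneg_add_mul_sub (hpf.psi_nonneg j S h) (hψ j S h)).mono fun _ h' _ => h'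
    · exact Eventually.of_forall fun _ h' => absurd h' h
  obtain ⟨ε, ⟨h3, h4⟩, hε⟩ := ((h1.and h2).and self_mem_nhdsWithin).exists
  have hε' : 0 < ε := hε
  -- The point `p + ε (p - q)` is an affine combination of `p` and `q`, hence satisfies the
  -- equalities. Its objective exceeds that of `p` by `ε` times the difference of the objectives,
  -- which therefore cannot be positive.
  have h5 := hpo ⟨fun i => p.n i + ε * (p.n i - q.n i),
    fun i j => p.x i j + ε * (p.x i j - q.x i j),
    fun S j => p.psi S j + ε * (p.psi S j - q.psi S j)⟩
    { balance := fun i => by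
        have e1 := hpf.balance i
        have e2 := hb i
        simp only [Finset.sum_add_distrib, ← Finset.mul_sum, Finset.sum_sub_distrib]
        linear_combination (1 + ε) * e1 - ε * e2
      matchRate := fun j S hS => by
        have e1 := hpf.matchRate j S hS
        have e2 := hm j S hS
        simp only [Finset.sum_add_distrib, ← Finset.mul_sum, Finset.sum_sub_distrib]
        linear_combination (1 + ε) * e1 - ε * e2
      x_nonneg := h3
      psi_nonneg := h4 }
  have h6 : ∑ m ∈ M, I.r m.1 m.2 * (p.x m.1 m.2 + ε * (p.x m.1 m.2 - q.x m.1 m.2)) =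
      p.objective I M + ε * (p.objective I M - q.objective I M) := by
    simp only [objective, mul_sub, Finset.mul_sum, ← Finset.sum_add_distrib,
      ← Finset.sum_sub_distrib]
    exact Finset.sum_congr rfl fun m _ => by ring
  rw [objective, h6] at h5
  nlinarith

lemma IsOptimal.lpValue_eq {I : MatchingInstance T} {M : Finset (T × T)} {p : LPPoint T}
    (hp : p.IsOptimal I M) : lpValue I M = p.objective I M := by
  refine IsGreatest.csSup_eq ⟨⟨p, hp.1, rfl⟩, ?_⟩
  rintro _ ⟨q, hq, rfl⟩
  exact hp.2 q hq

end LPPoint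

end LinearProgram

/-! ### The proposition -/

theorem mainTheorem3 {T : Type*} [Fintype T] [DecidableEq T] (I : MatchingInstance T)
    (M : Finset (T × T)) (p : LPPoint T) (hopt : p.IsOptimal I M) (hsuit : p.IsSuitable I M)
    (π : GreedyPolicy T) (hπ : p.Corresponds M π)
    (hγ : ∀ j S, IsSlackIndex M S j → p.psi S j = 0 →
      (π.steadyState I).real {m | 0 < ∑ i ∈ S, m i} ≥ I.gamma S * ∑ i ∈ S, π.meanPresent I i) :
    Tendsto (π.valueAt I) atTop (𝓝 (π.value I)) ∧ π.value I ≥ lpValue I M := by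
  have hlim := π.tendsto_valueAt I
  have hval : π.value I = _ := hlim.limUnder_eq
  rw [hval]
  refine ⟨hlim, ?_⟩
  -- A match that occurs has `i` acceptable to `j`. The prefix ending at `i` is then a slack index
  -- with `ψ = 0`, and suitability makes `x_ij` positive.
  have hsup : ∀ i j, π.topLimit I j i ≠ 0 → (i, j) ∈ M ∧ 0 < p.x i j := by
    intro i j h
    have h1 : π.prefers j (some i) none := by
      by_contra h'
      exact h (π.topLimit_eq_zero I h')
    classical
    set S : Finset T := {k | k = i ∨ π.prefers j (some k) (some i)} with hS
    have hSp : S ∈ π.prefixes j := ⟨i, h1, fun k => by simp [hS]⟩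
    have hiS : i ∈ S := by simp [hS]
    rw [hπ j] at hSp
    exact ⟨hSp.1.2 i hiS, hsuit.2 j S hSp.1 hSp.2 i hiS⟩
  have hz : ∀ i j, (i, j) ∉ M → I.lam j * π.topLimit I j i = 0 := fun i j h => by
    by_contra h'
    exact h (hsup i j (right_ne_zero_of_mul h')).1
  -- The steady state of `π` as a point of the program, with `ψ` defined so that the match-rate
  -- equations hold; `ψ` may be negative.
  set q : LPPoint T := ⟨π.meanPresent I, fun i j => I.lam j * π.topLimit I j i, fun S j =>
    I.lam j * I.gamma S * ∑ i ∈ S, π.meanPresent I i - ∑ i ∈ S, I.lam j * π.topLimit I j i⟩ with hq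
  have hobj : q.objective I M = ∑ i, ∑ j, I.r i j * (I.lam j * π.topLimit I j i) := by
    rw [LPPoint.objective, ← Fintype.sum_prod_type'
      fun i j => I.r i j * (I.lam j * π.topLimit I j i)]
    refine Finset.sum_subset (Finset.subset_univ M) fun m _ hm => ?_
    change _ * (I.lam m.2 * π.topLimit I m.2 m.1) = 0
    rw [hz _ _ hm, mul_zero]
  rw [hopt.lpValue_eq, ← hobj]
  refine hopt.objective_le (fun i => ?_) (fun j S _ => ?_) (fun i j _ h => ?_) fun j S hS h => ?_
  · have hb := π.meanPresent_balance I i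
    have e1 : ∑ j with (j, i) ∈ M, q.x j i = ∑ j, I.lam i * π.topLimit I i j :=
      Finset.sum_filter_of_ne fun j _ h' => by
        by_contra h''
        exact h' (hz j i h'')
    have e2 : ∑ j with (i, j) ∈ M, q.x i j = ∑ j, I.lam j * π.topLimit I j i :=
      Finset.sum_filter_of_ne fun j _ h' => by
        by_contra h''
        exact h' (hz i j h'')
    rw [e1, e2]
    exact hb
  · simp only [hq]
    ring
  · by_contra h'
    exact (hsup i j fun h0 => h' (by simp [hq, h0])).2.ne' h
  -- For a prefix, the match rate within `S` is `λ_j` times the probability that `S` is occupied,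
  -- which by hypothesis is at least the right side of the match-rate constraint; so the slack of
  -- `q` is at most zero.
  · have hpre : S ∈ π.prefixes j := by
      rw [hπ j]
      exact ⟨hS, h⟩
    have h1 := hγ j S hS h
    rw [π.steadyState_real, ← π.sum_topLimit I hpre] at h1
    have h2 := mul_le_mul_of_nonneg_left h1 (I.lam_pos j).le
    simp only [hq, ← Finset.mul_sum]
    linarith
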